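/- Let $K$ be a field complete for a (nontrivial) discrete valuation, with valuation ring $\mathfrak{o}_K$ and a corresponding norm $|\cdot|$; no restriction is made on the characteristics of $K$ and of its residue field. Let $q>1$ be an integer and let $\phi_K$ be an isometric automorphism of $K$. For $r>0$ let $\tilde{\mathcal R}^r$ be the set of formal sums $\sum_{i\in\mathbb Q}a_iu^i$ with $a_i\in K$ such that: for each $c>0$ the set $\{i\in\mathbb{Q}:|a_i|\ge c\}$ is well-ordered; $\sup_i|a_i|e^{-ri}<\infty$; $|a_i|e^{-ri}\to0$ as $i\to-\infty$; and for all $s>0$, $|a_i|e^{-si}\to0$ as $i\to+\infty$. Let $\tilde{\mathcal R}=\bigcup_{r>0}\tilde{\mathcal R}^r$ be the extended Robba ring over $K$ (a commutative ring under the Cauchy product, containing $K$ as the constants), let $\tilde{\mathcal R}^{\mathrm{int}}$ be its subring of series with coefficients in $\mathfrak{o}_K$, and let $\phi$ act on $\tilde{\mathcal R}$ by $\phi(\sum_i a_iu^i)=\sum_i\phi_K(a_i)u^{qi}$. Let $w$ be the normalized valuation of $K$, extended to series with bounded coefficients by $w(\sum_i a_iu^i)=\min_i w(a_i)$. Let $(R,R^{\mathrm{int}},\phi)$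 be $(K,\mathfrak{o}_K,\phi_K)$ or $(\tilde{\mathcal R},\tilde{\mathcal R}^{\mathrm{int}},\phi)$. A $\phi$-module over $R$ is a finite free $R$-module $M$ with a $\phi$-semilinear map $\phi:M\to M$ whose linearization $\phi^*M\to M$ is an isomorphism; morphisms are $R$-linear maps commuting with $\phi$. It is trivial if it has a basis of $\phi$-fixed vectors, and étale if it is the base extension of a $\phi$-module over $R^{\mathrm{int}}$. Its degree is $w(r)$, where $\phi$ acts on a generator of the top exterior power of $M$ by multiplication by $r\in R^*$; its slope, if $M\neq0$, is its degree divided by its rank. The same notions are used for powers of $\phi$. For a rational number $s=c/d$ in lowest terms with $d>0$, $M$ is pure of slope $s$ if $M$ has slope $s$ and, for some $\phi^d$-module $N$ over $R$ of rank $1$ and degree $-c$, the $\phi^d$-module $[d]_*M\otimes N$ is étale, where $[d]_*M$ is $M$ with the action of $\phi^d$; the zero module is counted as pure of every slope. Assume that every étale $\phi$-module over $K$ is trivial. Then for every rational number $s$, base change $M\mapsto \tilde{\mathcal R}\otimes_KM$ carries pure $\phi$-modules of slope $s$ over $K$ to pure $\phi$-modules of slope $s$ over $\tilde{\mathcal R}$,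 and it is an equivalence between the categories of such modules. -/

import Mathlib

universe u

namespace Slopes

open Filter Topology
open scoped Pointwise

section Series

variable {K : Type u} [NontriviallyNormedField K]

/-- The weighted absolute value `|a_i| e^{-s i}` of the `i`-th term of the formal sum
`∑ a_i u^i`, with `i` rational. -/
noncomputable def wt (s : ℝ) (f : ℚ → K) (i : ℚ) : ℝ := ‖f i‖ * Real.exp (-(s * (i : ℝ)))

/-- Membership of the formal sum `∑ (f i) u^i` in the ring of extended Robba series of radius `r`:
for each `c > 0` the set of `i` with `|f i| ≥ c` is well-ordered, the norm `sup_i |f i| e^{-r i}` is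
finite, `|f i| e^{-r i} → 0` as `i → -∞`, and `|f i| e^{-s i} → 0` as `i → +∞` for every `s > 0`. -/
structure IsExtRobbaOn (r : ℝ) (f : ℚ → K) : Prop where
  wf : ∀ c : ℝ, 0 < c → {i : ℚ | c ≤ ‖f i‖}.IsWF
  bdd : BddAbove (Set.range (wt r f))
  bot : Tendsto (wt r f) atBot (𝓝 0)
  top : ∀ s : ℝ, 0 < s → Tendsto (wt s f) atTop (𝓝 0)

/-- Auxiliary condition on one circle `|u| = e^{-s}`. -/
structure GoodAt (s : ℝ) (f : ℚ → K) : Prop where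
  bdd : ∃ A : ℝ, 0 < A ∧ ∀ i, wt s f i ≤ A
  pwo : ∀ δ : ℝ, 0 < δ → {i : ℚ | δ ≤ wt s f i}.IsPWO
  above : ∀ δ : ℝ, 0 < δ → BddAbove {i : ℚ | δ ≤ wt s f i}

theorem wt_nonneg (s : ℝ) (f : ℚ → K) (i : ℚ) : 0 ≤ wt s f i := by
  unfold wt; positivity

theorem norm_eq_wt (s : ℝ) (f : ℚ → K) (i : ℚ) : ‖f i‖ = wt s f i * Real.exp (s * (i : ℝ)) := by
  unfold wt
  rw [mul_assoc, ← Real.exp_add]; simp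

theorem wt_change (s t : ℝ) (f : ℚ → K) (i : ℚ) :
    wt s f i = wt t f i * Real.exp ((t - s) * (i : ℝ)) := by
  unfold wt
  rw [mul_assoc, ← Real.exp_add]; congr 2; ring

theorem exists_lt_of_tendsto_atBot {F : ℚ → ℝ} (h : Tendsto F atBot (𝓝 0)) {δ : ℝ} (hδ : 0 < δ) :
    ∃ L : ℚ, ∀ i ≤ L, F i < δ :=
  eventually_atBot.1 (h.eventually (gt_mem_nhds hδ))

theorem exists_lt_of_tendsto_atTop {F : ℚ → ℝ} (h : Tendsto F atTop (𝓝 0)) {δ : ℝ} (hδ : 0 < δ) :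
    ∃ L : ℚ, ∀ i ≥ L, F i < δ :=
  eventually_atTop.1 (h.eventually (gt_mem_nhds hδ))

theorem IsExtRobbaOn.goodAt {r : ℝ} {f : ℚ → K} (h : IsExtRobbaOn r f) {s : ℝ} (hs : 0 < s)
    (hsr : s ≤ r) : GoodAt s f := by
  have habove : ∀ δ : ℝ, 0 < δ → BddAbove {i : ℚ | δ ≤ wt s f i} := by
    intro δ hδ
    obtain ⟨U, hU⟩ := exists_lt_of_tendsto_atTop (h.top s hs) hδ
    refine ⟨U, fun i hi => ?_⟩
    by_contra hlt
    exact absurd hi (not_le.2 (hU i (le_of_lt (not_le.1 hlt))))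
  refine ⟨?_, ?_, habove⟩
  · obtain ⟨A, hA⟩ := h.bdd
    obtain ⟨U, hU⟩ := habove 1 one_pos
    have hA' : ∀ i, wt r f i ≤ A := fun i => hA ⟨i, rfl⟩
    have hA0 : 0 ≤ A := (wt_nonneg r f 0).trans (hA' 0)
    refine ⟨max 1 (A * Real.exp ((r - s) * (U : ℝ))), by positivity, fun i => ?_⟩
    by_cases hi : 1 ≤ wt s f i
    · refine le_max_of_le_right ?_
      rw [wt_change s r]
      have hiU : (i : ℝ) ≤ U := by exact_mod_cast hU hi
      have h1 : (r - s) * (i : ℝ) ≤ (r - s) * (U : ℝ) :=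
        mul_le_mul_of_nonneg_left hiU (by linarith)
      exact mul_le_mul (hA' i) (Real.exp_le_exp.2 h1) (by positivity) hA0
    · exact le_max_of_le_left (not_le.1 hi).le
  · intro δ hδ
    obtain ⟨L, hL⟩ := exists_lt_of_tendsto_atBot h.bot hδ
    have hlow : ∀ i : ℚ, δ ≤ wt s f i → min L 0 ≤ i := by
      intro i hi
      by_contra hlt
      have hi' := not_le.1 hlt
      have hi0 : (i : ℝ) ≤ 0 := by exact_mod_cast (hi'.trans_le (min_le_right _ _)).le
      have h1 := hL i (hi'.trans_le (min_le_left _ _)).le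
      rw [wt_change s r] at hi
      have h2 : Real.exp ((r - s) * (i : ℝ)) ≤ 1 :=
        Real.exp_le_one_iff.2 (mul_nonpos_of_nonneg_of_nonpos (by linarith) hi0)
      have h3 := mul_le_of_le_one_right (wt_nonneg r f i) h2
      linarith
    refine (Set.isPWO_iff_isWF.2
      (h.wf (δ * Real.exp (s * ((min L 0 : ℚ) : ℝ))) (by positivity))).mono ?_
    intro i hi
    have h1 : ((min L 0 : ℚ) : ℝ) ≤ i := by exact_mod_cast hlow i hi
    change _ ≤ ‖f i‖
    rw [norm_eq_wt s]
    exact mul_le_mul hi (Real.exp_le_exp.2 (mul_le_mul_of_nonneg_left h1 hs.le))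
      (by positivity) (wt_nonneg _ _ _)

theorem isExtRobbaOn_of_goodAt {r : ℝ} (hr : 0 < r) {f : ℚ → K}
    (h : ∀ s : ℝ, 0 < s → s ≤ r → GoodAt s f) : IsExtRobbaOn r f := by
  have hg := h r hr le_rfl
  refine ⟨?_, ?_, ?_, ?_⟩
  · intro c hc
    rw [Set.isWF_iff_no_descending_seq]
    intro g hgm hmem
    have hsub := hg.pwo (c * Real.exp (-(r * (g 0 : ℝ)))) (by positivity)
    refine Set.isWF_iff_no_descending_seq.1 hsub.isWF g hgm (fun n => ?_)
    have h1 : (g n : ℝ) ≤ g 0 := by exact_mod_cast hgm.antitone (Nat.zero_le n)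
    refine mul_le_mul (hmem n) (Real.exp_le_exp.2 ?_) (by positivity) (norm_nonneg _)
    exact neg_le_neg (mul_le_mul_of_nonneg_left h1 hr.le)
  · obtain ⟨A, -, hA⟩ := hg.bdd
    exact ⟨A, by rintro _ ⟨i, rfl⟩; exact hA i⟩
  · rw [tendsto_order]
    refine ⟨fun a ha => Eventually.of_forall fun i => ha.trans_le (wt_nonneg _ _ _), fun δ hδ => ?_⟩
    rw [eventually_atBot]
    by_cases hne : {i : ℚ | δ ≤ wt r f i}.Nonempty
    · refine ⟨(hg.pwo δ hδ).isWF.min hne - 1, fun i hi => ?_⟩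
      by_contra hcon
      have := (hg.pwo δ hδ).isWF.min_le hne (not_lt.1 hcon : i ∈ {i : ℚ | δ ≤ wt r f i})
      linarith
    · refine ⟨0, fun i _ => ?_⟩
      by_contra hcon
      exact hne ⟨i, not_lt.1 hcon⟩
  · intro s hs
    have hm := h (min s r) (lt_min hs hr) (min_le_right _ _)
    rw [tendsto_order]
    refine ⟨fun a ha => Eventually.of_forall fun i => ha.trans_le (wt_nonneg _ _ _), fun δ hδ => ?_⟩
    rw [eventually_atTop]
    obtain ⟨U, hU⟩ := hm.above δ hδ
    refine ⟨max (U + 1) 0, fun i hi => ?_⟩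
    by_contra hcon
    have hi0 : (0 : ℝ) ≤ i := by exact_mod_cast (le_max_right _ _).trans hi
    have h1 : δ ≤ wt (min s r) f i := by
      refine (not_lt.1 hcon).trans ?_
      rw [wt_change s (min s r)]
      refine mul_le_of_le_one_right (wt_nonneg _ _ _) (Real.exp_le_one_iff.2 ?_)
      exact mul_nonpos_of_nonpos_of_nonneg (by linarith [min_le_left s r]) hi0
    have h2 := hU h1
    have h3 := (le_max_left _ _).trans hi
    linarith

theorem GoodAt.neg {s : ℝ} {f : ℚ → K} (h : GoodAt s f) : GoodAt s (-f) := by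
  have : wt s (-f) = wt s f := by funext i; simp [wt]
  exact ⟨by rw [this]; exact h.bdd, by rw [this]; exact h.pwo, by rw [this]; exact h.above⟩

theorem goodAt_single (s : ℝ) (a : K) : GoodAt s (Pi.single (0 : ℚ) a) := by
  have h0 : ∀ i : ℚ, i ≠ 0 → wt s (Pi.single (0 : ℚ) a) i = 0 := by
    intro i hi; simp [wt, Pi.single_eq_of_ne hi]
  have hsub : ∀ δ : ℝ, 0 < δ → {i : ℚ | δ ≤ wt s (Pi.single (0 : ℚ) a) i} ⊆ {0} := by
    intro δ hδ i hi
    by_contra hne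
    have : δ ≤ wt s (Pi.single (0 : ℚ) a) i := hi
    rw [h0 i hne] at this
    linarith
  refine ⟨⟨‖a‖ + 1, by positivity, fun i => ?_⟩, fun δ hδ => ?_, fun δ hδ => ?_⟩
  · by_cases hi : i = 0
    · subst hi; simp [wt]
    · rw [h0 i hi]; positivity
  · exact (Set.isPWO_singleton (0 : ℚ)).mono (hsub δ hδ)
  · exact (bddAbove_singleton (a := (0 : ℚ))).mono (hsub δ hδ)

/-- The Cauchy product of two formal sums. -/
noncomputable def conv (f g : ℚ → K) : ℚ → K := fun k => ∑' i : ℚ, f i * g (k - i)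

theorem norm_mul_eq_wt (s : ℝ) (f g : ℚ → K) (i j : ℚ) :
    ‖f i * g j‖ = wt s f i * wt s g j * Real.exp (s * ((i + j : ℚ) : ℝ)) := by
  rw [norm_mul, norm_eq_wt s f, norm_eq_wt s g]
  push_cast
  rw [mul_add, Real.exp_add]; ring

theorem level_of_mul {s : ℝ} {f : ℚ → K} {B x δ : ℝ} (hB0 : 0 < B) (hx : x ≤ B) {i : ℚ}
    (h : δ ≤ wt s f i * x) : δ / B ≤ wt s f i := by
  rw [div_le_iff₀ hB0]
  exact h.trans (mul_le_mul_of_nonneg_left hx (wt_nonneg _ _ _))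

theorem tendsto_cofinite_of_finite {ι : Type*} {a : ι → K}
    (h : ∀ δ : ℝ, 0 < δ → {i | δ ≤ ‖a i‖}.Finite) : Tendsto a cofinite (𝓝 0) := by
  rw [tendsto_zero_iff_norm_tendsto_zero, tendsto_order]
  refine ⟨fun c hc => Eventually.of_forall fun i => hc.trans_le (norm_nonneg _), fun δ hδ => ?_⟩
  rw [eventually_cofinite]
  simpa using h δ hδ

theorem conv_comm (f g : ℚ → K) : conv f g = conv g f := by
  funext k
  unfold conv
  rw [← (Equiv.subLeft k).tsum_eq]
  simp [mul_comm]

theorem single_conv (a : K) (f : ℚ → K) : conv (Pi.single (0 : ℚ) a) f = fun k => a * f k := by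
  funext k
  unfold conv
  rw [tsum_eq_single (0 : ℚ)]
  · simp
  · intro i hi; simp [Pi.single_eq_of_ne hi]

variable [IsUltrametricDist K]

theorem GoodAt.add {s : ℝ} {f g : ℚ → K} (hf : GoodAt s f) (hg : GoodAt s g) :
    GoodAt s (f + g) := by
  have key : ∀ i, wt s (f + g) i ≤ max (wt s f i) (wt s g i) := by
    intro i
    unfold wt
    rw [← max_mul_of_nonneg _ _ (Real.exp_pos _).le]
    exact mul_le_mul_of_nonneg_right (IsUltrametricDist.norm_add_le_max _ _) (Real.exp_pos _).le
  have hsub : ∀ δ : ℝ, {i : ℚ | δ ≤ wt s (f + g) i} ⊆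
      {i : ℚ | δ ≤ wt s f i} ∪ {i : ℚ | δ ≤ wt s g i} := by
    intro δ i hi
    exact le_max_iff.1 (le_trans hi (key i))
  obtain ⟨A, hA0, hA⟩ := hf.bdd
  obtain ⟨B, hB0, hB⟩ := hg.bdd
  exact ⟨⟨max A B, lt_max_of_lt_left hA0, fun i => (key i).trans (max_le_max (hA i) (hB i))⟩,
    fun δ hδ => ((hf.pwo δ hδ).union (hg.pwo δ hδ)).mono (hsub δ),
    fun δ hδ => ((hf.above δ hδ).union (hg.above δ hδ)).mono (hsub δ)⟩

theorem norm_tsum_le_of_forall {ι : Type*} {a : ι → K} {C : ℝ} (hC : 0 ≤ C)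
    (h : ∀ i, ‖a i‖ ≤ C) : ‖∑' i, a i‖ ≤ C := by
  by_cases hs : Summable a
  · refine le_of_tendsto' hs.hasSum.norm (fun t => ?_)
    exact IsUltrametricDist.norm_sum_le_of_forall_le_of_nonneg hC (fun i _ => h i)
  · rw [tsum_eq_zero_of_not_summable hs]; simpa using hC

theorem GoodAt.conv {s : ℝ} {f g : ℚ → K} (hf : GoodAt s f) (hg : GoodAt s g) :
    GoodAt s (conv f g) := by
  obtain ⟨A, hA0, hA⟩ := hf.bdd
  obtain ⟨B, hB0, hB⟩ := hg.bdd
  have key : ∀ (k : ℚ) (C : ℝ), 0 ≤ C → (∀ i, wt s f i * wt s g (k - i) ≤ C) →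
      wt s (Slopes.conv f g) k ≤ C := by
    intro k C hC h
    have h1 : ‖Slopes.conv f g k‖ ≤ C * Real.exp (s * (k : ℝ)) := by
      refine norm_tsum_le_of_forall (by positivity) (fun i => ?_)
      rw [norm_mul_eq_wt s]
      rw [add_sub_cancel]
      exact mul_le_mul_of_nonneg_right (h i) (Real.exp_pos _).le
    rw [norm_eq_wt s] at h1
    exact le_of_mul_le_mul_right h1 (Real.exp_pos _)
  have hsub : ∀ δ : ℝ, 0 < δ → {k : ℚ | δ ≤ wt s (Slopes.conv f g) k} ⊆
      {i : ℚ | δ / 2 / B ≤ wt s f i} + {i : ℚ | δ / 2 / A ≤ wt s g i} := by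
    intro δ hδ k hk
    have : ∃ i, δ / 2 ≤ wt s f i * wt s g (k - i) := by
      by_contra hcon
      push Not at hcon
      have h2 := key k (δ / 2) (by positivity) (fun i => (hcon i).le)
      have h3 : δ ≤ wt s (Slopes.conv f g) k := hk
      linarith
    obtain ⟨i, hi⟩ := this
    refine Set.mem_add.2 ⟨i, level_of_mul hB0 (hB _) hi, k - i, ?_, by ring⟩
    rw [mul_comm] at hi
    exact level_of_mul hA0 (hA _) hi
  refine ⟨⟨A * B, by positivity, fun k => key k _ (by positivity) (fun i => ?_)⟩,
    fun δ hδ => ?_, fun δ hδ => ?_⟩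
  · exact mul_le_mul (hA _) (hB _) (wt_nonneg _ _ _) hA0.le
  · exact ((hf.pwo _ (by positivity)).add (hg.pwo _ (by positivity))).mono (hsub δ hδ)
  · exact ((hf.above _ (by positivity)).add (hg.above _ (by positivity))).mono (hsub δ hδ)

variable [CompleteSpace K]

theorem summable_conv {s : ℝ} {f g : ℚ → K} (hf : GoodAt s f) (hg : GoodAt s g) (k : ℚ) :
    Summable (fun i : ℚ => f i * g (k - i)) := by
  refine NonarchimedeanAddGroup.summable_of_tendsto_cofinite_zero
    (tendsto_cofinite_of_finite fun δ hδ => ?_)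
  obtain ⟨A, hA0, hA⟩ := hf.bdd
  obtain ⟨B, hB0, hB⟩ := hg.bdd
  set ε : ℝ := δ / Real.exp (s * (k : ℝ)) with hε
  have hε0 : 0 < ε := by positivity
  have hfin := Set.AddAntidiagonal.finite_of_isPWO (hf.pwo (ε / B) (by positivity))
    (hg.pwo (ε / A) (by positivity)) k
  refine (hfin.image Prod.fst).subset fun i hi => ?_
  have hi' : ε ≤ wt s f i * wt s g (k - i) := by
    rw [hε, div_le_iff₀ (Real.exp_pos _)]
    have h1 : δ ≤ ‖f i * g (k - i)‖ := hi
    rwa [norm_mul_eq_wt s, add_sub_cancel] at h1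
  refine ⟨(i, k - i), ⟨level_of_mul hB0 (hB _) hi', ?_, by ring⟩, rfl⟩
  rw [mul_comm] at hi'
  exact level_of_mul hA0 (hA _) hi'

theorem summable_conv₃ {s : ℝ} {f g h : ℚ → K} (hf : GoodAt s f) (hg : GoodAt s g)
    (hh : GoodAt s h) (k : ℚ) :
    Summable (fun p : ℚ × ℚ => f p.1 * (g p.2 * h (k - p.1 - p.2))) := by
  refine NonarchimedeanAddGroup.summable_of_tendsto_cofinite_zero
    (tendsto_cofinite_of_finite fun δ hδ => ?_)
  obtain ⟨A, hA0, hA⟩ := hf.bdd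
  obtain ⟨B, hB0, hB⟩ := hg.bdd
  obtain ⟨C, hC0, hC⟩ := hh.bdd
  set ε : ℝ := δ / Real.exp (s * (k : ℝ)) with hε
  have hε0 : 0 < ε := by positivity
  have hS := hf.pwo (ε / (B * C)) (by positivity)
  have hT := hg.pwo (ε / (A * C)) (by positivity)
  have hU := hh.pwo (ε / (A * B)) (by positivity)
  have hfin1 := Set.AddAntidiagonal.finite_of_isPWO hS (hT.add hU) k
  have hfin2 := Set.AddAntidiagonal.finite_of_isPWO hT (hS.add hU) k
  refine ((hfin1.image Prod.fst).prod (hfin2.image Prod.fst)).subset fun p hp => ?_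
  obtain ⟨i, j⟩ := p
  have hp' : ε ≤ wt s f i * (wt s g j * wt s h (k - i - j)) := by
    rw [hε, div_le_iff₀ (Real.exp_pos _)]
    have h1 : δ ≤ ‖f i * (g j * h (k - i - j))‖ := hp
    rw [norm_mul, norm_mul_eq_wt s, norm_eq_wt s f, show j + (k - i - j) = k - i by ring] at h1
    have h2 : Real.exp (s * (k : ℝ)) = Real.exp (s * (i : ℝ)) *
        Real.exp (s * ((k - i : ℚ) : ℝ)) := by
      rw [← Real.exp_add]; congr 1; push_cast; ring
    rw [h2]
    linarith
  have m1 : i ∈ {i : ℚ | ε / (B * C) ≤ wt s f i} :=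
    level_of_mul (by positivity) (mul_le_mul (hB _) (hC _) (wt_nonneg _ _ _) hB0.le) hp'
  have m2 : j ∈ {i : ℚ | ε / (A * C) ≤ wt s g i} := by
    rw [mul_left_comm] at hp'
    exact level_of_mul (by positivity) (mul_le_mul (hA _) (hC _) (wt_nonneg _ _ _) hA0.le) hp'
  have m3 : k - i - j ∈ {i : ℚ | ε / (A * B) ≤ wt s h i} := by
    rw [← mul_assoc, mul_comm] at hp'
    exact level_of_mul (by positivity) (mul_le_mul (hA _) (hB _) (wt_nonneg _ _ _) hA0.le) hp'
  refine ⟨⟨(i, k - i), ⟨m1, ?_, by ring⟩, rfl⟩,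
    ⟨(j, k - j), ⟨m2, ?_, by ring⟩, rfl⟩⟩
  · exact Set.mem_add.2 ⟨j, m2, _, m3, by ring⟩
  · exact Set.mem_add.2 ⟨i, m1, _, m3, by ring⟩

theorem conv_assoc {s : ℝ} {f g h : ℚ → K} (hf : GoodAt s f) (hg : GoodAt s g)
    (hh : GoodAt s h) : conv (conv f g) h = conv f (conv g h) := by
  funext k
  have h3 := summable_conv₃ hf hg hh k
  have e1 : conv f (conv g h) k = ∑' p : ℚ × ℚ, f p.1 * (g p.2 * h (k - p.1 - p.2)) := by
    rw [h3.tsum_prod]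
    unfold conv
    exact tsum_congr fun i => tsum_mul_left.symm
  let e : ℚ × ℚ ≃ ℚ × ℚ :=
    { toFun := fun p => (p.2, p.1 - p.2)
      invFun := fun p => (p.1 + p.2, p.1)
      left_inv := fun p => by simp
      right_inv := fun p => by simp }
  have h3' := (e.summable_iff).2 h3
  have e2 : conv (conv f g) h k = ∑' p : ℚ × ℚ, f (e p).1 * (g (e p).2 * h (k - (e p).1 - (e p).2)) := by
    refine Eq.trans ?_ (h3'.tsum_prod).symm
    unfold conv
    refine tsum_congr fun l => ?_
    rw [← tsum_mul_right]
    refine tsum_congr fun i => ?_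
    simp [e, mul_assoc]
  rw [e1, e2]
  exact e.tsum_eq (fun p : ℚ × ℚ => f p.1 * (g p.2 * h (k - p.1 - p.2)))

theorem add_conv {s : ℝ} {f g h : ℚ → K} (hf : GoodAt s f) (hg : GoodAt s g)
    (hh : GoodAt s h) : conv (f + g) h = conv f h + conv g h := by
  funext k
  simp only [conv, Pi.add_apply, add_mul]
  exact (summable_conv hf hh k).tsum_add (summable_conv hg hh k)

end Series

section Ring

variable (K : Type u) [NontriviallyNormedField K] [IsUltrametricDist K]

/-- The additive group of extended Robba series: the union over `r > 0` of the sets of formal sums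
of radius `r`. -/
def extRobbaAddSubgroup : AddSubgroup (ℚ → K) where
  carrier := {f | ∃ r : ℝ, 0 < r ∧ IsExtRobbaOn r f}
  zero_mem' := ⟨1, one_pos, isExtRobbaOn_of_goodAt one_pos fun s _ _ => by
    simpa using goodAt_single s (0 : K)⟩
  add_mem' := by
    rintro f g ⟨r, hr, hf⟩ ⟨t, ht, hg⟩
    refine ⟨min r t, lt_min hr ht, isExtRobbaOn_of_goodAt (lt_min hr ht) fun s hs hst => ?_⟩
    exact (hf.goodAt hs (hst.trans (min_le_left _ _))).add
      (hg.goodAt hs (hst.trans (min_le_right _ _)))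
  neg_mem' := by
    rintro f ⟨r, hr, hf⟩
    exact ⟨r, hr, isExtRobbaOn_of_goodAt hr fun s hs hst => (hf.goodAt hs hst).neg⟩

/-- The extended Robba ring over `K`. -/
def ExtRobba : Type u := extRobbaAddSubgroup K

noncomputable instance : AddCommGroup (ExtRobba K) :=
  inferInstanceAs (AddCommGroup (extRobbaAddSubgroup K))

variable {K}

/-- The `i`-th coefficient of an extended Robba series. -/
def ExtRobba.coeff (f : ExtRobba K) : ℚ → K := f.1

theorem ExtRobba.ext {f g : ExtRobba K} (h : f.coeff = g.coeff) : f = g := Subtype.ext h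

theorem ExtRobba.coeff_add (f g : ExtRobba K) : (f + g).coeff = f.coeff + g.coeff := rfl

theorem ExtRobba.coeff_zero : (0 : ExtRobba K).coeff = 0 := rfl

theorem ExtRobba.coeff_neg (f : ExtRobba K) : (-f).coeff = -f.coeff := rfl

theorem ExtRobba.exists_goodAt (f : ExtRobba K) :
    ∃ r : ℝ, 0 < r ∧ ∀ s : ℝ, 0 < s → s ≤ r → GoodAt s f.coeff := by
  obtain ⟨r, hr, h⟩ := f.2
  exact ⟨r, hr, fun s hs hsr => h.goodAt hs hsr⟩

theorem ExtRobba.exists_goodAt₂ (f g : ExtRobba K) :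
    ∃ r : ℝ, 0 < r ∧ ∀ s : ℝ, 0 < s → s ≤ r → GoodAt s f.coeff ∧ GoodAt s g.coeff := by
  obtain ⟨r, hr, hf⟩ := f.exists_goodAt
  obtain ⟨t, ht, hg⟩ := g.exists_goodAt
  exact ⟨min r t, lt_min hr ht, fun s hs h => ⟨hf s hs (h.trans (min_le_left _ _)),
    hg s hs (h.trans (min_le_right _ _))⟩⟩

theorem ExtRobba.exists_goodAt₃ (f g h : ExtRobba K) :
    ∃ s : ℝ, GoodAt s f.coeff ∧ GoodAt s g.coeff ∧ GoodAt s h.coeff := by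
  obtain ⟨r, hr, hf⟩ := f.exists_goodAt
  obtain ⟨t, ht, hg⟩ := ExtRobba.exists_goodAt₂ g h
  exact ⟨min r t, hf _ (lt_min hr ht) (min_le_left _ _), hg _ (lt_min hr ht) (min_le_right _ _)⟩

/-- The constant series `a = a u^0`. -/
noncomputable def ExtRobba.const (a : K) : ExtRobba K :=
  ⟨Pi.single (0 : ℚ) a, 1, one_pos, isExtRobbaOn_of_goodAt one_pos fun s _ _ => goodAt_single s a⟩

theorem ExtRobba.coeff_const (a : K) : (ExtRobba.const a).coeff = Pi.single (0 : ℚ) a := rfl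

noncomputable instance : One (ExtRobba K) := ⟨ExtRobba.const 1⟩

noncomputable instance : Mul (ExtRobba K) := ⟨fun f g => ⟨conv f.coeff g.coeff, by
  obtain ⟨r, hr, h⟩ := ExtRobba.exists_goodAt₂ f g
  exact ⟨r, hr, isExtRobbaOn_of_goodAt hr fun s hs hsr => (h s hs hsr).1.conv (h s hs hsr).2⟩⟩⟩

theorem ExtRobba.coeff_mul (f g : ExtRobba K) : (f * g).coeff = conv f.coeff g.coeff := rfl

theorem ExtRobba.coeff_one : (1 : ExtRobba K).coeff = Pi.single (0 : ℚ) 1 := rfl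

theorem ExtRobba.mul_comm' (f g : ExtRobba K) : f * g = g * f :=
  ExtRobba.ext (conv_comm _ _)

theorem ExtRobba.one_mul' (f : ExtRobba K) : 1 * f = f :=
  ExtRobba.ext (by rw [coeff_mul, coeff_one, single_conv]; simp)

variable [CompleteSpace K]

theorem ExtRobba.mul_assoc' (f g h : ExtRobba K) : f * g * h = f * (g * h) := by
  obtain ⟨s, hf, hg, hh⟩ := ExtRobba.exists_goodAt₃ f g h
  exact ExtRobba.ext (conv_assoc hf hg hh)

theorem ExtRobba.add_mul' (f g h : ExtRobba K) : (f + g) * h = f * h + g * h := by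
  obtain ⟨s, hf, hg, hh⟩ := ExtRobba.exists_goodAt₃ f g h
  exact ExtRobba.ext (add_conv hf hg hh)

noncomputable instance : CommRing (ExtRobba K) where
  __ := (inferInstance : AddCommGroup (ExtRobba K))
  mul := (· * ·)
  one := 1
  mul_assoc := ExtRobba.mul_assoc'
  one_mul := ExtRobba.one_mul'
  mul_one f := by rw [ExtRobba.mul_comm', ExtRobba.one_mul']
  mul_comm := ExtRobba.mul_comm'
  right_distrib := ExtRobba.add_mul'
  left_distrib f g h := by
    rw [ExtRobba.mul_comm', ExtRobba.add_mul', ExtRobba.mul_comm' g, ExtRobba.mul_comm' h]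
  zero_mul f := by
    have := ExtRobba.add_mul' 0 0 f
    rw [add_zero] at this
    simpa using this
  mul_zero f := by
    have := ExtRobba.add_mul' 0 0 f
    rw [add_zero] at this
    rw [ExtRobba.mul_comm']
    simpa using this

/-- The inclusion of `K` in the extended Robba ring as the constant series. -/
noncomputable def ExtRobba.constHom : K →+* ExtRobba K where
  toFun := ExtRobba.const
  map_one' := rfl
  map_zero' := ExtRobba.ext (by rw [coeff_const, coeff_zero, Pi.single_zero])
  map_add' a b := ExtRobba.ext (by rw [coeff_const, coeff_add, coeff_const, coeff_const,
    Pi.single_add])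
  map_mul' a b := ExtRobba.ext (by
    rw [coeff_mul, coeff_const, coeff_const, coeff_const, single_conv]
    funext k
    by_cases hk : k = 0
    · subst hk; simp
    · simp [Pi.single_eq_of_ne hk])

noncomputable instance : Algebra K (ExtRobba K) := ExtRobba.constHom.toAlgebra

/-- The subring of series with coefficients in the valuation ring of `K`. -/
def ExtRobba.int : Subring (ExtRobba K) where
  carrier := {f | ∀ i, ‖f.coeff i‖ ≤ 1}
  zero_mem' i := by simp [coeff_zero]
  one_mem' i := by
    rw [coeff_one]
    by_cases hi : i = 0
    · subst hi; simp
    · simp [Pi.single_eq_of_ne hi]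
  add_mem' {f g} hf hg i := by
    rw [coeff_add]
    exact (IsUltrametricDist.norm_add_le_max _ _).trans (max_le (hf i) (hg i))
  neg_mem' {f} hf i := by
    rw [coeff_neg]; simpa using hf i
  mul_mem' {f g} hf hg k := by
    rw [coeff_mul]
    refine norm_tsum_le_of_forall zero_le_one fun i => ?_
    rw [norm_mul]
    exact mul_le_one₀ (hf i) (norm_nonneg _) (hg _)

end Ring

section Frobenius

variable {K : Type u} [NontriviallyNormedField K]

theorem GoodAt.frob {φ : K →+* K} (hφ : ∀ x, ‖φ x‖ = ‖x‖) {q : ℕ} (hq : 1 < q) {s : ℝ}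
    {f : ℚ → K} (hf : GoodAt s f) : GoodAt (s / q) (fun i => φ (f (i / q))) := by
  have hq0 : (0 : ℚ) < q := by exact_mod_cast (zero_lt_one.trans hq)
  have hq0' : (q : ℝ) ≠ 0 := by exact_mod_cast (zero_lt_one.trans hq).ne'
  have key : ∀ i, wt (s / q) (fun i => φ (f (i / q))) i = wt s f (i / q) := by
    intro i
    simp only [wt, hφ]
    congr 3
    push_cast
    field_simp
  have hset : ∀ δ : ℝ, {i : ℚ | δ ≤ wt (s / q) (fun i => φ (f (i / q))) i} ⊆
      (fun j : ℚ => j * q) '' {i : ℚ | δ ≤ wt s f i} := by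
    intro δ i hi
    exact ⟨i / q, by
      change δ ≤ wt s f (i / q)
      rw [← key]; exact hi, by field_simp⟩
  have hmono : Monotone (fun j : ℚ => j * q) := fun a b hab =>
    mul_le_mul_of_nonneg_right hab hq0.le
  obtain ⟨A, hA0, hA⟩ := hf.bdd
  exact ⟨⟨A, hA0, fun i => by rw [key]; exact hA _⟩,
    fun δ hδ => ((hf.pwo δ hδ).image_of_monotone hmono).mono (hset δ),
    fun δ hδ => (hmono.map_bddAbove (hf.above δ hδ)).mono (hset δ)⟩

variable [IsUltrametricDist K]

theorem mem_integer_of_isometric (φ : K →+* K) (hφ : ∀ x, ‖φ x‖ = ‖x‖) :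
    ∀ x ∈ (NormedField.valuation (K := K)).integer,
      φ x ∈ (NormedField.valuation (K := K)).integer := fun x hx => by
  rw [Valuation.mem_integer_iff, NormedField.valuation_apply, ← NNReal.coe_le_coe,
    coe_nnnorm] at hx ⊢
  rwa [hφ]

variable [CompleteSpace K]

/-- The Frobenius `∑ a_i u^i ↦ ∑ φ(a_i) u^{q i}` of the extended Robba ring, where `φ` is an
isometric endomorphism of `K` and `q > 1`. -/
noncomputable def ExtRobba.frob (φ : K →+* K) (hφ : ∀ x, ‖φ x‖ = ‖x‖) (q : ℕ) (hq : 1 < q) :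
    ExtRobba K →+* ExtRobba K where
  toFun f := ⟨fun i => φ (f.coeff (i / q)), by
    obtain ⟨r, hr, h⟩ := f.exists_goodAt
    have hq0 : (0 : ℝ) < q := by exact_mod_cast (zero_lt_one.trans hq)
    refine ⟨r / q, by positivity, isExtRobbaOn_of_goodAt (by positivity) fun s hs hsr => ?_⟩
    have h1 := (h (s * q) (by positivity) ((le_div_iff₀ hq0).1 hsr)).frob hφ hq
    rwa [mul_div_cancel_right₀ _ hq0.ne'] at h1⟩
  map_zero' := ExtRobba.ext (by funext i; exact map_zero φ)
  map_one' := ExtRobba.ext (by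
    have hq0 : (q : ℚ) ≠ 0 := by exact_mod_cast (zero_lt_one.trans hq).ne'
    funext i
    change φ ((Pi.single (0 : ℚ) (1 : K) : ℚ → K) (i / q)) = (Pi.single (0 : ℚ) (1 : K) : ℚ → K) i
    by_cases hi : i = 0
    · subst hi; simp
    · rw [Pi.single_eq_of_ne hi, Pi.single_eq_of_ne (div_ne_zero hi hq0), map_zero])
  map_add' f g := ExtRobba.ext (by funext i; exact map_add φ _ _)
  map_mul' f g := ExtRobba.ext (by
    have hq0 : (q : ℚ) ≠ 0 := by exact_mod_cast (zero_lt_one.trans hq).ne'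
    funext k
    change φ (∑' i : ℚ, f.coeff i * g.coeff (k / q - i)) =
      ∑' i : ℚ, φ (f.coeff (i / q)) * φ (g.coeff ((k - i) / q))
    obtain ⟨r, hr, h⟩ := ExtRobba.exists_goodAt₂ f g
    have hs := summable_conv (h r hr le_rfl).1 (h r hr le_rfl).2 (k / q)
    have hcont : Continuous φ := (AddMonoidHomClass.isometry_of_norm φ hφ).continuous
    rw [hs.map_tsum φ hcont]
    refine Eq.trans (tsum_congr fun i => ?_) ((Equiv.mulRight₀ (q : ℚ) hq0).tsum_eq
      (fun i : ℚ => φ (f.coeff (i / q)) * φ (g.coeff ((k - i) / q))))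
    simp [sub_div, hq0])

theorem ExtRobba.coeff_frob (φ : K →+* K) (hφ : ∀ x, ‖φ x‖ = ‖x‖) (q : ℕ) (hq : 1 < q)
    (f : ExtRobba K) (i : ℚ) : (ExtRobba.frob φ hφ q hq f).coeff i = φ (f.coeff (i / q)) := rfl

theorem ExtRobba.frob_mem_int (φ : K →+* K) (hφ : ∀ x, ‖φ x‖ = ‖x‖) (q : ℕ) (hq : 1 < q) :
    ∀ f ∈ (ExtRobba.int : Subring (ExtRobba K)), ExtRobba.frob φ hφ q hq f ∈ ExtRobba.int :=
  fun f hf i => by rw [ExtRobba.coeff_frob, hφ]; exact hf _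

theorem ExtRobba.algebraMap_frob (φ : K →+* K) (hφ : ∀ x, ‖φ x‖ = ‖x‖) (q : ℕ) (hq : 1 < q)
    (a : K) : algebraMap K (ExtRobba K) (φ a) =
      ExtRobba.frob φ hφ q hq (algebraMap K (ExtRobba K) a) := ExtRobba.ext (by
  have hq0 : (q : ℚ) ≠ 0 := by exact_mod_cast (zero_lt_one.trans hq).ne'
  funext i
  change (Pi.single (0 : ℚ) (φ a) : ℚ → K) i = φ ((Pi.single (0 : ℚ) a : ℚ → K) (i / q))
  by_cases hi : i = 0
  · subst hi; simp
  · rw [Pi.single_eq_of_ne hi, Pi.single_eq_of_ne (div_ne_zero hi hq0), map_zero])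

end Frobenius

section PhiModules

open CategoryTheory TensorProduct Module

variable {R : Type u} [CommRing R]

/-- A (strict) `φ`-module over a ring `R` with endomorphism `φ`: a finite free `R`-module with a
`φ`-semilinear map `Φ` whose linearization `φ^* M → M` is an isomorphism. As `φ^* M` is free on the
elements `1 ⊗ e_i` for any basis `e_i` of `M`, the latter says that `Φ` carries some basis to
another basis. -/
structure PhiMod (φ : R →+* R) where
  carrier : Type u
  [addCommGroup : AddCommGroup carrier]
  [module : Module R carrier]
  Φ : carrier →ₛₗ[φ] carrier
  strict : ∃ (n : ℕ) (b b' : Basis (Fin n) R carrier), ∀ i, b' i = Φ (b i)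

namespace PhiMod

attribute [instance] PhiMod.addCommGroup PhiMod.module

variable {φ : R →+* R}

/-- Morphisms of `φ`-modules: `R`-linear maps commuting with `Φ`. -/
@[ext]
structure Hom (M N : PhiMod φ) where
  lin : M.carrier →ₗ[R] N.carrier
  comm : ∀ x, lin (M.Φ x) = N.Φ (lin x)

instance : Category (PhiMod φ) where
  Hom M N := Hom M N
  id M := ⟨LinearMap.id, fun _ => rfl⟩
  comp f g := ⟨g.lin.comp f.lin, fun x => by simp [f.comm, g.comm]⟩

@[ext]
theorem hom_ext {M N : PhiMod φ} {f g : M ⟶ N} (h : Hom.lin f = Hom.lin g) : f = g :=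
  Hom.ext h

/-- A semilinear map carrying some basis to a basis carries every basis to a basis. -/
theorem exists_basis_of_basis {M : PhiMod φ} {n : ℕ} (c : Basis (Fin n) R M.carrier) :
    ∃ c' : Basis (Fin n) R M.carrier, ∀ i, c' i = M.Φ (c i) := by
  obtain ⟨m, b, b', hb⟩ := M.strict
  rcases subsingleton_or_nontrivial R with hR | hR
  · have := Module.subsingleton R M.carrier
    exact ⟨c, fun i => Subsingleton.elim _ _⟩
  obtain rfl : m = n := by
    simpa using Fintype.card_congr (b.indexEquiv c)
  have hmat : b'.toMatrix (fun i => M.Φ (c i)) = (b.toMatrix c).map φ := by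
    ext i j
    rw [Basis.toMatrix_apply, Matrix.map_apply, Basis.toMatrix_apply]
    conv_lhs => rw [← b.sum_repr (c j)]
    simp only [map_sum, LinearMap.map_smulₛₗ, ← hb]
    simp [Finsupp.single_apply]
  have hdet : IsUnit (b'.det fun i => M.Φ (c i)) := by
    rw [Basis.det_apply, hmat, ← RingHom.mapMatrix_apply, ← RingHom.map_det]
    exact ((Basis.is_basis_iff_det b).1 ⟨c.linearIndependent, c.span_eq⟩).map φ
  have hb' := (Basis.is_basis_iff_det b').2 hdet
  exact ⟨Basis.mk hb'.1 hb'.2.ge, fun i => by simp⟩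

/-- The `d`-th iterate of `Φ`, as a `φ^d`-semilinear map. -/
def iter (M : PhiMod φ) (d : ℕ) : M.carrier →ₛₗ[φ ^ d] M.carrier where
  toFun := M.Φ^[d]
  map_add' := fun x y => by
    induction d generalizing x y with
    | zero => rfl
    | succ d ih => simp only [Function.iterate_succ, Function.comp_apply, map_add, ih]
  map_smul' := fun r x => by
    induction d generalizing r x with
    | zero => rfl
    | succ d ih =>
      simp only [Function.iterate_succ, Function.comp_apply, LinearMap.map_smulₛₗ, ih]
      rw [pow_succ]; rfl

/-- The `d`-pushforward `[d]_* M`: the same module, viewed as a `φ^d`-module. -/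
def push (M : PhiMod φ) (d : ℕ) : PhiMod (φ ^ d) where
  carrier := M.carrier
  Φ := M.iter d
  strict := by
    obtain ⟨n, b, -, -⟩ := M.strict
    refine ⟨n, b, ?_⟩
    induction d with
    | zero => exact ⟨b, fun i => rfl⟩
    | succ d ih =>
      obtain ⟨b', hb'⟩ := ih
      obtain ⟨c, hc⟩ := exists_basis_of_basis b'
      refine ⟨c, fun i => ?_⟩
      rw [hc, hb']
      exact (Function.iterate_succ_apply' M.Φ d (b i)).symm

/-- The tensor product of two `φ`-modules. -/
noncomputable def tensor (M N : PhiMod φ) : PhiMod φ where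
  carrier := M.carrier ⊗[R] N.carrier
  Φ := TensorProduct.map M.Φ N.Φ
  strict := by
    obtain ⟨m, b, b', hb⟩ := M.strict
    obtain ⟨n, c, c', hc⟩ := N.strict
    refine ⟨m * n, (b.tensorProduct c).reindex finProdFinEquiv,
      (b'.tensorProduct c').reindex finProdFinEquiv, fun i => ?_⟩
    simp [Basis.tensorProduct_apply, hb, hc]

/-- A `φ`-module is trivial if it has a basis of `Φ`-fixed vectors, that is, if it is a direct sum
of copies of `R` with `Φ = φ`. -/
def IsTrivial (M : PhiMod φ) : Prop :=
  ∃ (n : ℕ) (b : Basis (Fin n) R M.carrier), ∀ i, M.Φ (b i) = b i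

section BaseChange

variable {S : Type u} [CommRing S] [Algebra R S] {ψ : S →+* S}

/-- The semilinear action on the base change `S ⊗ M`. -/
noncomputable def baseChangeΦ (h : ∀ r, algebraMap R S (φ r) = ψ (algebraMap R S r))
    (M : PhiMod φ) : (S ⊗[R] M.carrier) →ₛₗ[ψ] (S ⊗[R] M.carrier) :=
  let ψ' : S →ₛₗ[φ] S :=
    { toFun := ψ
      map_add' := map_add ψ
      map_smul' := fun r s => by rw [Algebra.smul_def, Algebra.smul_def, map_mul, h] }
  { toFun := TensorProduct.map ψ' M.Φ
    map_add' := map_add _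
    map_smul' := fun s x => by
      induction x using TensorProduct.induction_on with
      | zero => simp
      | tmul t m =>
        rw [TensorProduct.smul_tmul', TensorProduct.map_tmul, TensorProduct.map_tmul,
          TensorProduct.smul_tmul', smul_eq_mul, smul_eq_mul]
        congr 1
        exact map_mul ψ s t
      | add x y hx hy => rw [smul_add, map_add, hx, hy, map_add, smul_add] }

theorem baseChangeΦ_tmul (h : ∀ r, algebraMap R S (φ r) = ψ (algebraMap R S r))
    (M : PhiMod φ) (s : S) (m : M.carrier) :
    baseChangeΦ h M (s ⊗ₜ[R] m) = ψ s ⊗ₜ[R] M.Φ m := rfl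

/-- Base change of a `φ`-module along a homomorphism `R → S` intertwining `φ` and `ψ`: the module
`S ⊗ M` with the action `s ⊗ m ↦ ψ(s) ⊗ Φ(m)`. -/
noncomputable def baseChangeObj (h : ∀ r, algebraMap R S (φ r) = ψ (algebraMap R S r))
    (M : PhiMod φ) : PhiMod ψ where
  carrier := S ⊗[R] M.carrier
  Φ := baseChangeΦ h M
  strict := by
    obtain ⟨n, b, b', hb⟩ := M.strict
    refine ⟨n, b.baseChange S, b'.baseChange S, fun i => ?_⟩
    rw [Basis.baseChange_apply, Basis.baseChange_apply, baseChangeΦ_tmul, map_one, hb]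

/-- Base change of a morphism of `φ`-modules. -/
noncomputable def baseChangeMap (h : ∀ r, algebraMap R S (φ r) = ψ (algebraMap R S r))
    {M N : PhiMod φ} (f : Hom M N) : Hom (baseChangeObj h M) (baseChangeObj h N) where
  lin := f.lin.baseChange S
  comm x := by
    change f.lin.baseChange S (baseChangeΦ h M x) = baseChangeΦ h N (f.lin.baseChange S x)
    induction x using TensorProduct.induction_on with
    | zero => rw [map_zero, map_zero, map_zero]
    | tmul s m =>
      rw [baseChangeΦ_tmul, LinearMap.baseChange_tmul, LinearMap.baseChange_tmul,
        baseChangeΦ_tmul, f.comm]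
    | add x y hx hy => rw [map_add, map_add, hx, hy, map_add, map_add]

/-- The base change functor of `φ`-modules along a homomorphism `R → S` intertwining `φ` and
`ψ`. -/
noncomputable def baseChange (h : ∀ r, algebraMap R S (φ r) = ψ (algebraMap R S r)) :
    PhiMod φ ⥤ PhiMod ψ where
  obj := baseChangeObj h
  map f := baseChangeMap h f
  map_id _ := hom_ext LinearMap.baseChange_id
  map_comp f g := hom_ext (LinearMap.baseChange_comp (Hom.lin f) (Hom.lin g))

end BaseChange

/-- Over a ring `R` with endomorphism `φ` stabilizing a subring `O` (playing the role of
`R^int`), a `φ`-module is étale if it is obtained by base extension from a `φ`-module over `O`. -/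
def IsEtale (O : Subring R) (hO : ∀ x ∈ O, φ x ∈ O) (M : PhiMod φ) : Prop :=
  ∃ N : PhiMod (φ.restrict O O hO),
    Nonempty ((baseChange (S := R) (ψ := φ) (fun _ => rfl)).obj N ≅ M)

/-- `M` has degree `n` with respect to the valuation `w`, given by the relation
`ord r n ↔ w(r) = n`: the top exterior power of `M` has a generator `v = b_1 ∧ ⋯ ∧ b_m` (with `b` a
basis of `M`) such that `Φ(v) = r v` and `w(r) = n`. Here `r` is the determinant of the matrix of
`Φ` in the basis `b`. -/
def HasDegree (ord : R → ℤ → Prop) (M : PhiMod φ) (n : ℤ) : Prop :=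
  ∃ (m : ℕ) (b : Basis (Fin m) R M.carrier), ord (b.toMatrix fun i => M.Φ (b i)).det n

theorem pow_stable {O : Subring R} (hO : ∀ x ∈ O, φ x ∈ O) (d : ℕ) : ∀ x ∈ O, (φ ^ d) x ∈ O := by
  induction d with
  | zero => exact fun x hx => hx
  | succ d ih => exact fun x hx => by rw [pow_succ]; exact ih _ (hO x hx)

/-- `M` is pure of slope `s = c / d` (in lowest terms with `d > 0`): the degree of `M` is `s` times
its rank, and for some `φ^d`-module `N` of rank `1` and degree `-c`, the `φ^d`-module
`[d]_* M ⊗ N` is étale. By convention the zero module is pure of every slope. -/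
def IsPure (O : Subring R) (hO : ∀ x ∈ O, φ x ∈ O) (ord : R → ℤ → Prop) (s : ℚ) (M : PhiMod φ) :
    Prop :=
  (∃ n : ℤ, M.HasDegree ord n ∧ (n : ℚ) = s * finrank R M.carrier) ∧
    ∃ N : PhiMod (φ ^ s.den), finrank R N.carrier = 1 ∧ N.HasDegree ord (-s.num) ∧
      ((M.push s.den).tensor N).IsEtale O (pow_stable hO s.den)

end PhiMod

end PhiModules

section Pure

open CategoryTheory

variable {K : Type u} [NontriviallyNormedField K] [IsUltrametricDist K]
  [(NormedField.valuation (K := K)).IsRankOneDiscrete]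

/-- The relation `w(x) = n` for the normalized valuation `w` of `K`. -/
def fieldOrd (x : K) (n : ℤ) : Prop :=
  ∃ ϖ : K, (NormedField.valuation (K := K)).IsUniformizer ϖ ∧ ‖x‖ = ‖ϖ‖ ^ n

/-- `φ`-modules over `K` that are étale, with respect to the valuation ring of `K`. -/
def IsEtaleField (φ : K →+* K) (hφ : ∀ x, ‖φ x‖ = ‖x‖) : ObjectProperty (PhiMod φ) :=
  PhiMod.IsEtale (NormedField.valuation (K := K)).integer (mem_integer_of_isometric φ hφ)

/-- `φ`-modules over `K` that are pure of slope `s`, with respect to the valuation ring of `K`. -/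
def IsPureField (φ : K →+* K) (hφ : ∀ x, ‖φ x‖ = ‖x‖) (s : ℚ) : ObjectProperty (PhiMod φ) :=
  PhiMod.IsPure (NormedField.valuation (K := K)).integer (mem_integer_of_isometric φ hφ) fieldOrd s

variable [CompleteSpace K]

/-- The relation `w(f) = n` for the valuation `w(∑ a_i u^i) = min_i w(a_i)` on the series with
bounded coefficients. -/
def extRobbaOrd (f : ExtRobba K) (n : ℤ) : Prop :=
  ∃ ϖ : K, (NormedField.valuation (K := K)).IsUniformizer ϖ ∧
    IsGreatest (Set.range fun i => ‖f.coeff i‖) (‖ϖ‖ ^ n)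

/-- `φ`-modules over the extended Robba ring that are pure of slope `s`, with respect to the
subring of series with integral coefficients. -/
def IsPureExtRobba (φ : K →+* K) (hφ : ∀ x, ‖φ x‖ = ‖x‖) (q : ℕ) (hq : 1 < q) (s : ℚ) :
    ObjectProperty (PhiMod (ExtRobba.frob φ hφ q hq)) :=
  PhiMod.IsPure ExtRobba.int (ExtRobba.frob_mem_int φ hφ q hq) extRobbaOrd s

/-- Base change of `φ`-modules from `K` to the extended Robba ring. -/
noncomputable def toExtRobba (φ : K →+* K) (hφ : ∀ x, ‖φ x‖ = ‖x‖) (q : ℕ) (hq : 1 < q) :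
    PhiMod φ ⥤ PhiMod (ExtRobba.frob φ hφ q hq) :=
  PhiMod.baseChange (ExtRobba.algebraMap_frob φ hφ q hq)

end Pure

end Slopes

/-! Write s = c/d in lowest terms. Triviality of étale modules over K becomes the matrix statement
`Lang φ`: for every invertible integral A, the equation A φ(U) = U has an invertible solution U over
K. It passes to powers of φ by inducing φ^d-modules up to φ-modules (`Lang.pow`), and together with
an argument on norm-one units it yields a uniformizer ϖ with φ(ϖ) = ϖ (`exists_uniformizer_map_eq`).

The heart of the proof is that étale modules over the extended Robba ring are then trivial too
(`Lang.exists_int`). Reduction modulo ϖ maps the integral subring onto the field of Hahn series over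
the residue field, and it detects units. Over a field with a bijective endomorphism, triviality
follows once homogeneous scalar equations have nonzero solutions and x - φ(x) = a is always solvable
(`exists_isUnit_mul_map_eq`). For Hahn series the first is a Newton polygon normalisation, an
equation over the residue field and a contraction (`solvesHomogeneous_hahnFrob`). The second is
lifted to the extended Robba ring, where it is solved coefficient by coefficient
(`exists_sub_frob_eq`). A trivialization over Hahn series lifts to a change of basis making the
matrix congruent to 1. The remaining equation is solved by successive approximation in a Banach ring
whose norm controls both the Gauss norm and the growth at one radius (`exists_mul_frob_eq_ban`).

Hence, over both rings, M is pure of slope c/d exactly when it has the right degree and a basis on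
which φ^d acts by ϖ^c (`PhiMod.isPure_iff`). The φ^d-invariants of the extended Robba ring are
constants, because a nonconstant invariant would have coefficients of equal norm along an infinite
descending sequence of exponents. So in such bases the matrices of morphisms, and of φ itself, have
entries in K: the first gives fullness, the second descent of objects. Faithfulness holds because
the modules are free and K embeds in the extended Robba ring. -/

namespace Slopes

/-! ### Fixed vectors over a field with an endomorphism -/

section DifferenceFields

variable {F : Type*} [Field F] {M : Type*} [AddCommGroup M] [Module F M]

/-- Every scalar equation `y = ∑ d_j φ^{j+1}(y)` with some `d_j ≠ 0` has a nonzero solution. -/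
def SolvesHomogeneous (φ : F →+* F) : Prop :=
  ∀ (m : ℕ) (d : ℕ → F), (∃ j < m, d j ≠ 0) →
    ∃ y ≠ 0, y = ∑ j ∈ Finset.range m, d j * φ^[j + 1] y

theorem exists_iterate_mem_span [FiniteDimensional F M] (w : ℕ → M) :
    ∃ m, w m ∈ Submodule.span F (w '' Set.Iio m) := by
  let W : ℕ →o Submodule F M := ⟨fun m => Submodule.span F (w '' Set.Iio m), fun a b h =>
    Submodule.span_mono (Set.image_mono (Set.Iio_subset_Iio h))⟩
  obtain ⟨m, hm⟩ := monotone_stabilizes_iff_noetherian.2 (inferInstance : IsNoetherian F M) W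
  refine ⟨m, ?_⟩
  have h1 : w m ∈ W (m + 1) := Submodule.subset_span ⟨m, Nat.lt_succ_self m, rfl⟩
  rw [← hm (m + 1) (Nat.le_succ m)] at h1
  exact h1

theorem mem_span_image_Iio_iff (w : ℕ → M) (m : ℕ) (x : M) :
    x ∈ Submodule.span F (w '' Set.Iio m) ↔
      ∃ c : ℕ → F, x = ∑ i ∈ Finset.range m, c i • w i := by
  constructor
  · intro h
    rw [← Finset.coe_range, Submodule.mem_span_image_finset_iff_exists_fun'] at h
    obtain ⟨c, hc⟩ := h
    exact ⟨c, hc.symm⟩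
  · rintro ⟨c, rfl⟩
    exact Submodule.sum_mem _ fun i hi => Submodule.smul_mem _ _
      (Submodule.subset_span ⟨i, Finset.mem_range.1 hi, rfl⟩)

/-- Cyclic vector argument. For the first linear relation among e, Φ e, Φ² e, ..., a combination of
the earlier iterates is fixed as soon as its last coefficient y solves one scalar equation; the
other coefficients are determined by y. -/
theorem exists_fixed_ne_zero [FiniteDimensional F M] [Nontrivial M] {φ : F →+* F}
    (hφ : SolvesHomogeneous φ) (Φ : M →ₛₗ[φ] M) (hΦ : Function.Injective Φ) :
    ∃ v ≠ 0, Φ v = v := by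
  classical
  obtain ⟨e, he⟩ := exists_ne (0 : M)
  let w : ℕ → M := fun i => Φ^[i] e
  have hw : ∀ i, w (i + 1) = Φ (w i) := fun i => Function.iterate_succ_apply' Φ i e
  have hw0 : ∀ i, w i ≠ 0 := by
    intro i
    induction i with
    | zero => exact he
    | succ i ih => rw [hw]; exact (map_ne_zero_iff Φ hΦ).2 ih
  have hex := exists_iterate_mem_span (F := F) w
  obtain ⟨c, hc⟩ := (mem_span_image_Iio_iff w _ _).1 (Nat.find_spec hex)
  have hmin := fun j => Nat.find_min hex (m := j)
  generalize Nat.find hex = m at hc hmin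
  obtain _ | m := m
  · exact absurd (by simpa using hc) (hw0 0)
  -- If all coefficients of the scalar equation vanished, the relation would give Φ^(m+1) e = 0,
  -- against injectivity.
  have hne : ∃ j < m + 1, φ^[j] (c (m - j)) ≠ 0 := by
    by_contra hcon
    push Not at hcon
    refine hw0 (m + 1) (hc.trans (Finset.sum_eq_zero fun i hi => ?_))
    have h1 := hcon (m - i) (by omega)
    rw [Nat.sub_sub_self (by simpa [Nat.lt_succ_iff] using hi), ← RingHom.coe_pow,
      map_eq_zero] at h1
    rw [h1, zero_smul]
  obtain ⟨y, hy0, hy⟩ := hφ (m + 1) (fun j => φ^[j] (c (m - j))) hne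
  -- Fixedness means x₀ = c₀ φ(y) and x_{i+1} = φ(x_i) + c_{i+1} φ(y), closing up with x_m = y. This
  -- is the recursion unrolled; the closing condition is the scalar equation for y.
  let x : ℕ → F := fun i => ∑ j ∈ Finset.range (i + 1), φ^[j] (c (i - j)) * φ^[j + 1] y
  have hx0 : x 0 = c 0 * φ y := by simp [x]
  have hxs : ∀ i, x (i + 1) = φ (x i) + c (i + 1) * φ y := by
    intro i
    simp only [x]
    rw [Finset.sum_range_succ', map_sum]
    congr 1
    refine Finset.sum_congr rfl fun j hj => ?_
    rw [map_mul, ← Function.iterate_succ_apply' φ, ← Function.iterate_succ_apply' φ,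
      Nat.add_sub_add_right]
  have hxm : x m = y := hy.symm
  refine ⟨∑ i ∈ Finset.range (m + 1), x i • w i, fun h0 => ?_, ?_⟩
  · refine hmin m (Nat.lt_succ_self m) ((mem_span_image_Iio_iff w _ _).2 ?_)
    refine ⟨fun i => -(y⁻¹ * x i), ?_⟩
    rw [Finset.sum_range_succ, hxm, add_eq_zero_iff_eq_neg'] at h0
    rw [← inv_smul_smul₀ hy0 (w m), h0, ← Finset.sum_neg_distrib, Finset.smul_sum]
    exact Finset.sum_congr rfl fun i _ => by rw [smul_neg, smul_smul, neg_smul]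
  · simp only [map_sum, LinearMap.map_smulₛₗ, ← hw]
    rw [Finset.sum_range_succ, hxm, hc, Finset.smul_sum, Finset.sum_range_succ', 
      Finset.sum_range_succ', ← add_assoc, ← Finset.sum_add_distrib, hx0, smul_smul, mul_comm (φ y)]
    congr 1
    refine Finset.sum_congr rfl fun i _ => ?_
    rw [hxs, smul_smul, mul_comm (φ y), add_smul]

/-- Divide by the line of a fixed vector v and induct. A fixed class of the quotient lifts to y with
Φ y - y = a v, and y + x v is fixed when x - φ(x) = a. -/
theorem span_fixed_eq_top {φ : F →+* F} (hbij : Function.Bijective φ)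
    (hφ : SolvesHomogeneous φ) (hφ' : ∀ a, ∃ x, x - φ x = a) (n : ℕ) :
    ∀ {M : Type u} [AddCommGroup M] [Module F M] [FiniteDimensional F M],
    Module.finrank F M = n → ∀ Φ : M →ₛₗ[φ] M, Function.Bijective Φ →
      Submodule.span F {v | Φ v = v} = ⊤ := by
  induction n with
  | zero =>
    intro M _ _ _ hn Φ _
    have := Module.finrank_zero_iff.1 hn
    exact Subsingleton.elim _ _
  | succ n ih =>
    intro M _ _ _ hn Φ hΦ
    have : Nontrivial M := Module.nontrivial_of_finrank_pos (R := F) (by omega)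
    obtain ⟨v, hv0, hv⟩ := exists_fixed_ne_zero hφ Φ hΦ.1
    let L := Submodule.span F {v}
    have hL : L ≤ L.comap Φ := by
      rw [Submodule.span_singleton_le_iff_mem]
      change Φ v ∈ L
      rw [hv]
      exact Submodule.mem_span_singleton_self v
    let Ψ : (M ⧸ L) →ₛₗ[φ] (M ⧸ L) := Submodule.mapQ L L Φ hL
    have hΨ : Function.Bijective Ψ := by
      refine ⟨?_, fun y => ?_⟩
      · rw [injective_iff_map_eq_zero]
        intro y hy
        obtain ⟨y, rfl⟩ := Submodule.Quotient.mk_surjective L y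
        rw [Submodule.mapQ_apply, Submodule.Quotient.mk_eq_zero,
          Submodule.mem_span_singleton] at hy
        obtain ⟨a, ha⟩ := hy
        -- Surjectivity of φ makes Φ injective on the quotient: a multiple of v is Φ of a multiple
        -- of v.
        obtain ⟨a, rfl⟩ := hbij.2 a
        rw [Submodule.Quotient.mk_eq_zero, Submodule.mem_span_singleton]
        refine ⟨a, hΦ.1 ?_⟩
        rw [LinearMap.map_smulₛₗ, hv, ha]
      · obtain ⟨y, rfl⟩ := Submodule.Quotient.mk_surjective L y
        obtain ⟨y, rfl⟩ := hΦ.2 y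
        exact ⟨Submodule.Quotient.mk y, Submodule.mapQ_apply ..⟩
    have hfin : Module.finrank F (M ⧸ L) = n := by
      have h1 := Submodule.finrank_quotient_add_finrank L
      have h2 : Module.finrank F L = 1 := finrank_span_singleton hv0
      omega
    have hspan := ih hfin Ψ hΨ
    set S := Submodule.span F {v | Φ v = v} with hS
    have hLS : L ≤ S := (Submodule.span_singleton_le_iff_mem _ _).2 (Submodule.subset_span hv)
    have hmap : S.map L.mkQ = ⊤ := by
      rw [eq_top_iff, ← hspan, Submodule.span_le]
      intro y hy
      obtain ⟨y, rfl⟩ := Submodule.Quotient.mk_surjective L y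
      have h1 : Φ y - y ∈ L := by
        rw [← Submodule.Quotient.mk_eq_zero, Submodule.Quotient.mk_sub, sub_eq_zero]
        exact hy
      obtain ⟨a, ha⟩ := Submodule.mem_span_singleton.1 h1
      obtain ⟨x, hx⟩ := hφ' a
      refine ⟨y + x • v, Submodule.subset_span ?_, ?_⟩
      · change Φ (y + x • v) = y + x • v
        rw [map_add, LinearMap.map_smulₛₗ, hv, eq_add_of_sub_eq ha.symm, ← hx, sub_smul]
        abel
      · rw [map_add, Submodule.mkQ_apply, Submodule.mkQ_apply, add_eq_left,
          Submodule.Quotient.mk_eq_zero]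
        exact Submodule.smul_mem _ _ (Submodule.mem_span_singleton_self v)
    have h2 := Submodule.comap_map_mkQ L S
    rw [hmap, Submodule.comap_top, sup_eq_right.2 hLS] at h2
    exact h2.symm

/-- A basis extracted from the fixed vectors supplies the columns of U. -/
theorem exists_isUnit_mul_map_eq_of_span {φ : F →+* F} {ι : Type*} [Fintype ι] [DecidableEq ι]
    (A : Matrix ι ι F)
    (h : Submodule.span F {v : ι → F | A.mulVec (φ ∘ v) = v} = ⊤) :
    ∃ U : Matrix ι ι F, IsUnit U ∧ A * U.map φ = U := by
  let b := Module.Basis.ofSpan h.ge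
  have : Finite _ := Module.Finite.finite_basis b
  let e := b.indexEquiv (Pi.basisFun F ι)
  have hb : ∀ i, A.mulVec (φ ∘ (b.reindex e i)) = b.reindex e i := fun i => by
    rw [Module.Basis.reindex_apply]
    exact Module.Basis.ofSpan_subset h.ge ⟨_, rfl⟩
  refine ⟨(Pi.basisFun F ι).toMatrix (b.reindex e), ?_, ?_⟩
  · exact IsUnit.of_mul_eq_one _ ((Pi.basisFun F ι).toMatrix_mul_toMatrix_flip (b.reindex e))
  · ext i j
    exact congrFun (hb j) i

theorem exists_isUnit_mul_map_eq {F : Type u} [Field F] {φ : F →+* F}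
    (hbij : Function.Bijective φ) (hφ : SolvesHomogeneous φ) (hφ' : ∀ a, ∃ x, x - φ x = a)
    {n : ℕ} (A : Matrix (Fin n) (Fin n) F) (hA : IsUnit A) :
    ∃ U : Matrix (Fin n) (Fin n) F, IsUnit U ∧ A * U.map φ = U := by
  let Φ : (Fin n → F) →ₛₗ[φ] (Fin n → F) :=
    { toFun := fun v => A.mulVec (φ ∘ v)
      map_add' := fun v w => by
        rw [← Matrix.mulVec_add]
        congr 1
        funext i
        simp
      map_smul' := fun a v => by
        rw [← Matrix.mulVec_smul]
        congr 1
        funext i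
        simp }
  refine exists_isUnit_mul_map_eq_of_span A
    (span_fixed_eq_top hbij hφ hφ' _ rfl Φ ⟨fun v w hvw => ?_, fun w => ?_⟩)
  · exact hbij.1.comp_left (Matrix.mulVec_injective_of_isUnit hA hvw)
  · obtain ⟨v, hv⟩ := Matrix.mulVec_surjective_iff_isUnit.2 hA w
    obtain ⟨v, rfl⟩ := hbij.2.comp_left v
    exact ⟨v, hv⟩

end DifferenceFields

end Slopes

namespace Slopes

/-! ### Étale triviality in matrix form, and its powers -/

section Lang

variable {K : Type u} [NontriviallyNormedField K] [IsUltrametricDist K]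

/-- Matrix form of the condition that every étale `ψ`-module over `K` is trivial. -/
def Lang (ψ : K →+* K) : Prop :=
  ∀ (n : ℕ) (A : Matrix (Fin n) (Fin n) (NormedField.valuation (K := K)).integer), IsUnit A →
    ∃ U : Matrix (Fin n) (Fin n) K, IsUnit U ∧
      A.map (NormedField.valuation (K := K)).integer.subtype * U.map ψ = U

theorem mem_integer_iff_norm {x : K} :
    x ∈ (NormedField.valuation (K := K)).integer ↔ ‖x‖ ≤ 1 := by
  rw [Valuation.mem_integer_iff, NormedField.valuation_apply, ← NNReal.coe_le_coe, coe_nnnorm,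
    NNReal.coe_one]

theorem Lang.exists_of_fintype {ψ : K →+* K} (h : Lang ψ) {ι : Type*} [Fintype ι]
    [DecidableEq ι] (A : Matrix ι ι (NormedField.valuation (K := K)).integer) (hA : IsUnit A) :
    ∃ U : Matrix ι ι K, IsUnit U ∧
      A.map (NormedField.valuation (K := K)).integer.subtype * U.map ψ = U := by
  let e := Fintype.equivFin ι
  obtain ⟨U, hU, hAU⟩ := h _ (A.submatrix e.symm e.symm)
    ((Matrix.isUnit_submatrix_equiv e.symm e.symm).2 hA)
  refine ⟨U.submatrix e e, (Matrix.isUnit_submatrix_equiv e e).2 hU, ?_⟩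
  conv_rhs => rw [← hAU]
  rw [← Matrix.submatrix_map, ← Matrix.submatrix_mul_equiv _ _ e e e, ← Matrix.submatrix_map,
    Matrix.submatrix_submatrix]
  simp

theorem span_col_eq_top {F ι : Type*} [Field F] [Fintype ι] [DecidableEq ι] {U : Matrix ι ι F}
    (hU : IsUnit U) : Submodule.span F (Set.range U.col) = ⊤ := by
  rw [← Matrix.range_mulVecLin, LinearMap.range_eq_top]
  exact Matrix.mulVec_surjective_iff_isUnit.2 hU

/-- Induction of modules: on m + 1 copies of the module let ψ carry each copy identically to the
next, and the last to the first through A. A fixed vector is (v, ψ v, ..., ψ^m v) with A ψ^{m+1}(v)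
= v, so its component in copy 0 is fixed for the original ψ^{m+1}-module. -/
theorem Lang.pow {ψ : K →+* K} (h : Lang ψ) (m : ℕ) : Lang (ψ ^ (m + 1)) := by
  intro n A hA
  let D : Matrix (Fin n × Fin (m + 1)) (Fin n × Fin (m + 1))
      (NormedField.valuation (K := K)).integer :=
    Matrix.blockDiagonal fun b => if b = Fin.last m then A else 1
  have hD : IsUnit D := by
    have h1 : IsUnit fun b : Fin (m + 1) => if b = Fin.last m then A else 1 := by
      refine Pi.isUnit_iff.2 fun b => ?_
      split_ifs
      exacts [hA, isUnit_one]
    exact h1.map (Matrix.blockDiagonalRingHom (Fin n) (Fin (m + 1))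
      (NormedField.valuation (K := K)).integer)
  -- Rotating the row index of the block diagonal matrix produces the cyclic block matrix of the
  -- induced module.
  let e : Fin n × Fin (m + 1) ≃ Fin n × Fin (m + 1) :=
    Equiv.prodCongr (Equiv.refl _) (finRotate (m + 1))
  obtain ⟨U, hU, hAU⟩ := h.exists_of_fintype (D.submatrix e.symm (Equiv.refl _))
    ((Matrix.isUnit_submatrix_equiv _ _).2 hD)
  have key : ∀ c i b, U (e (i, b)) c = ∑ j, (if b = Fin.last m then (A i j : K) else
      (1 : Matrix (Fin n) (Fin n) K) i j) * ψ (U (j, b) c) := by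
    intro c i b
    conv_lhs => rw [← hAU]
    rw [Matrix.mul_apply, Fintype.sum_prod_type]
    refine Finset.sum_congr rfl fun j _ => ?_
    rw [Finset.sum_eq_single b]
    · simp only [Matrix.map_apply, Matrix.submatrix_apply, Equiv.symm_apply_apply,
        Equiv.refl_apply, D, Matrix.blockDiagonal_apply_eq]
      congr 1
      split_ifs
      · rfl
      · rw [Matrix.one_apply, Matrix.one_apply]
        split_ifs <;> simp
    · intro b' _ hb'
      simp only [Matrix.map_apply, Matrix.submatrix_apply, Equiv.symm_apply_apply,
        Equiv.refl_apply, D, Matrix.blockDiagonal_apply_ne _ _ _ hb'.symm, map_zero, zero_mul]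
    · simp
  have hstep : ∀ c i b (hb : b < m + 1), U (i, ⟨b, hb⟩) c = (ψ ^ b) (U (i, 0) c) := by
    intro c i b
    induction b with
    | zero => exact fun _ => rfl
    | succ b ih =>
      intro hb
      have h1 := key c i ⟨b, by omega⟩
      have h2 : e (i, ⟨b, by omega⟩) = (i, ⟨b + 1, hb⟩) := by
        simp only [e, Equiv.prodCongr_apply, Prod.map, Equiv.refl_apply,
          finRotate_of_lt (show b < m by omega)]
      have h3 : (⟨b, by omega⟩ : Fin (m + 1)) ≠ Fin.last m := by
        intro h; have := congrArg Fin.val h; simp at this; omega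
      rw [h2] at h1
      rw [h1]
      simp only [if_neg h3, Matrix.one_apply, ite_mul, one_mul, zero_mul, Finset.sum_ite_eq,
        Finset.mem_univ, if_true]
      rw [ih, pow_succ']
      rfl
  -- The columns of U span, and projection to copy 0 is surjective, so their images span; only
  -- spanning is needed.
  apply exists_isUnit_mul_map_eq_of_span
  let p : (Fin n × Fin (m + 1) → K) →ₗ[K] (Fin n → K) :=
    LinearMap.funLeft K K fun i => (i, 0)
  have hp : Function.Surjective p := LinearMap.funLeft_surjective_of_injective _ _ _
    fun i j hij => (Prod.mk.inj hij).1
  rw [eq_top_iff, ← LinearMap.range_eq_top.2 hp, LinearMap.range_eq_map, ← span_col_eq_top hU,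
    Submodule.map_span, Submodule.span_le]
  rintro _ ⟨_, ⟨c, rfl⟩, rfl⟩
  refine Submodule.subset_span ?_
  funext i
  have h1 := key c i (Fin.last m)
  have h2 : e (i, Fin.last m) = (i, 0) := by
    simp only [e, Equiv.prodCongr_apply, Prod.map, Equiv.refl_apply, finRotate_last]
  rw [h2] at h1
  change _ = U (i, 0) c
  rw [h1]
  simp only [if_true]
  symm
  refine Finset.sum_congr rfl fun j _ => ?_
  have h3 := hstep c j m (Nat.lt_succ_self m)
  change U (j, Fin.last m) c = _ at h3
  rw [h3, ← RingHom.comp_apply, ← RingHom.mul_def, ← pow_succ']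
  rfl

/-- Étale rank one case. -/
theorem Lang.exists_ne_zero {ψ : K →+* K} (h : Lang ψ) {c : K} (hc : ‖c‖ = 1) :
    ∃ x ≠ 0, c * ψ x = x := by
  have hc0 : c ≠ 0 := by rintro rfl; simp at hc
  let A : Matrix (Fin 1) (Fin 1) (NormedField.valuation (K := K)).integer :=
    Matrix.of fun _ _ => ⟨c, mem_integer_iff_norm.2 hc.le⟩
  have hA : IsUnit A := by
    refine IsUnit.of_mul_eq_one
      (Matrix.of fun _ _ => ⟨c⁻¹, mem_integer_iff_norm.2 (by simp [hc])⟩) ?_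
    ext i j
    fin_cases i; fin_cases j
    simp [A, Matrix.mul_apply, hc0]
  obtain ⟨U, hU, hAU⟩ := h 1 A hA
  refine ⟨U 0 0, ?_, ?_⟩
  · have h1 := (Matrix.isUnit_iff_isUnit_det U).1 hU
    rw [Matrix.det_fin_one] at h1
    exact h1.ne_zero
  · have h1 := congrFun (congrFun hAU 0) 0
    simpa [Matrix.mul_apply, A] using h1

end Lang

/-! ### Uniformizers and norms -/

section Discrete

variable {K : Type u} [NontriviallyNormedField K] [IsUltrametricDist K]
  [(NormedField.valuation (K := K)).IsRankOneDiscrete]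

theorem exists_isUniformizer : ∃ ϖ : K, (NormedField.valuation (K := K)).IsUniformizer ϖ :=
  Valuation.IsRankOneDiscrete.generator_mem_range K _

theorem isUniformizer_of_norm_eq {ϖ ϖ' : K} (h : (NormedField.valuation (K := K)).IsUniformizer ϖ)
    (h' : ‖ϖ'‖ = ‖ϖ‖) : (NormedField.valuation (K := K)).IsUniformizer ϖ' := by
  have : ‖ϖ'‖₊ = ‖ϖ‖₊ := NNReal.eq h'
  rw [Valuation.IsUniformizer.iff, NormedField.valuation_apply, this, ← NormedField.valuation_apply]
  exact h

theorem norm_uniformizer_lt_one {ϖ : K}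
    (hϖ : (NormedField.valuation (K := K)).IsUniformizer ϖ) : ‖ϖ‖ < 1 := by
  have := hϖ.val_lt_one
  rwa [NormedField.valuation_apply, ← NNReal.coe_lt_coe] at this

theorem norm_uniformizer_pos {ϖ : K}
    (hϖ : (NormedField.valuation (K := K)).IsUniformizer ϖ) : 0 < ‖ϖ‖ := norm_pos_iff.2 hϖ.ne_zero

theorem exists_norm_eq_zpow {ϖ : K}
    (hϖ : (NormedField.valuation (K := K)).IsUniformizer ϖ) {x : K} (hx : x ≠ 0) :
    ∃ n : ℤ, ‖x‖ = ‖ϖ‖ ^ n := by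
  have h1 : NormedField.valuation x ∈
      Set.range (NormedField.valuation (K := K)) \ {0} := ⟨⟨x, rfl⟩, by simpa using hx⟩
  rw [← Valuation.IsRankOneDiscrete.generator_zpowers_eq_range] at h1
  obtain ⟨_, ⟨n, rfl⟩, hn⟩ := h1
  refine ⟨n, ?_⟩
  have h2 := congrArg NNReal.toReal hn
  simp only [Units.val_zpow_eq_zpow_val] at h2
  rw [← Valuation.IsUniformizer.iff.1 hϖ] at h2
  simpa using h2.symm

theorem norm_le_of_lt_one {ϖ : K}
    (hϖ : (NormedField.valuation (K := K)).IsUniformizer ϖ) {x : K} (hx : ‖x‖ < 1) : ‖x‖ ≤ ‖ϖ‖ := by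
  by_cases h0 : x = 0
  · simp [h0]
  obtain ⟨n, hn⟩ := exists_norm_eq_zpow hϖ h0
  rw [hn] at hx ⊢
  have h1 : 0 < n := by
    by_contra hcon
    exact absurd hx (not_lt.2 (one_le_zpow_of_nonpos₀ (norm_uniformizer_pos hϖ)
      (norm_uniformizer_lt_one hϖ).le (not_lt.1 hcon)))
  calc ‖ϖ‖ ^ n ≤ ‖ϖ‖ ^ (1 : ℤ) := zpow_le_zpow_right_of_le_one₀ (norm_uniformizer_pos hϖ)
        (norm_uniformizer_lt_one hϖ).le h1
    _ = ‖ϖ‖ := zpow_one _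

/-- A nonzero vector can be scaled to have sup norm `1`. -/
theorem exists_zpow_mul_norm {ϖ : K}
    (hϖ : (NormedField.valuation (K := K)).IsUniformizer ϖ)
    {ι : Type*} [Finite ι] {v : ι → K} (hv : v ≠ 0) :
    ∃ n : ℤ, (∀ i, ‖ϖ ^ n * v i‖ ≤ 1) ∧ ∃ i, ‖ϖ ^ n * v i‖ = 1 := by
  obtain ⟨i₀, hi₀⟩ := Function.ne_iff.1 hv
  have : Nonempty ι := ⟨i₀⟩
  obtain ⟨i, hi⟩ := Finite.exists_max fun i => ‖v i‖
  have hvi : v i ≠ 0 := by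
    intro h0
    have := hi i₀
    rw [h0, norm_zero] at this
    exact hi₀ (norm_le_zero_iff.1 this)
  obtain ⟨n, hn⟩ := exists_norm_eq_zpow hϖ hvi
  have h1 : ‖ϖ ^ (-n) * v i‖ = 1 := by
    rw [norm_mul, norm_zpow, hn, ← zpow_add₀ (norm_uniformizer_pos hϖ).ne']
    simp
  refine ⟨-n, fun j => ?_, i, h1⟩
  rw [← h1, norm_mul, norm_mul]
  exact mul_le_mul_of_nonneg_left (hi j) (norm_nonneg _)

end Discrete

end Slopes

namespace Slopes

/-! ### A uniformizer fixed by φ -/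

theorem zpow_pow_comm {G : Type*} [Group G] (g : G) (k : ℤ) (n : ℕ) :
    (g ^ k) ^ n = (g ^ n) ^ k := by
  rw [← zpow_natCast, ← zpow_natCast, ← zpow_mul, ← zpow_mul, mul_comm]

/-- The case d = 1 gives g^(2k-1) = 1 with an odd, hence nonzero, exponent. Choosing d + 1 = |2k-1|
makes the right-hand side trivial. -/
theorem eq_one_of_forall_eq_zpow {G : Type*} [Group G] {g : G}
    (h : ∀ d : ℕ, ∃ k : ℤ, g = (g ^ (d + 1)) ^ k) : g = 1 := by
  obtain ⟨k, hk⟩ := h 1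
  have h1 : g ^ (2 * k - 1) = 1 := by
    rw [zpow_sub, zpow_mul, zpow_one, mul_inv_eq_one, zpow_ofNat]
    exact hk.symm
  obtain ⟨m, hm⟩ : ∃ m : ℕ, (2 * k - 1).natAbs = m + 1 := ⟨(2 * k - 1).natAbs - 1, by omega⟩
  have h2 : g ^ (m + 1) = 1 := by
    rw [← hm]
    exact pow_natAbs_eq_one.2 h1
  obtain ⟨k', hk'⟩ := h m
  rw [hk', h2, one_zpow]

section FixedUniformizer

variable {K : Type u} [NontriviallyNormedField K] [IsUltrametricDist K]
  [(NormedField.valuation (K := K)).IsRankOneDiscrete]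

/-- For a uniformizer π put u = φ(π)/π; one needs u = φ(v)/v with v of norm one, and then π/v is
fixed. Solving φ(x) = u x does not help, since x = π is a solution. But solving φ^{d+1}(x) = u x for
every d gives relations u = u^{k(d+1)} modulo the wanted subgroup B, with k depending on d, and
these force u to be trivial there. -/
theorem exists_uniformizer_map_eq {φ : K →+* K} (hφ : ∀ x, ‖φ x‖ = ‖x‖) (hL : Lang φ) :
    ∃ ϖ : K, (NormedField.valuation (K := K)).IsUniformizer ϖ ∧ φ ϖ = ϖ := by
  obtain ⟨π, hπ⟩ := exists_isUniformizer (K := K)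
  let N : Subgroup Kˣ :=
    { carrier := {v | ‖(v : K)‖ = 1}
      one_mem' := by simp
      mul_mem' := fun {a b} ha hb => by
        change ‖((a * b : Kˣ) : K)‖ = 1
        rw [Units.val_mul, norm_mul, ha, hb, one_mul]
      inv_mem' := fun {a} ha => by
        change ‖((a⁻¹ : Kˣ) : K)‖ = 1
        rw [Units.val_inv_eq_inv_val, norm_inv, ha, inv_one] }
  have hN : ∀ v : Kˣ, v ∈ N ↔ ‖(v : K)‖ = 1 := fun v => Iff.rfl
  let φ' : Kˣ →* Kˣ := Units.map φ
  have hφ' : ∀ v : Kˣ, ((φ' v : Kˣ) : K) = φ v := fun v => rfl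
  let θ : Kˣ →* Kˣ := φ' / MonoidHom.id _
  have hθ : ∀ v, θ v = φ' v / v := fun v => rfl
  have hθN : ∀ v, θ v ∈ N := fun v => by
    rw [hN, hθ, Units.val_div_eq_div_val, norm_div, hφ', hφ]
    exact div_self (norm_ne_zero_iff.2 v.ne_zero)
  let B : Subgroup Kˣ := N.map θ
  let π' : Kˣ := Units.mk0 π hπ.ne_zero
  let u : Kˣ := θ π'
  let mk : Kˣ →* Kˣ ⧸ B := QuotientGroup.mk' B
  have hmkN : ∀ v ∈ N, mk (θ v) = 1 := fun v hv =>
    (QuotientGroup.eq_one_iff _).2 ⟨v, hv, rfl⟩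
  -- Since φ^d(x)/x has norm one, φ^d(x) and x have the same image under θ modulo B, so the product
  -- telescoping φ^d(x)/x is a d-th power.
  have hiter : ∀ (x : Kˣ) (d : ℕ), mk ((φ'^[d] x) / x) = mk (θ x) ^ d := by
    intro x d
    have hd : φ'^[d] x / x ∈ N := by
      induction d with
      | zero => simp [N.one_mem]
      | succ d ih =>
        rw [Function.iterate_succ_apply', ← div_mul_div_cancel _ (φ'^[d] x)]
        exact N.mul_mem (hθN _) ih
    induction d with
    | zero => simp
    | succ d ih =>
      have hd' : φ'^[d] x / x ∈ N := by
        have h1 := N.mul_mem (N.inv_mem (hθN (φ'^[d] x))) hd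
        rw [Function.iterate_succ_apply', hθ] at h1
        simpa using h1
      rw [Function.iterate_succ_apply', ← div_mul_div_cancel _ (φ'^[d] x), map_mul, ih hd',
        pow_succ']
      congr 1
      have h2 := hmkN _ hd'
      rw [map_div, map_div, div_eq_one] at h2
      exact h2
  -- Writing x = v π^k with v of norm one gives θ(x) ≡ u^k modulo B.
  have hpow : ∀ d : ℕ, ∃ k : ℤ, mk u = (mk u ^ (d + 1)) ^ k := by
    intro d
    obtain ⟨x, hx0, hx⟩ := (hL.pow d).exists_ne_zero (c := ((u⁻¹ : Kˣ) : K))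
      ((hN _).1 (N.inv_mem (hθN π')))
    let x' : Kˣ := Units.mk0 x hx0
    have hx' : φ'^[d + 1] x' / x' = u := by
      rw [div_eq_iff_eq_mul, ← inv_mul_eq_iff_eq_mul]
      ext
      have h1 : ∀ d : ℕ, ((φ'^[d] x' : Kˣ) : K) = (φ ^ d) x := by
        intro d
        induction d with
        | zero => rfl
        | succ d ih => rw [Function.iterate_succ_apply', hφ', ih, pow_succ']; rfl
      rw [Units.val_mul, h1]
      exact hx
    obtain ⟨k, hk⟩ := exists_norm_eq_zpow hπ hx0
    have hv : x' / π' ^ k ∈ N := by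
      rw [hN, Units.val_div_eq_div_val, Units.val_zpow_eq_zpow_val, norm_div, norm_zpow]
      change ‖x‖ / ‖π‖ ^ k = 1
      rw [hk, div_self (zpow_ne_zero _ (norm_uniformizer_pos hπ).ne')]
    refine ⟨k, ?_⟩
    have h2 : mk (θ x') = mk u ^ k := by
      have := hmkN _ hv
      rwa [map_div, map_div, div_eq_one, map_zpow, map_zpow] at this
    conv_lhs => rw [← hx', hiter, h2]
    exact zpow_pow_comm _ _ _
  have hu : mk u = 1 := eq_one_of_forall_eq_zpow hpow
  obtain ⟨v, hv, hvu⟩ := (QuotientGroup.eq_one_iff u).1 hu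
  refine ⟨((π' / v : Kˣ) : K), isUniformizer_of_norm_eq hπ ?_, ?_⟩
  · rw [Units.val_div_eq_div_val, norm_div, (hN v).1 hv, div_one]
    rfl
  · have h1 : θ (π' / v) = 1 := by rw [map_div, hvu, div_self']
    rw [hθ, div_eq_one] at h1
    rw [← hφ', h1]

end FixedUniformizer

/-! ### Reduction to the residue field -/

section Residue

variable (K : Type u) [NontriviallyNormedField K] [IsUltrametricDist K]

/-- The residue field of `K`. -/
abbrev ResField : Type u :=
  IsLocalRing.ResidueField (NormedField.valuation (K := K)).valuationSubring

variable {K}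

theorem mem_valuationSubring_iff_norm {x : K} :
    x ∈ (NormedField.valuation (K := K)).valuationSubring ↔ ‖x‖ ≤ 1 := mem_integer_iff_norm

open Classical in
/-- Reduction modulo the maximal ideal, extended by zero. -/
noncomputable def red (x : K) : ResField K :=
  if h : ‖x‖ ≤ 1 then IsLocalRing.residue _ ⟨x, mem_valuationSubring_iff_norm.2 h⟩ else 0

theorem red_def {x : K} (h : ‖x‖ ≤ 1) :
    red x = IsLocalRing.residue _ ⟨x, mem_valuationSubring_iff_norm.2 h⟩ := dif_pos h

theorem exists_red_eq (a : ResField K) : ∃ x : K, ‖x‖ ≤ 1 ∧ red x = a := by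
  obtain ⟨⟨x, hx⟩, rfl⟩ := IsLocalRing.residue_surjective a
  exact ⟨x, mem_valuationSubring_iff_norm.1 hx, red_def (mem_valuationSubring_iff_norm.1 hx)⟩

theorem red_add {x y : K} (hx : ‖x‖ ≤ 1) (hy : ‖y‖ ≤ 1) : red (x + y) = red x + red y := by
  rw [red_def hx, red_def hy,
    red_def ((IsUltrametricDist.norm_add_le_max x y).trans (max_le hx hy)), ← map_add]
  rfl

theorem red_mul {x y : K} (hx : ‖x‖ ≤ 1) (hy : ‖y‖ ≤ 1) : red (x * y) = red x * red y := by
  rw [red_def hx, red_def hy,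
    red_def (by rw [norm_mul]; exact mul_le_one₀ hx (norm_nonneg _) hy), ← map_mul]
  rfl

theorem red_zero : red (0 : K) = 0 := by
  rw [red_def (by simp)]
  exact map_zero _

theorem red_one : red (1 : K) = 1 := by
  rw [red_def (by simp)]
  exact map_one _

theorem red_eq_zero_iff {x : K} (hx : ‖x‖ ≤ 1) : red x = 0 ↔ ‖x‖ < 1 := by
  rw [red_def hx, IsLocalRing.residue_eq_zero_iff, Valuation.mem_maximalIdeal_iff,
    NormedField.valuation_apply, ← NNReal.coe_lt_coe, coe_nnnorm, NNReal.coe_one]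

theorem red_eq_red_iff {x y : K} (hx : ‖x‖ ≤ 1) (hy : ‖y‖ ≤ 1) :
    red x = red y ↔ ‖x - y‖ < 1 := by
  have hy' : ‖-y‖ ≤ 1 := by rwa [norm_neg]
  have hxy : ‖x - y‖ ≤ 1 := by
    rw [sub_eq_add_neg]
    exact (IsUltrametricDist.norm_add_le_max x _).trans (max_le hx hy')
  rw [← red_eq_zero_iff hxy, ← sub_eq_zero (a := red x), sub_eq_iff_eq_add (a := red x),
    zero_add]
  have h1 : red x = red (x - y) + red y := by rw [← red_add hxy hy, sub_add_cancel]
  rw [h1, add_eq_right]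

theorem red_sum {ι : Type*} (s : Finset ι) (f : ι → K) (hf : ∀ i ∈ s, ‖f i‖ ≤ 1) :
    red (∑ i ∈ s, f i) = ∑ i ∈ s, red (f i) := by
  classical
  induction s using Finset.induction_on with
  | empty => simp [red_zero]
  | insert a s ha ih =>
    rw [Finset.sum_insert ha, Finset.sum_insert ha, red_add (hf a (Finset.mem_insert_self a s)),
      ih fun i hi => hf i (Finset.mem_insert_of_mem hi)]
    exact IsUltrametricDist.norm_sum_le_of_forall_le_of_nonneg zero_le_one
      fun i hi => hf i (Finset.mem_insert_of_mem hi)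

/-- The endomorphism of the residue field induced by an isometric endomorphism. -/
noncomputable def redHom (φ : K →+* K) (hφ : ∀ x, ‖φ x‖ = ‖x‖) : ResField K →+* ResField K :=
  Ideal.Quotient.lift _
    ({ toFun := fun x => red (φ x)
       map_one' := by simp [red_one]
       map_zero' := by simp [red_zero]
       map_mul' := fun x y => by
         rw [MulMemClass.coe_mul, map_mul, red_mul]
         · rw [hφ]; exact mem_valuationSubring_iff_norm.1 x.2
         · rw [hφ]; exact mem_valuationSubring_iff_norm.1 y.2
       map_add' := fun x y => by
         rw [AddMemClass.coe_add, map_add, red_add]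
         · rw [hφ]; exact mem_valuationSubring_iff_norm.1 x.2
         · rw [hφ]; exact mem_valuationSubring_iff_norm.1 y.2 } :
      (NormedField.valuation (K := K)).valuationSubring →+* ResField K)
    fun x hx => by
      have hx1 := mem_valuationSubring_iff_norm.1 x.2
      change red (φ (x : K)) = 0
      rw [red_eq_zero_iff (by rwa [hφ]), hφ, ← red_eq_zero_iff hx1, red_def hx1]
      exact (IsLocalRing.residue_eq_zero_iff x).2 hx

theorem redHom_red (φ : K →+* K) (hφ : ∀ x, ‖φ x‖ = ‖x‖) {x : K} (hx : ‖x‖ ≤ 1) :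
    redHom φ hφ (red x) = red (φ x) := by
  rw [red_def hx]
  rfl

theorem redHom_bijective {φ : K →+* K} (hφ : ∀ x, ‖φ x‖ = ‖x‖) (hbij : Function.Bijective φ) :
    Function.Bijective (redHom φ hφ) := by
  refine ⟨(redHom φ hφ).injective, fun a => ?_⟩
  obtain ⟨x, hx, rfl⟩ := exists_red_eq a
  obtain ⟨y, rfl⟩ := hbij.2 x
  rw [hφ] at hx
  exact ⟨red y, redHom_red φ hφ hx⟩

end Residue

/-! ### Equations over the residue field -/

section LangResidue

variable {K : Type u} [NontriviallyNormedField K] [IsUltrametricDist K]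
  [(NormedField.valuation (K := K)).IsRankOneDiscrete]

/-- An integral unit matrix over `K` has an integral fixed vector of norm one. -/
theorem Lang.exists_primitive {φ : K →+* K} (hL : Lang φ) {ϖ : K}
    (hϖ : (NormedField.valuation (K := K)).IsUniformizer ϖ) (hϖφ : φ ϖ = ϖ)
    {ι : Type*} [Fintype ι] [DecidableEq ι] [Nonempty ι]
    (A : Matrix ι ι (NormedField.valuation (K := K)).integer) (hA : IsUnit A) :
    ∃ v : ι → K, (∀ i, ‖v i‖ ≤ 1) ∧ (∃ i, ‖v i‖ = 1) ∧
      ∀ i, ∑ j, (A i j : K) * φ (v j) = v i := by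
  obtain ⟨U, hU, hAU⟩ := hL.exists_of_fintype A hA
  obtain ⟨c⟩ := ‹Nonempty ι›
  have hc : U.col c ≠ 0 := by
    intro h0
    have h1 := (Matrix.isUnit_iff_isUnit_det U).1 hU
    rw [Matrix.det_eq_zero_of_column_eq_zero c (congrFun h0)] at h1
    exact not_isUnit_zero h1
  -- As φ(ϖ) = ϖ, rescaling a fixed column by a power of ϖ keeps it fixed.
  obtain ⟨n, hn, hn'⟩ := exists_zpow_mul_norm hϖ hc
  refine ⟨fun i => ϖ ^ n * U i c, hn, hn', fun i => ?_⟩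
  have h1 := congrFun (congrFun hAU i) c
  change _ = ϖ ^ n * U i c
  rw [← h1, Matrix.mul_apply, Finset.mul_sum]
  refine Finset.sum_congr rfl fun j _ => ?_
  rw [map_mul, map_zpow₀, hϖφ, mul_left_comm]
  rfl

/-- Any lift of A is invertible because the valuation ring is local, and a fixed vector of norm one
has nonzero reduction. -/
theorem Lang.exists_fixed_residue {φ : K →+* K} (hφ : ∀ x, ‖φ x‖ = ‖x‖) (hL : Lang φ) {ϖ : K}
    (hϖ : (NormedField.valuation (K := K)).IsUniformizer ϖ) (hϖφ : φ ϖ = ϖ)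
    {ι : Type*} [Fintype ι] [DecidableEq ι] [Nonempty ι]
    (A : Matrix ι ι (ResField K)) (hA : IsUnit A) :
    ∃ v : ι → ResField K, v ≠ 0 ∧ A.mulVec (redHom φ hφ ∘ v) = v := by
  choose lift hlift hred using exists_red_eq (K := K)
  let f : (NormedField.valuation (K := K)).integer →+* ResField K :=
    IsLocalRing.residue (NormedField.valuation (K := K)).valuationSubring
  have hf : ∀ x, f x = red (x : K) := fun x => (red_def (mem_integer_iff_norm.1 x.2)).symm
  let A' : Matrix ι ι (NormedField.valuation (K := K)).integer :=
    Matrix.of fun i j => ⟨lift (A i j), mem_integer_iff_norm.2 (hlift _)⟩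
  have hA' : A'.map f = A := by
    ext i j
    rw [Matrix.map_apply, hf]
    exact hred _
  have hunit : IsUnit A' := by
    rw [Matrix.isUnit_iff_isUnit_det] at hA ⊢
    rw [← hA', ← RingHom.mapMatrix_apply, ← RingHom.map_det] at hA
    exact (isUnit_map_iff (IsLocalRing.residue
      (NormedField.valuation (K := K)).valuationSubring) _).1 hA
  obtain ⟨v, hv, ⟨i₀, hi₀⟩, hAv⟩ := hL.exists_primitive hϖ hϖφ A' hunit
  refine ⟨fun i => red (v i), fun h0 => ?_, ?_⟩
  · have h1 := congrFun h0 i₀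
    rw [Pi.zero_apply, red_eq_zero_iff (hv _)] at h1
    exact h1.ne hi₀
  · funext i
    have hφv : ∀ j, ‖φ (v j)‖ ≤ 1 := fun j => by rw [hφ]; exact hv j
    rw [← hAv i, red_sum]
    · refine Finset.sum_congr rfl fun j _ => ?_
      change A i j * redHom φ hφ (red (v j)) = red (lift (A i j) * φ (v j))
      rw [red_mul (hlift _) (hφv j), ← redHom_red φ hφ (hv j), hred]
    · intro j _
      rw [norm_mul]
      exact mul_le_one₀ (hlift _) (norm_nonneg _) (hφv j)

theorem Lang.solvesHomogeneous_residue {φ : K →+* K} (hφ : ∀ x, ‖φ x‖ = ‖x‖) (hL : Lang φ) {ϖ : K}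
    (hϖ : (NormedField.valuation (K := K)).IsUniformizer ϖ) (hϖφ : φ ϖ = ϖ) :
    SolvesHomogeneous (redHom φ hφ) := by
  classical
  intro m d hd
  induction m with
  | zero => obtain ⟨j, hj, -⟩ := hd; exact absurd hj (Nat.not_lt_zero j)
  | succ m ih =>
    by_cases hm : d m = 0
    · obtain ⟨j, hj, hj0⟩ := hd
      have hjm : j ≠ m := by rintro rfl; exact hj0 hm
      obtain ⟨y, hy0, hy⟩ := ih ⟨j, by omega, hj0⟩
      exact ⟨y, hy0, by rw [Finset.sum_range_succ, hm, zero_mul, add_zero]; exact hy⟩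
    -- Companion matrix, invertible because the top coefficient is nonzero. A fixed vector has the
    -- form (y, φ y, ..., φ^m y), and its first row is the equation.
    · let A : Matrix (Fin (m + 1)) (Fin (m + 1)) (ResField K) :=
        Matrix.of (Fin.cons (fun j => d j) fun i => Pi.single i.castSucc 1)
      have hA0 : ∀ v, A.mulVec v 0 = ∑ j : Fin (m + 1), d j * v j := fun v => rfl
      have hAs : ∀ v (i : Fin m), A.mulVec v i.succ = v i.castSucc := fun v i => by
        change Pi.single i.castSucc 1 ⬝ᵥ v = _
        rw [single_dotProduct, one_mul]
      have hA : IsUnit A := by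
        rw [← Matrix.mulVec_injective_iff_isUnit]
        rw [← Matrix.coe_mulVecLin, injective_iff_map_eq_zero]
        intro v hv
        have h1 : ∀ i : Fin m, v i.castSucc = 0 := fun i => by
          rw [← hAs v i]; exact congrFun hv i.succ
        have h2 : ∑ j : Fin (m + 1), d j * v j = 0 := congrFun hv 0
        rw [Fin.sum_univ_castSucc, Finset.sum_eq_zero fun i _ => by rw [h1, mul_zero],
          zero_add] at h2
        funext i
        refine Fin.lastCases ?_ h1 i
        exact (mul_eq_zero.1 h2).resolve_left hm
      obtain ⟨v, hv0, hv⟩ := hL.exists_fixed_residue hφ hϖ hϖφ A hA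
      have hstep : ∀ i (hi : i < m + 1), v ⟨i, hi⟩ = (redHom φ hφ)^[i] (v 0) := by
        intro i
        induction i with
        | zero => exact fun _ => rfl
        | succ i ih' =>
          intro hi
          have h1 := hAs (redHom φ hφ ∘ v) ⟨i, by omega⟩
          rw [hv] at h1
          rw [Function.iterate_succ_apply', ← ih' (by omega)]
          exact h1
      refine ⟨v 0, fun h0 => hv0 ?_, ?_⟩
      · funext ⟨i, hi⟩
        rw [hstep, h0, ← RingHom.coe_pow, map_zero]
        rfl
      · have h1 := hA0 (redHom φ hφ ∘ v)
        rw [hv] at h1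
        rw [← Fin.sum_univ_eq_sum_range (fun j => d j * (redHom φ hφ)^[j + 1] (v 0))]
        refine h1.trans (Finset.sum_congr rfl fun j _ => ?_)
        rw [Function.iterate_succ_apply', ← hstep j j.2]
        rfl

/-- The extension with matrix (1, b; 0, 1) would encode the equation, but its primitive fixed vector
may lie in the subobject and say nothing about b. The perturbation by ϖ b below the diagonal, with
the corner adjusted to keep determinant 1, makes every primitive fixed vector give a solution modulo
ϖ. -/
theorem Lang.exists_sub_eq_residue {φ : K →+* K} (hφ : ∀ x, ‖φ x‖ = ‖x‖) (hL : Lang φ) {ϖ : K}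
    (hϖ : (NormedField.valuation (K := K)).IsUniformizer ϖ) (hϖφ : φ ϖ = ϖ) (b : K)
    (hb : ‖b‖ ≤ 1) : ∃ y, ‖y‖ ≤ 1 ∧ ‖b - (y - φ y)‖ < 1 := by
  let b' : (NormedField.valuation (K := K)).integer := ⟨b, mem_integer_iff_norm.2 hb⟩
  let w : (NormedField.valuation (K := K)).integer :=
    ⟨ϖ, mem_integer_iff_norm.2 (norm_uniformizer_lt_one hϖ).le⟩
  have hA : IsUnit !![1 + w * b' * b', b'; w * b', 1] := by
    rw [Matrix.isUnit_iff_isUnit_det, Matrix.det_fin_two_of]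
    convert isUnit_one using 1
    ring
  obtain ⟨v, hv, ⟨i₀, hi₀⟩, hAv⟩ := hL.exists_primitive hϖ hϖφ _ hA
  have e0 : (1 + ϖ * b * b) * φ (v 0) + b * φ (v 1) = v 0 := by
    simpa [Fin.sum_univ_two, w, b'] using hAv 0
  have e1 : ϖ * b * φ (v 0) + φ (v 1) = v 1 := by
    simpa [Fin.sum_univ_two, w, b'] using hAv 1
  have hw := norm_uniformizer_lt_one hϖ
  have hsmall : ∀ x : K, ‖x‖ ≤ 1 → ‖ϖ * x‖ < 1 := fun x hx => by
    rw [norm_mul]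
    exact (mul_le_of_le_one_right (norm_nonneg _) hx).trans_lt hw
  have hmul : ∀ x y : K, ‖x‖ ≤ 1 → ‖y‖ ≤ 1 → ‖x * y‖ ≤ 1 := fun x y hx hy => by
    rw [norm_mul]
    exact mul_le_one₀ hx (norm_nonneg _) hy
  have hdiv : ∀ x y : K, ‖y‖ = 1 → ‖b * y * φ y - x * φ y + φ x * y‖ < 1 →
      ‖b - (x / y - φ (x / y))‖ < 1 := by
    intro x y hy h
    have hy0 : y ≠ 0 := by rintro rfl; simp at hy
    have hφy0 : φ y ≠ 0 := (map_ne_zero φ).2 hy0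
    have h1 : b * y * φ y - x * φ y + φ x * y = (b - (x / y - φ (x / y))) * (y * φ y) := by
      rw [map_div₀]
      field_simp
      ring
    rw [h1, norm_mul, norm_mul, hφ, hy, mul_one, mul_one] at h
    exact h
  have hquot : ∀ x y : K, ‖x‖ ≤ 1 → ‖y‖ = 1 → ‖x / y‖ ≤ 1 := fun x y hx hy => by
    rwa [norm_div, hy, div_one]
  have hφ0 : ‖φ (v 0)‖ ≤ 1 := by rw [hφ]; exact hv 0
  -- If v₁ is a unit, modulo ϖ the equations read v₁ = φ(v₁) and v₀ - φ(v₀) = b φ(v₁), so v₀/v₁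
  -- works.
  by_cases h1 : ‖v 1‖ = 1
  · refine ⟨v 0 / v 1, hquot _ _ (hv 0) h1, hdiv _ _ h1 ?_⟩
    have : b * v 1 * φ (v 1) - v 0 * φ (v 1) + φ (v 0) * v 1 =
        ϖ * (b * φ (v 0) * (v 0 + -(b * v 1))) := by
      linear_combination v 1 * e0 - v 0 * e1
    rw [this]
    refine hsmall _ (hmul _ _ (hmul _ _ hb hφ0) ?_)
    refine (IsUltrametricDist.norm_add_le_max _ _).trans (max_le (hv 0) ?_)
    rw [norm_neg]
    exact hmul _ _ hb (hv 1)
  · have h0 : ‖v 0‖ = 1 := by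
      fin_cases i₀
      · exact hi₀
      · exact absurd hi₀ h1
    have hϖ0 := hϖ.ne_zero
    -- Otherwise v₁ = ϖ t and v₀ is a unit fixed modulo ϖ. Dividing the second equation by ϖ gives t
    -- - φ(t) = b φ(v₀), so t/v₀ works.
    obtain ⟨t, ht⟩ : ∃ t, v 1 = ϖ * t := ⟨v 1 / ϖ, by field_simp⟩
    have htn : ‖t‖ ≤ 1 := by
      have h2 := norm_le_of_lt_one hϖ (lt_of_le_of_ne (hv 1) h1)
      rw [ht, norm_mul] at h2
      exact le_of_mul_le_mul_left (by rwa [mul_one]) (norm_uniformizer_pos hϖ)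
    rw [ht, map_mul, hϖφ] at e0 e1
    have e1' : b * φ (v 0) + φ t = t := by
      refine mul_left_cancel₀ hϖ0 ?_
      linear_combination e1
    refine ⟨t / v 0, hquot _ _ htn h0, hdiv _ _ h0 ?_⟩
    have : b * v 0 * φ (v 0) - t * φ (v 0) + φ t * v 0 = ϖ * (b * t * t) := by
      linear_combination v 0 * e1' - t * e0 + t * ϖ * b * e1'
    rw [this]
    exact hsmall _ (hmul _ _ (hmul _ _ hb htn) htn)

end LangResidue

end Slopes

namespace Slopes

open Filter Topology

/-! ### Solving x - φ(x) = b in K -/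

section Constants

variable {K : Type u} [NontriviallyNormedField K] [IsUltrametricDist K] [CompleteSpace K]
  [(NormedField.valuation (K := K)).IsRankOneDiscrete]

/-- `1 - φ` is surjective on every ball of `K` around the origin. -/
theorem Lang.exists_sub_eq {φ : K →+* K} (hφ : ∀ x, ‖φ x‖ = ‖x‖) (hL : Lang φ) {ϖ : K}
    (hϖ : (NormedField.valuation (K := K)).IsUniformizer ϖ) (hϖφ : φ ϖ = ϖ) (b : K) :
    ∃ x, ‖x‖ ≤ ‖b‖ ∧ x - φ x = b := by
  have hϖ0 := hϖ.ne_zero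
  have hw := norm_uniformizer_lt_one hϖ
  have unit_ball : ∀ b : K, ‖b‖ ≤ 1 → ∃ x, ‖x‖ ≤ 1 ∧ x - φ x = b := by
    intro b hb
    choose Y hY hY' using hL.exists_sub_eq_residue hφ hϖ hϖφ
    -- Solve modulo ϖ, divide the error by ϖ and repeat. Since φ fixes ϖ, the corrections add up to
    -- the series of the terms ϖ^n Y_n.
    let next : {x : K // ‖x‖ ≤ 1} → {x : K // ‖x‖ ≤ 1} := fun x =>
      ⟨(x.1 - (Y x.1 x.2 - φ (Y x.1 x.2))) / ϖ, by
        rw [norm_div, div_le_one (norm_uniformizer_pos hϖ)]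
        exact norm_le_of_lt_one hϖ (hY' x.1 x.2)⟩
    let B : ℕ → {x : K // ‖x‖ ≤ 1} := fun n => next^[n] ⟨b, hb⟩
    have hB : ∀ n, ((B (n + 1)).1 : K) * ϖ = (B n).1 - (Y _ (B n).2 - φ (Y _ (B n).2)) := by
      intro n
      have : B (n + 1) = next (B n) := Function.iterate_succ_apply' next n _
      rw [this]
      exact div_mul_cancel₀ _ hϖ0
    let y : ℕ → K := fun n => ϖ ^ n * Y _ (B n).2
    have hy : ∀ n, ‖y n‖ ≤ ‖ϖ‖ ^ n := fun n => by
      rw [norm_mul, norm_pow]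
      exact mul_le_of_le_one_right (by positivity) (hY _ _)
    have hys : Summable y :=
      Summable.of_norm_bounded (summable_geometric_of_lt_one (norm_nonneg _) hw) hy
    refine ⟨∑' n, y n, norm_tsum_le_of_forall zero_le_one fun n => (hy n).trans
      (pow_le_one₀ (norm_nonneg _) hw.le), ?_⟩
    have hcont : Continuous φ := (AddMonoidHomClass.isometry_of_norm φ hφ).continuous
    have hs := hys.hasSum.sub (hys.hasSum.map φ hcont)
    refine tendsto_nhds_unique hs.tendsto_sum_nat ?_
    have hpart : ∀ N, ∑ n ∈ Finset.range N, (y n - φ (y n)) = b - ϖ ^ N * (B N).1 := by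
      intro N
      induction N with
      | zero => simp [B]
      | succ N ih =>
        rw [Finset.sum_range_succ, ih]
        simp only [y, map_mul, map_pow, hϖφ]
        linear_combination ϖ ^ N * hB N
    change Tendsto (fun N => ∑ n ∈ Finset.range N, (y n - φ (y n))) atTop (𝓝 b)
    simp only [hpart]
    have hz : Tendsto (fun N => ϖ ^ N * (B N).1) atTop (𝓝 0) := by
      refine squeeze_zero_norm (fun N => ?_) (tendsto_pow_atTop_nhds_zero_of_lt_one
        (norm_nonneg ϖ) hw)
      rw [norm_mul, norm_pow]
      exact mul_le_of_le_one_right (by positivity) (B N).2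
    simpa using hz.const_sub b
  by_cases hb : b = 0
  · exact ⟨0, by simp [hb]⟩
  obtain ⟨n, hn⟩ := exists_norm_eq_zpow hϖ hb
  have hn0 : ϖ ^ n ≠ 0 := zpow_ne_zero _ hϖ0
  have hb' : ‖b / ϖ ^ n‖ ≤ 1 := by
    rw [norm_div, norm_zpow, ← hn, div_self (norm_ne_zero_iff.2 hb)]
  obtain ⟨x, hx, hxb⟩ := unit_ball _ hb'
  refine ⟨ϖ ^ n * x, ?_, ?_⟩
  · rw [norm_mul, norm_zpow, ← hn]
    exact mul_le_of_le_one_right (norm_nonneg _) hx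
  · rw [map_mul, map_zpow₀, hϖφ, ← mul_sub, hxb, mul_div_cancel₀ _ hn0]

end Constants

/-! ### Well-ordered sets of exponents under multiplication by q -/

section WellOrdered

theorem isWF_of_forall_inter_Iic {S : Set ℚ} (h : ∀ x ∈ S, (S ∩ Set.Iic x).IsWF) : S.IsWF := by
  rw [Set.isWF_iff_no_descending_seq]
  intro f hf hmem
  exact Set.isWF_iff_no_descending_seq.1 (h (f 0) (hmem 0)) f hf
    fun n => ⟨hmem n, hf.antitone (Nat.zero_le n)⟩

theorem finite_setOf_mem_of_strictAnti {S : Set ℚ} (hS : S.IsWF) {t : ℕ → ℚ} (ht : StrictAnti t) :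
    {n | t n ∈ S}.Finite := by
  by_contra hinf
  exact Set.isWF_iff_no_descending_seq.1 hS (fun n => t (Nat.nth (fun n => t n ∈ S) n))
    (ht.comp_strictMono (Nat.nth_strictMono hinf)) fun n => Nat.nth_mem_of_infinite hinf n

/-- Below a given x only finitely many n matter: i / q^n is at least the least positive element of S
while i ≤ x. So there the set lies in a finite union of dilates of S. -/
theorem isWF_setOf_exists_div_mem {S : Set ℚ} (hS : S.IsWF) {q : ℕ} (hq : 1 < q) :
    {i : ℚ | 0 < i ∧ ∃ n : ℕ, i / q ^ n ∈ S}.IsWF := by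
  have hq1 : (1 : ℚ) < q := by exact_mod_cast hq
  have hq0 : (0 : ℚ) < q := zero_lt_one.trans hq1
  refine isWF_of_forall_inter_Iic ?_
  rintro x ⟨hx0, nx, hnx⟩
  have hS' : (S ∩ Set.Ioi 0).IsWF := hS.mono Set.inter_subset_left
  have hne : (S ∩ Set.Ioi 0).Nonempty := ⟨_, hnx, by
    change 0 < x / q ^ nx
    positivity⟩
  have hm0 : 0 < hS'.min hne := (hS'.min_mem hne).2
  obtain ⟨N, hN⟩ := pow_unbounded_of_one_lt (x / hS'.min hne) hq1
  have hpwo : (⋃ n ∈ Finset.range N, (fun j : ℚ => j * q ^ n) '' S).IsPWO :=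
    (Finset.isPWO_bUnion _).2 fun n _ => hS.isPWO.image_of_monotone
      fun a b hab => mul_le_mul_of_nonneg_right hab (by positivity)
  refine hpwo.isWF.mono ?_
  rintro i ⟨⟨hi0, n, hn⟩, hix⟩
  have hmin := hS'.min_le hne (show i / q ^ n ∈ S ∩ Set.Ioi 0 from ⟨hn, by
    change 0 < i / q ^ n
    positivity⟩)
  have hnN : n < N := by
    by_contra hcon
    have h1 : (q : ℚ) ^ N ≤ q ^ n := pow_le_pow_right₀ hq1.le (not_lt.1 hcon)
    rw [le_div_iff₀ (by positivity)] at hmin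
    rw [div_lt_iff₀ hm0] at hN
    have h2 : hS'.min hne * q ^ N ≤ hS'.min hne * q ^ n := mul_le_mul_of_nonneg_left h1 hm0.le
    have h3 : i ≤ x := hix
    linarith
  simp only [Set.mem_iUnion, Finset.mem_range]
  exact ⟨n, hnN, _, hn, by field_simp⟩

/-- For i ≤ x < 0, large n would push i q^n below the minimum of S, so again finitely many dilates
suffice. -/
theorem isWF_setOf_exists_mul_mem {S : Set ℚ} (hS : S.IsWF) {q : ℕ} (hq : 1 < q) :
    {i : ℚ | i < 0 ∧ ∃ n : ℕ, i * q ^ n ∈ S}.IsWF := by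
  have hq1 : (1 : ℚ) < q := by exact_mod_cast hq
  have hq0 : (0 : ℚ) < q := zero_lt_one.trans hq1
  refine isWF_of_forall_inter_Iic ?_
  rintro x ⟨hx0, nx, hnx⟩
  have hne : S.Nonempty := ⟨_, hnx⟩
  obtain ⟨N, hN⟩ := pow_unbounded_of_one_lt (hS.min hne / x) hq1
  rw [div_lt_iff_of_neg hx0] at hN
  have hpwo : (⋃ n ∈ Finset.range N, (fun j : ℚ => j / q ^ n) '' S).IsPWO :=
    (Finset.isPWO_bUnion _).2 fun n _ => hS.isPWO.image_of_monotone
      fun a b hab => div_le_div_of_nonneg_right hab (by positivity)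
  refine hpwo.isWF.mono ?_
  rintro i ⟨⟨hi0, n, hn⟩, hix⟩
  have hmin := hS.min_le hne hn
  have hnN : n < N := by
    by_contra hcon
    have h1 : (q : ℚ) ^ N ≤ q ^ n := pow_le_pow_right₀ hq1.le (not_lt.1 hcon)
    have h2 : x * (q : ℚ) ^ n ≤ x * q ^ N := mul_le_mul_of_nonpos_left h1 hx0.le
    have h3 : i * (q : ℚ) ^ n ≤ x * q ^ n := mul_le_mul_of_nonneg_right hix (by positivity)
    linarith
  simp only [Set.mem_iUnion, Finset.mem_range]
  exact ⟨n, hnN, _, hn, by field_simp⟩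

end WellOrdered

/-! ### The weight combining the Gauss norm with one radius -/

section Bound

variable {K : Type u} [NontriviallyNormedField K]

/-- The weight `max(1, e^{-r i})`. -/
noncomputable def wgt (r : ℝ) (i : ℚ) : ℝ := max 1 (Real.exp (-(r * (i : ℝ))))

theorem one_le_wgt (r : ℝ) (i : ℚ) : 1 ≤ wgt r i := le_max_left _ _

theorem wgt_pos (r : ℝ) (i : ℚ) : 0 < wgt r i := zero_lt_one.trans_le (one_le_wgt r i)

theorem wgt_add_le (r : ℝ) (i j : ℚ) : wgt r (i + j) ≤ wgt r i * wgt r j := by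
  refine max_le (one_le_mul_of_one_le_of_one_le (one_le_wgt r i) (one_le_wgt r j)) ?_
  have : Real.exp (-(r * ((i + j : ℚ) : ℝ))) =
      Real.exp (-(r * (i : ℝ))) * Real.exp (-(r * (j : ℝ))) := by
    rw [← Real.exp_add]; congr 1; push_cast; ring
  rw [this]
  exact mul_le_mul (le_max_right _ _) (le_max_right _ _) (Real.exp_pos _).le (wgt_pos r i).le

theorem wgt_antitone {r : ℝ} (hr : 0 ≤ r) {i j : ℚ} (h : i ≤ j) : wgt r j ≤ wgt r i := by
  refine max_le_max le_rfl (Real.exp_le_exp.2 (neg_le_neg (mul_le_mul_of_nonneg_left ?_ hr)))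
  exact_mod_cast h

theorem wgt_of_nonneg {r : ℝ} (hr : 0 ≤ r) {i : ℚ} (h : 0 ≤ i) : wgt r i = 1 := by
  refine max_eq_left (Real.exp_le_one_iff.2 (neg_nonpos.2 (mul_nonneg hr ?_)))
  exact_mod_cast h

/-- Halving the radius turns boundedness into decay at -∞; at +∞ bounded coefficients suffice for
every s > 0. -/
theorem isExtRobbaOn_of_bound {r : ℝ} (hr : 0 < r) {f : ℚ → K} {C : ℝ}
    (wf : ∀ c : ℝ, 0 < c → {i : ℚ | c ≤ ‖f i‖}.IsWF) (hC : ∀ i, ‖f i‖ * wgt r i ≤ C) :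
    IsExtRobbaOn (r / 2) f := by
  have hC0 : 0 ≤ C := (mul_nonneg (norm_nonneg _) (wgt_pos r 0).le).trans (hC 0)
  have hC1 : ∀ i, ‖f i‖ ≤ C := fun i =>
    (le_mul_of_one_le_right (norm_nonneg _) (one_le_wgt r i)).trans (hC i)
  have hC2 : ∀ i, wt r f i ≤ C := fun i =>
    (mul_le_mul_of_nonneg_left (le_max_right _ _) (norm_nonneg _)).trans (hC i)
  have hbot : ∀ i, wt (r / 2) f i ≤ C * Real.exp (r / 2 * (i : ℝ)) := fun i => by
    rw [wt_change (r / 2) r, show r - r / 2 = r / 2 by ring]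
    exact mul_le_mul_of_nonneg_right (hC2 i) (Real.exp_pos _).le
  have htop : ∀ s i, wt s f i ≤ C * Real.exp (-(s * (i : ℝ))) := fun s i =>
    mul_le_mul_of_nonneg_right (hC1 i) (Real.exp_pos _).le
  refine ⟨wf, ⟨C, ?_⟩, ?_, fun s hs => ?_⟩
  · rintro _ ⟨i, rfl⟩
    rcases le_total i 0 with hi | hi
    · refine (hbot i).trans (mul_le_of_le_one_right hC0 (Real.exp_le_one_iff.2 ?_))
      exact mul_nonpos_of_nonneg_of_nonpos (by positivity) (by exact_mod_cast hi)
    · refine (htop _ i).trans (mul_le_of_le_one_right hC0 (Real.exp_le_one_iff.2 ?_))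
      exact neg_nonpos.2 (mul_nonneg (by positivity) (by exact_mod_cast hi))
  · refine squeeze_zero (wt_nonneg _ _) hbot ?_
    have h1 : Tendsto (fun i : ℚ => r / 2 * (i : ℝ)) atBot atBot :=
      (tendsto_ratCast_atBot_iff.2 tendsto_id).const_mul_atBot (by positivity)
    simpa using (Real.tendsto_exp_atBot.comp h1).const_mul C
  · refine squeeze_zero (wt_nonneg _ _) (htop s) ?_
    have h1 : Tendsto (fun i : ℚ => -(s * (i : ℝ))) atTop atBot :=
      tendsto_neg_atTop_atBot.comp
        ((tendsto_ratCast_atTop_iff.2 tendsto_id).const_mul_atTop hs)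
    simpa using (Real.tendsto_exp_atBot.comp h1).const_mul C

end Bound

/-! ### Solving g - φ(g) = f coefficientwise -/

section SolveAdditive

variable {K : Type u} [NontriviallyNormedField K] [IsUltrametricDist K] [CompleteSpace K]

/-- Halving c creates the strict inequality needed for a contradiction; a non-summable family causes
no trouble, its sum being 0 by convention. -/
theorem exists_half_le_of_le_norm_tsum {K : Type u} [NontriviallyNormedField K]
    [IsUltrametricDist K] {ι : Type*} {a : ι → K} {c : ℝ} (hc : 0 < c)
    (h : c ≤ ‖∑' n, a n‖) : ∃ n, c / 2 ≤ ‖a n‖ := by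
  by_contra hcon
  push Not at hcon
  have := norm_tsum_le_of_forall (by positivity : 0 ≤ c / 2) fun n => (hcon n).le
  linarith

theorem summable_of_strictAnti {f : ℚ → K} (wf : ∀ c : ℝ, 0 < c → {i : ℚ | c ≤ ‖f i‖}.IsWF)
    {t : ℕ → ℚ} (ht : StrictAnti t) {a : ℕ → K} (ha : ∀ n, ‖a n‖ = ‖f (t n)‖) : Summable a := by
  refine NonarchimedeanAddGroup.summable_of_tendsto_cofinite_zero
    (tendsto_cofinite_of_finite fun δ hδ => ?_)
  simp only [ha]
  exact finite_setOf_mem_of_strictAnti (wf δ hδ) ht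

/-- The operator decouples along orbits of multiplication by q. At 0 it is the equation over K.
Elsewhere one sums over the orbit in the direction of decreasing exponents, where well-ordering
makes the coefficients of f tend to 0. -/
theorem exists_sub_frob_eq {φ : K →+* K} (hφ : ∀ x, ‖φ x‖ = ‖x‖) (hbij : Function.Bijective φ)
    {q : ℕ} (hq : 1 < q) (hsolve : ∀ b, ∃ x, ‖x‖ ≤ ‖b‖ ∧ x - φ x = b) {r : ℝ} (hr : 0 < r)
    {C : ℝ} {f : ℚ → K} (wf : ∀ c : ℝ, 0 < c → {i : ℚ | c ≤ ‖f i‖}.IsWF)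
    (hC : ∀ i, ‖f i‖ * wgt r i ≤ C) :
    ∃ g : ℚ → K, (∀ c : ℝ, 0 < c → {i : ℚ | c ≤ ‖g i‖}.IsWF) ∧
      (∀ i, ‖g i‖ * wgt r i ≤ C) ∧ ∀ i, g i - φ (g (i / q)) = f i := by
  have hq1 : (1 : ℚ) < q := by exact_mod_cast hq
  have hq0 : (0 : ℚ) < q := zero_lt_one.trans hq1
  have hC0 : 0 ≤ C := (mul_nonneg (norm_nonneg _) (wgt_pos r 0).le).trans (hC 0)
  have hcont : Continuous φ := (AddMonoidHomClass.isometry_of_norm φ hφ).continuous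
  let e : K →+* K := (RingEquiv.ofBijective φ hbij).symm
  have hφe : ∀ x, φ (e x) = x := (RingEquiv.ofBijective φ hbij).apply_symm_apply
  have he : ∀ x, ‖e x‖ = ‖x‖ := fun x => by rw [← hφ, hφe]
  have hφn : ∀ n x, ‖φ^[n] x‖ = ‖x‖ := fun n x => by
    induction n with
    | zero => rfl
    | succ n ih => rw [Function.iterate_succ_apply', hφ, ih]
  have hen : ∀ n x, ‖e^[n] x‖ = ‖x‖ := fun n x => by
    induction n with
    | zero => rfl
    | succ n ih => rw [Function.iterate_succ_apply', he, ih]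
  obtain ⟨x₀, hx₀, hx₀'⟩ := hsolve (f 0)
  -- For i > 0 this is the sum of φ^n f over n ≥ 0, evaluated at i. For i < 0 it is minus the sum of
  -- φ^{-n} f over n ≥ 1, whence the shift n + 1 in `gn`.
  let gp : ℚ → K := fun i => ∑' n : ℕ, φ^[n] (f (i / q ^ n))
  let gn : ℚ → K := fun i => ∑' n : ℕ, e^[n + 1] (f (i * q ^ (n + 1)))
  let g : ℚ → K := fun i => if 0 < i then gp i else if i < 0 then -gn i else x₀
  have hgp : ∀ i, 0 < i → g i = gp i := fun i hi => if_pos hi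
  have hgn : ∀ i, i < 0 → g i = -gn i := fun i hi => by
    simp only [g, if_neg hi.not_gt, if_pos hi]
  have hg0 : g 0 = x₀ := by simp [g]
  refine ⟨g, fun c hc => ?_, fun i => ?_, fun i => ?_⟩
  · have h1 := isWF_setOf_exists_div_mem (wf (c / 2) (by positivity)) hq
    have h2 := isWF_setOf_exists_mul_mem (wf (c / 2) (by positivity)) hq
    have h3 : ({0} : Set ℚ).IsWF := (Set.isPWO_singleton 0).isWF
    refine ((h1.union h2).union h3).mono fun i hi => ?_
    have hi' : c ≤ ‖g i‖ := hi
    rcases lt_trichotomy i 0 with h | rfl | h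
    · rw [hgn i h, norm_neg] at hi'
      obtain ⟨n, hn⟩ := exists_half_le_of_le_norm_tsum hc hi'
      rw [hen] at hn
      exact Or.inl (Or.inr ⟨h, n + 1, hn⟩)
    · exact Or.inr rfl
    · rw [hgp i h] at hi'
      obtain ⟨n, hn⟩ := exists_half_le_of_le_norm_tsum hc hi'
      rw [hφn] at hn
      exact Or.inl (Or.inl ⟨h, n, hn⟩)
  -- The constant C is preserved: for i > 0 the weight takes its minimum 1, and for i < 0 only
  -- exponents ≤ i occur, where the weight is no smaller.
  · rw [← le_div_iff₀ (wgt_pos r i)]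
    have hCi : ∀ j, wgt r i ≤ wgt r j → ‖f j‖ ≤ C / wgt r i := fun j hj => by
      rw [le_div_iff₀ (wgt_pos r i)]
      exact (mul_le_mul_of_nonneg_left hj (norm_nonneg _)).trans (hC j)
    rcases lt_trichotomy i 0 with h | rfl | h
    · rw [hgn i h, norm_neg]
      refine norm_tsum_le_of_forall (div_nonneg hC0 (wgt_pos r i).le) fun n => ?_
      rw [hen]
      refine hCi _ (wgt_antitone hr.le ?_)
      exact mul_le_of_one_le_right h.le (one_le_pow₀ hq1.le)
    · rw [hg0]
      exact hx₀.trans (hCi _ le_rfl)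
    · rw [hgp i h]
      refine norm_tsum_le_of_forall (div_nonneg hC0 (wgt_pos r i).le) fun n => ?_
      rw [hφn]
      refine hCi _ ?_
      rw [wgt_of_nonneg hr.le h.le]
      exact one_le_wgt _ _
  · rcases lt_trichotomy i 0 with h | rfl | h
    · have hiq : i / q < 0 := div_neg_of_neg_of_pos h hq0
      rw [hgn i h, hgn _ hiq, map_neg]
      have hs : ∀ j < 0, Summable fun n : ℕ => e^[n + 1] (f (j * q ^ (n + 1))) := fun j hj =>
        summable_of_strictAnti wf (t := fun n : ℕ => j * q ^ (n + 1))
          (fun a b hab => mul_lt_mul_of_neg_left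
            (pow_lt_pow_right₀ hq1 (Nat.succ_lt_succ hab)) hj) fun n => hen _ _
      have h1 : φ (gn (i / q)) = f i + gn i := by
        change φ (∑' n : ℕ, e^[n + 1] (f (i / q * q ^ (n + 1)))) = _
        have h2 : Summable fun n : ℕ => φ (e^[n + 1] (f (i / q * q ^ (n + 1)))) :=
          (hs _ hiq).map φ hcont
        rw [(hs _ hiq).map_tsum φ hcont, h2.tsum_eq_zero_add]
        congr 1
        · simp [hφe, div_mul_cancel₀ _ hq0.ne']
        · refine tsum_congr fun n => ?_
          rw [Function.iterate_succ_apply', hφe]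
          congr 2
          field_simp
          ring
      rw [h1]
      ring
    · rw [zero_div, hg0, hx₀']
    · have hiq : 0 < i / q := div_pos h hq0
      rw [hgp i h, hgp _ hiq]
      have hs : ∀ j : ℚ, 0 < j → Summable fun n : ℕ => φ^[n] (f (j / q ^ n)) := fun j hj =>
        summable_of_strictAnti wf (t := fun n : ℕ => j / q ^ n)
          (fun a b hab => div_lt_div_of_pos_left hj (by positivity)
            (pow_lt_pow_right₀ hq1 hab)) fun n => hφn _ _
      have h1 : gp i = f i + φ (gp (i / q)) := by
        change ∑' n : ℕ, φ^[n] (f (i / q ^ n)) = f i + φ (∑' n : ℕ, φ^[n] (f (i / q / q ^ n)))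
        rw [(hs _ hiq).map_tsum φ hcont, (hs _ h).tsum_eq_zero_add]
        congr 1
        · simp
        · refine tsum_congr fun n => ?_
          rw [Function.iterate_succ_apply', div_div, ← pow_succ']
      rw [h1]
      ring

end SolveAdditive

end Slopes

namespace Slopes

open Filter Topology

/-! ### A Banach ring inside the extended Robba ring -/

section Banach

variable {K : Type u} [NontriviallyNormedField K] [IsUltrametricDist K]

theorem conv_bound {r C D : ℝ} {f g : ℚ → K} (hf : ∀ i, ‖f i‖ * wgt r i ≤ C)
    (hg : ∀ i, ‖g i‖ * wgt r i ≤ D) (k : ℚ) : ‖conv f g k‖ * wgt r k ≤ C * D := by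
  have hC0 : 0 ≤ C := (mul_nonneg (norm_nonneg _) (wgt_pos r 0).le).trans (hf 0)
  have hD0 : 0 ≤ D := (mul_nonneg (norm_nonneg _) (wgt_pos r 0).le).trans (hg 0)
  rw [← le_div_iff₀ (wgt_pos r k)]
  refine norm_tsum_le_of_forall (div_nonneg (mul_nonneg hC0 hD0) (wgt_pos r k).le) fun i => ?_
  rw [le_div_iff₀ (wgt_pos r k), norm_mul]
  have h1 := wgt_add_le r i (k - i)
  rw [add_sub_cancel] at h1
  calc ‖f i‖ * ‖g (k - i)‖ * wgt r k
      ≤ ‖f i‖ * ‖g (k - i)‖ * (wgt r i * wgt r (k - i)) :=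
        mul_le_mul_of_nonneg_left h1 (by positivity)
    _ = (‖f i‖ * wgt r i) * (‖g (k - i)‖ * wgt r (k - i)) := by ring
    _ ≤ C * D := mul_le_mul (hf i) (hg _) (mul_nonneg (norm_nonneg _) (wgt_pos r _).le) hC0

theorem add_bound {r C D : ℝ} {f g : ℚ → K} (hf : ∀ i, ‖f i‖ * wgt r i ≤ C)
    (hg : ∀ i, ‖g i‖ * wgt r i ≤ D) (k : ℚ) : ‖(f + g) k‖ * wgt r k ≤ max C D := by
  have h1 := mul_le_mul_of_nonneg_right (IsUltrametricDist.norm_add_le_max (f k) (g k))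
    (wgt_pos r k).le
  rw [max_mul_of_nonneg _ _ (wgt_pos r k).le] at h1
  exact h1.trans (max_le_max (hf k) (hg k))

variable [CompleteSpace K]

variable (K) in
/-- The ring of extended Robba series that are bounded for the weight `max(1, e^{-r i})`. -/
def banSubring (r : ℝ) : Subring (ExtRobba K) where
  carrier := {f | ∃ C, ∀ i, ‖f.coeff i‖ * wgt r i ≤ C}
  zero_mem' := ⟨0, fun i => by simp [ExtRobba.coeff_zero]⟩
  one_mem' := ⟨wgt r 0, fun i => by
    rw [ExtRobba.coeff_one]
    by_cases hi : i = 0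
    · subst hi; simp
    · simp [Pi.single_eq_of_ne hi, (wgt_pos r 0).le]⟩
  add_mem' := fun {f g} ⟨C, hC⟩ ⟨D, hD⟩ => ⟨max C D, add_bound hC hD⟩
  neg_mem' := fun {f} ⟨C, hC⟩ => ⟨C, fun i => by
    rw [ExtRobba.coeff_neg, Pi.neg_apply, norm_neg]; exact hC i⟩
  mul_mem' := fun {f g} ⟨C, hC⟩ ⟨D, hD⟩ => ⟨C * D, conv_bound hC hD⟩

variable {r : ℝ}

theorem bddAbove_ban (f : banSubring K r) :
    BddAbove (Set.range fun i => ‖f.1.coeff i‖ * wgt r i) := by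
  obtain ⟨C, hC⟩ := f.2
  exact ⟨C, by rintro _ ⟨i, rfl⟩; exact hC i⟩

/-- The weighted sup norm. -/
noncomputable def banNorm (f : banSubring K r) : ℝ := ⨆ i, ‖f.1.coeff i‖ * wgt r i

theorem le_banNorm (f : banSubring K r) (i : ℚ) : ‖f.1.coeff i‖ * wgt r i ≤ banNorm f :=
  le_ciSup (bddAbove_ban f) i

theorem banNorm_le {f : banSubring K r} {C : ℝ} (h : ∀ i, ‖f.1.coeff i‖ * wgt r i ≤ C) :
    banNorm f ≤ C := ciSup_le h

theorem banNorm_nonneg (f : banSubring K r) : 0 ≤ banNorm f :=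
  (mul_nonneg (norm_nonneg _) (wgt_pos r 0).le).trans (le_banNorm f 0)

theorem banNorm_add_le_max (f g : banSubring K r) :
    banNorm (f + g) ≤ max (banNorm f) (banNorm g) :=
  banNorm_le fun i => add_bound (le_banNorm f) (le_banNorm g) i

noncomputable instance : NormedCommRing (banSubring K r) :=
  { RingNorm.toNormedRing
      ({ toFun := banNorm
         map_zero' := le_antisymm (banNorm_le fun i => by simp [ExtRobba.coeff_zero])
           (banNorm_nonneg 0)
         add_le' := fun f g => (banNorm_add_le_max f g).trans
           (max_le_add_of_nonneg (banNorm_nonneg f) (banNorm_nonneg g))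
         neg' := fun f => by simp [banNorm, ExtRobba.coeff_neg]
         mul_le' := fun f g => banNorm_le (conv_bound (le_banNorm f) (le_banNorm g))
         eq_zero_of_map_eq_zero' := fun f hf => by
           refine Subtype.ext (ExtRobba.ext (funext fun i => ?_))
           have h1 := le_banNorm f i
           rw [hf] at h1
           have h2 : ‖f.1.coeff i‖ ≤ 0 := le_of_mul_le_mul_right (by simpa using h1) (wgt_pos r i)
           exact norm_le_zero_iff.1 h2 } : RingNorm (banSubring K r)) with
    mul_comm := mul_comm }

theorem norm_coeff_mul_le (f : banSubring K r) (i : ℚ) : ‖f.1.coeff i‖ * wgt r i ≤ ‖f‖ :=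
  le_banNorm f i

theorem norm_coeff_le (f : banSubring K r) (i : ℚ) : ‖f.1.coeff i‖ ≤ ‖f‖ :=
  (le_mul_of_one_le_right (norm_nonneg _) (one_le_wgt r i)).trans (norm_coeff_mul_le f i)

theorem norm_le_of_bound {f : banSubring K r} {C : ℝ} (h : ∀ i, ‖f.1.coeff i‖ * wgt r i ≤ C) :
    ‖f‖ ≤ C := banNorm_le h

instance : IsUltrametricDist (banSubring K r) :=
  IsUltrametricDist.isUltrametricDist_of_forall_norm_add_le_max_norm banNorm_add_le_max

/-- The `i`-th coefficient as a continuous additive map. -/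
noncomputable def coeffHom (i : ℚ) : banSubring K r →+ K where
  toFun f := f.1.coeff i
  map_zero' := rfl
  map_add' _ _ := rfl

theorem continuous_coeffHom (i : ℚ) : Continuous (coeffHom i : banSubring K r →+ K) :=
  AddMonoidHomClass.continuous_of_bound _ 1 fun f => by
    rw [one_mul]; exact norm_coeff_le f i

/-- The limit is taken coefficientwise, the convergence being uniform for the weight. The weight
bound persists in the limit and gives the series conditions at radius r/2. -/
instance [Fact (0 < r)] : CompleteSpace (banSubring K r) := by
  refine Metric.complete_of_cauchySeq_tendsto fun u hu => ?_
  have hcoef : ∀ i, CauchySeq fun n => (u n).1.coeff i := fun i => by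
    have := hu.map
      (uniformContinuous_addMonoidHom_of_continuous (continuous_coeffHom (K := K) (r := r) i))
    exact this
  choose a ha using fun i => cauchySeq_tendsto_of_complete (hcoef i)
  have key : ∀ ε > 0, ∃ N, ∀ m ≥ N, ∀ i, ‖(u m).1.coeff i - a i‖ * wgt r i ≤ ε := by
    intro ε hε
    obtain ⟨N, hN⟩ := Metric.cauchySeq_iff.1 hu ε hε
    refine ⟨N, fun m hm i => ?_⟩
    have h1 : Tendsto (fun n => ‖(u m).1.coeff i - (u n).1.coeff i‖ * wgt r i) atTop
        (𝓝 (‖(u m).1.coeff i - a i‖ * wgt r i)) :=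
      ((tendsto_const_nhds.sub (ha i)).norm).mul_const _
    refine le_of_tendsto h1 ?_
    filter_upwards [eventually_ge_atTop N] with n hn
    have h2 := hN m hm n hn
    rw [dist_eq_norm] at h2
    have h3 := norm_coeff_mul_le (u m - u n) i
    have h4 : (u m - u n).1.coeff i = (u m).1.coeff i - (u n).1.coeff i :=
      map_sub (coeffHom i) (u m) (u n)
    rw [h4] at h3
    exact h3.trans h2.le
  have key' : ∀ ε > 0, ∃ N, ∀ m ≥ N, ∀ i, ‖(u m).1.coeff i - a i‖ ≤ ε := fun ε hε => by
    obtain ⟨N, hN⟩ := key ε hε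
    exact ⟨N, fun m hm i => (le_mul_of_one_le_right (norm_nonneg _) (one_le_wgt r i)).trans
      (hN m hm i)⟩
  -- Coefficients of the limit of norm at least c are coefficients of norm at least c/2 of one close
  -- approximant.
  have hwf : ∀ c : ℝ, 0 < c → {i : ℚ | c ≤ ‖a i‖}.IsWF := by
    intro c hc
    obtain ⟨N, hN⟩ := key' (c / 2) (by positivity)
    obtain ⟨r', hr', h⟩ := (u N).1.2
    refine (h.wf (c / 2) (by positivity)).mono fun i hi => ?_
    have h1 : c ≤ ‖a i‖ := hi
    have h2 := hN N le_rfl i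
    have h3 := norm_sub_norm_le (a i) ((u N).1.coeff i)
    rw [norm_sub_rev] at h3
    change c / 2 ≤ ‖(u N).1.coeff i‖
    linarith
  have hbound : ∃ C, ∀ i, ‖a i‖ * wgt r i ≤ C := by
    obtain ⟨N, hN⟩ := key 1 one_pos
    refine ⟨1 + ‖u N‖, fun i => ?_⟩
    have h1 := hN N le_rfl i
    have h2 := norm_coeff_mul_le (u N) i
    have h3 := norm_sub_norm_le (a i) ((u N).1.coeff i)
    rw [norm_sub_rev] at h3
    have h4 := mul_le_mul_of_nonneg_right h3 (wgt_pos r i).le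
    rw [sub_mul] at h4
    linarith
  have hr : 0 < r := Fact.out
  obtain ⟨C, hC⟩ := hbound
  let A : ExtRobba K := ⟨a, r / 2, by positivity, isExtRobbaOn_of_bound hr hwf hC⟩
  refine ⟨⟨A, C, hC⟩, ?_⟩
  rw [Metric.tendsto_atTop]
  intro ε hε
  obtain ⟨N, hN⟩ := key (ε / 2) (by positivity)
  refine ⟨N, fun n hn => ?_⟩
  rw [dist_eq_norm]
  refine (norm_le_of_bound (C := ε / 2) fun i => ?_).trans_lt (by linarith)
  exact hN n hn i

/-- The equation is stated in the whole ring because Frobenius need not preserve the weighted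
subring. For this g the series φ(g) = g - f does lie in it. -/
theorem exists_sub_frob_eq_ban {φ : K →+* K} (hφ : ∀ x, ‖φ x‖ = ‖x‖)
    (hbij : Function.Bijective φ) {q : ℕ} (hq : 1 < q)
    (hsolve : ∀ b, ∃ x, ‖x‖ ≤ ‖b‖ ∧ x - φ x = b) (hr : 0 < r) (f : banSubring K r) :
    ∃ g : banSubring K r, ‖g‖ ≤ ‖f‖ ∧ g.1 - ExtRobba.frob φ hφ q hq g.1 = f.1 := by
  obtain ⟨r', hr', h⟩ := f.1.2
  obtain ⟨g, hwf, hg, hgf⟩ := exists_sub_frob_eq hφ hbij hq hsolve hr h.wf (norm_coeff_mul_le f)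
  let G : ExtRobba K := ⟨g, r / 2, by positivity, isExtRobbaOn_of_bound hr hwf hg⟩
  refine ⟨⟨G, ‖f‖, hg⟩, norm_le_of_bound hg, ExtRobba.ext ?_⟩
  rw [sub_eq_add_neg, ExtRobba.coeff_add, ExtRobba.coeff_neg]
  funext i
  exact (sub_eq_add_neg _ _).symm.trans (hgf i)

end Banach

end Slopes

namespace Slopes

open Filter Topology

/-! ### Frobenius on Hahn series -/

section HahnFrobenius

variable {k : Type u} [Field k]

/-- The endomorphism `∑ a_i u^i ↦ ∑ σ(a_i) u^{q i}` of the field of Hahn series. -/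
noncomputable def hahnFrob (σ : k →+* k) (q : ℕ) (hq : 1 < q) :
    HahnSeries ℚ k →+* HahnSeries ℚ k :=
  have hq0 : (0 : ℚ) < q := by exact_mod_cast zero_lt_one.trans hq
  (HahnSeries.embDomainRingHom (AddMonoidHom.mulLeft (q : ℚ))
    (mul_right_injective₀ hq0.ne') fun _ _ => mul_le_mul_iff_of_pos_left hq0).comp
  { toFun := fun x => x.map σ
    map_one' := HahnSeries.map_one σ.toMonoidWithZeroHom
    map_mul' := fun _ _ => HahnSeries.map_mul (σ : k →ₙ+* k)
    map_zero' := HahnSeries.map_zero (σ : ZeroHom k k)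
    map_add' := fun _ _ => HahnSeries.map_add (σ : k →+ k) }

theorem coeff_hahnFrob (σ : k →+* k) (q : ℕ) (hq : 1 < q) (x : HahnSeries ℚ k) (i : ℚ) :
    (hahnFrob σ q hq x).coeff i = σ (x.coeff (i / q)) := by
  have hq0 : (q : ℚ) ≠ 0 := by exact_mod_cast (zero_lt_one.trans hq).ne'
  have h := HahnSeries.embDomain_coeff (x := x.map σ) (a := i / q)
    (f := ⟨⟨fun j : ℚ => (q : ℚ) * j, mul_right_injective₀ hq0⟩,
      fun {_ _} => mul_le_mul_iff_of_pos_left (by positivity)⟩)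
  change HahnSeries.coeff _ ((q : ℚ) * (i / q)) = _ at h
  rw [mul_div_cancel₀ _ hq0] at h
  exact h

theorem hahnFrob_bijective {σ : k →+* k} (hσ : Function.Bijective σ) (q : ℕ) (hq : 1 < q) :
    Function.Bijective (hahnFrob σ q hq) := by
  have hq0 : (0 : ℚ) < q := by exact_mod_cast zero_lt_one.trans hq
  refine ⟨(hahnFrob σ q hq).injective, fun y => ?_⟩
  let e := RingEquiv.ofBijective σ hσ
  refine ⟨⟨fun i => e.symm (y.coeff (i * q)), ?_⟩, HahnSeries.ext (funext fun i => ?_)⟩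
  · have h1 : (Function.support fun i : ℚ => e.symm (y.coeff (i * q))) ⊆
        (fun j : ℚ => j / q) '' y.support := by
      intro i hi
      refine ⟨i * q, fun h0 => hi ?_, by field_simp⟩
      change e.symm (y.coeff (i * q)) = 0
      rw [h0, map_zero]
    exact (y.isPWO_support.image_of_monotone fun a b hab =>
      div_le_div_of_nonneg_right hab hq0.le).mono h1
  · rw [coeff_hahnFrob]
    change e (e.symm (y.coeff (i / q * q))) = _
    rw [e.apply_symm_apply, div_mul_cancel₀ _ hq0.ne']

end HahnFrobenius

/-! ### Comparison of the weighted and Gauss norms for small radius -/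

section Shrink

variable {K : Type u} [NontriviallyNormedField K] [IsUltrametricDist K]

/-- For exponents ≤ -N the growth bound at a fixed radius r₁ dominates, once N is large. For
exponents ≥ -N the weight is at most e^{rN}, which tends to 1 as r → 0. -/
theorem ExtRobba.eventually_bound (f : ExtRobba K) {c C : ℝ} (hc : ∀ i, ‖f.coeff i‖ ≤ c)
    (hcC : c < C) : ∀ᶠ r in 𝓝[>] (0 : ℝ), ∀ i, ‖f.coeff i‖ * wgt r i ≤ C := by
  obtain ⟨r₁, hr₁, hf⟩ := f.2
  obtain ⟨A, hA⟩ := hf.bdd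
  have hA' : ∀ i, wt r₁ f.coeff i ≤ A := fun i => hA ⟨i, rfl⟩
  have hA0 : 0 ≤ A := (wt_nonneg _ _ 0).trans (hA' 0)
  have hc0 : 0 ≤ c := (norm_nonneg _).trans (hc 0)
  have hC0 : 0 < C := hc0.trans_lt hcC
  obtain ⟨N, hN⟩ : ∃ N : ℕ, A * Real.exp (-(r₁ / 2 * N)) ≤ C := by
    have h1 : Tendsto (fun N : ℕ => -(r₁ / 2 * (N : ℝ))) atTop atBot :=
      tendsto_neg_atTop_atBot.comp (tendsto_natCast_atTop_atTop.const_mul_atTop (by positivity))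
    have h2 : Tendsto (fun N : ℕ => A * Real.exp (-(r₁ / 2 * (N : ℝ)))) atTop (𝓝 0) := by
      simpa using (Real.tendsto_exp_atBot.comp h1).const_mul A
    exact (h2.eventually_le_const hC0).exists
  have h1 : ∀ᶠ r in 𝓝[>] (0 : ℝ), c * Real.exp (r * N) ≤ C := by
    have h2 : Tendsto (fun r : ℝ => c * Real.exp (r * N)) (𝓝 0) (𝓝 c) := by
      have : Continuous fun r : ℝ => c * Real.exp (r * N) := by fun_prop
      simpa using this.tendsto 0
    exact (h2.mono_left nhdsWithin_le_nhds).eventually_le_const hcC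
  have h2 : ∀ᶠ r in 𝓝[>] (0 : ℝ), r ≤ r₁ / 2 :=
    (eventually_le_nhds (by positivity : (0 : ℝ) < r₁ / 2)).filter_mono nhdsWithin_le_nhds
  filter_upwards [h1, h2, self_mem_nhdsWithin] with r hr1 hr2 hr0 i
  have hr0' : 0 < r := hr0
  rw [wgt, mul_max_of_nonneg _ _ (norm_nonneg _), mul_one]
  refine max_le ((hc i).trans hcC.le) ?_
  rcases le_total (i : ℝ) (-N) with hi | hi
  · change wt r f.coeff i ≤ C
    rw [wt_change r r₁]
    refine le_trans (mul_le_mul (hA' i) (Real.exp_le_exp.2 ?_) (Real.exp_pos _).le hA0) hN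
    have hN0 : (0 : ℝ) ≤ N := N.cast_nonneg
    nlinarith
  · refine le_trans (mul_le_mul (hc i) (Real.exp_le_exp.2 ?_) (Real.exp_pos _).le hc0) hr1
    nlinarith

end Shrink

/-! ### Reduction of integral series to Hahn series -/

section Reduction

variable {K : Type u} [NontriviallyNormedField K] [IsUltrametricDist K] [CompleteSpace K]
  [(NormedField.valuation (K := K)).IsRankOneDiscrete]

/-- Discreteness bounds the Gauss norm of f - 1 by |ϖ| < 1, so its weighted norm is below 1 for
small r, and f is inverted in a complete ring. -/
theorem isUnit_int_of_norm_sub_one_lt (f : (ExtRobba.int : Subring (ExtRobba K)))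
    (hf : ∀ i, ‖(f.1 - 1).coeff i‖ < 1) : IsUnit f := by
  obtain ⟨ϖ, hϖ⟩ := exists_isUniformizer (K := K)
  have hw := norm_uniformizer_lt_one hϖ
  obtain ⟨C, hC, hC1⟩ := exists_between hw
  have hev := (f.1 - 1).eventually_bound (fun i => norm_le_of_lt_one hϖ (hf i)) hC
  obtain ⟨r, hr, hr0⟩ := (hev.and self_mem_nhdsWithin).exists
  have : Fact (0 < r) := ⟨hr0⟩
  let x : banSubring K r := ⟨f.1 - 1, C, hr⟩
  have hx : ‖x‖ < 1 := (norm_le_of_bound hr).trans_lt hC1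
  obtain ⟨y, hy⟩ := (isUnit_one_sub_of_norm_lt_one (x := -x) (by rwa [norm_neg])).exists_right_inv
  have hy' : y = 1 - x * y := by linear_combination hy
  have hone : ‖(1 : banSubring K r)‖ ≤ 1 := norm_le_of_bound fun i => by
    change ‖(1 : ExtRobba K).coeff i‖ * _ ≤ _
    rw [ExtRobba.coeff_one]
    by_cases hi : i = 0
    · subst hi
      simp [wgt_of_nonneg (le_of_lt (show 0 < r from hr0)) le_rfl]
    · simp [Pi.single_eq_of_ne hi]
  -- The identity y = 1 - x y with ‖x‖ < 1 shows that the inverse is again integral.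
  have hyn : ‖y‖ ≤ 1 := by
    by_contra hcon
    push Not at hcon
    have h1 : ‖y‖ ≤ max ‖(1 : banSubring K r)‖ ‖x * y‖ := by
      conv_lhs => rw [hy']
      rw [sub_eq_add_neg, ← norm_neg (x * y)]
      exact IsUltrametricDist.norm_add_le_max _ _
    have h2 : ‖x * y‖ < ‖y‖ := (norm_mul_le _ _).trans_lt
      (mul_lt_of_lt_one_left (zero_lt_one.trans hcon) hx)
    exact absurd h1 (not_le.2 (max_lt (hone.trans_lt hcon) h2))
  refine IsUnit.of_mul_eq_one ⟨y.1, fun i => (norm_coeff_le y i).trans hyn⟩ (Subtype.ext ?_)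
  have h1 := congrArg Subtype.val hy
  change (1 - -(f.1 - 1)) * y.1 = 1 at h1
  change f.1 * y.1 = 1
  rw [← h1]
  ring

/-- Reduction of integral extended Robba series to Hahn series over the residue field. -/
noncomputable def redSeries (f : ExtRobba K) (hf : ∀ i, ‖f.coeff i‖ ≤ 1) :
    HahnSeries ℚ (ResField K) where
  coeff i := red (f.coeff i)
  isPWO_support' := by
    obtain ⟨r, hr, h⟩ := f.2
    refine (Set.isPWO_iff_isWF.2 (h.wf 1 one_pos)).mono fun i hi => ?_
    by_contra hcon
    exact hi ((red_eq_zero_iff (hf i)).2 (not_le.1 hcon))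

/-- A term of the infinite Cauchy product survives reduction only if both factors have norm one.
Those are the finitely many terms of the Hahn series product. -/
theorem redSeries_mul (f g : ExtRobba K) (hf : ∀ i, ‖f.coeff i‖ ≤ 1) (hg : ∀ i, ‖g.coeff i‖ ≤ 1)
    (hfg : ∀ i, ‖(f * g).coeff i‖ ≤ 1) :
    redSeries (f * g) hfg = redSeries f hf * redSeries g hg := by
  classical
  obtain ⟨ϖ, hϖ⟩ := exists_isUniformizer (K := K)
  have hw := norm_uniformizer_lt_one hϖ
  refine HahnSeries.ext (funext fun k => ?_)
  rw [HahnSeries.coeff_mul]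
  set D := Finset.antidiagonal (redSeries f hf).isPWO_support (redSeries g hg).isPWO_support k
    with hD
  have hinj : Set.InjOn Prod.fst (D : Set (ℚ × ℚ)) := by
    rintro ⟨i, j⟩ hij ⟨i', j'⟩ hij' h
    have h1 := (Finset.mem_antidiagonal.1 (Finset.mem_coe.1 hij)).2.2
    have h2 := (Finset.mem_antidiagonal.1 (Finset.mem_coe.1 hij')).2.2
    simp only at h h1 h2
    subst h
    exact Prod.ext rfl (by linarith)
  have hterm : ∀ i j, ‖f.coeff i * g.coeff j‖ ≤ 1 := fun i j => by
    rw [norm_mul]; exact mul_le_one₀ (hf i) (norm_nonneg _) (hg _)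
  obtain ⟨r, hr, h⟩ := ExtRobba.exists_goodAt₂ f g
  have hs := summable_conv (h r hr le_rfl).1 (h r hr le_rfl).2 k
  have hsplit := hs.sum_add_tsum_compl (s := D.image Prod.fst)
  -- Each remaining term has norm < 1, hence ≤ |ϖ| by discreteness; this uniform bound passes to the
  -- infinite sum.
  have hrest : ‖∑' i : ↑((D.image Prod.fst : Finset ℚ) : Set ℚ)ᶜ,
      f.coeff i * g.coeff (k - i)‖ ≤ ‖ϖ‖ := by
    refine norm_tsum_le_of_forall (norm_nonneg _) fun ⟨i, hi⟩ => norm_le_of_lt_one hϖ ?_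
    refine lt_of_le_of_ne (hterm _ _) fun h1 => hi ?_
    rw [norm_mul] at h1
    have hfi : ‖f.coeff i‖ = 1 := by
      refine le_antisymm (hf i) ?_
      rw [← h1]
      exact mul_le_of_le_one_right (norm_nonneg _) (hg _)
    have hgi : ‖g.coeff (k - i)‖ = 1 := by rwa [hfi, one_mul] at h1
    rw [Finset.mem_coe, Finset.mem_image]
    refine ⟨(i, k - i), Finset.mem_antidiagonal.2 ⟨fun h0 => ?_, fun h0 => ?_, by ring⟩, rfl⟩
    · exact ((red_eq_zero_iff (hf i)).1 h0).ne hfi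
    · exact ((red_eq_zero_iff (hg _)).1 h0).ne hgi
  have hsum1 : ‖∑ i ∈ D.image Prod.fst, f.coeff i * g.coeff (k - i)‖ ≤ 1 :=
    IsUltrametricDist.norm_sum_le_of_forall_le_of_nonneg zero_le_one fun i _ => hterm _ _
  change red ((f * g).coeff k) = _
  have hk : (f * g).coeff k = ∑' i, f.coeff i * g.coeff (k - i) := rfl
  have hred : red ((f * g).coeff k) =
      red (∑ i ∈ D.image Prod.fst, f.coeff i * g.coeff (k - i)) := by
    rw [red_eq_red_iff (hfg k) hsum1, hk, ← hsplit, add_sub_cancel_left]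
    exact hrest.trans_lt hw
  rw [hred, red_sum _ _ fun i _ => hterm _ _, Finset.sum_image hinj]
  refine Finset.sum_congr rfl fun ij hij => ?_
  have h1 := (Finset.mem_antidiagonal.1 hij).2.2
  rw [← h1, add_sub_cancel_left, red_mul (hf _) (hg _)]
  rfl

/-- Reduction of integral extended Robba series as a ring homomorphism. -/
noncomputable def redHahn :
    (ExtRobba.int : Subring (ExtRobba K)) →+* HahnSeries ℚ (ResField K) where
  toFun f := redSeries f.1 f.2
  map_one' := HahnSeries.ext (funext fun i => by
    change red ((1 : ExtRobba K).coeff i) = _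
    rw [ExtRobba.coeff_one, HahnSeries.coeff_one]
    split_ifs with h
    · subst h; simp [red_one]
    · rw [Pi.single_eq_of_ne h, red_zero])
  map_mul' f g := redSeries_mul f.1 g.1 f.2 g.2 (f * g).2
  map_zero' := HahnSeries.ext (funext fun i => red_zero)
  map_add' f g := HahnSeries.ext (funext fun i => red_add (f.2 i) (g.2 i))

theorem coeff_redHahn (f : (ExtRobba.int : Subring (ExtRobba K))) (i : ℚ) :
    (redHahn f).coeff i = red (f.1.coeff i) := rfl

theorem redHahn_surjective : Function.Surjective (redHahn (K := K)) := by
  intro h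
  classical
  choose lift hlift hred using exists_red_eq (K := K)
  -- Lifting 0 to 0 keeps the support inside that of h, hence well-ordered and bounded below, which
  -- bounds the weight.
  let f : ℚ → K := fun i => if h.coeff i = 0 then 0 else lift (h.coeff i)
  have hf1 : ∀ i, ‖f i‖ ≤ 1 := fun i => by
    simp only [f]
    split_ifs
    · simp
    · exact hlift _
  have hf0 : ∀ i, f i ≠ 0 → i ∈ h.support := fun i hi h0 => hi (if_pos h0)
  have hwf : ∀ c : ℝ, 0 < c → {i : ℚ | c ≤ ‖f i‖}.IsWF := fun c hc =>
    h.isWF_support.mono fun i hi => hf0 i (norm_pos_iff.1 (lt_of_lt_of_le hc hi))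
  have hbound : ∃ C, ∀ i, ‖f i‖ * wgt 2 i ≤ C := by
    refine ⟨wgt 2 h.order, fun i => ?_⟩
    by_cases hi : f i = 0
    · rw [hi, norm_zero, zero_mul]; exact (wgt_pos _ _).le
    · refine (mul_le_of_le_one_left (wgt_pos _ _).le (hf1 i)).trans (wgt_antitone two_pos.le ?_)
      exact HahnSeries.order_le_of_coeff_ne_zero (hf0 i hi)
  obtain ⟨C, hC⟩ := hbound
  refine ⟨⟨⟨f, 2 / 2, by norm_num, isExtRobbaOn_of_bound two_pos hwf hC⟩, hf1⟩,
    HahnSeries.ext (funext fun i => ?_)⟩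
  change red (f i) = _
  simp only [f]
  split_ifs with hi
  · rw [hi, red_zero]
  · exact hred _

/-- Multiplying by a lift of the inverse reduction gives an element congruent to 1, which is a unit.
-/
theorem isUnit_int_of_redHahn_ne_zero {f : (ExtRobba.int : Subring (ExtRobba K))}
    (hf : redHahn f ≠ 0) : IsUnit f := by
  obtain ⟨g, hg⟩ := redHahn_surjective (redHahn f)⁻¹
  have h1 : redHahn (f * g) = 1 := by rw [map_mul, hg, mul_inv_cancel₀ hf]
  refine isUnit_of_mul_isUnit_left (isUnit_int_of_norm_sub_one_lt (f * g) fun i => ?_)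
  have h2 : redHahn (f * g - 1) = 0 := by rw [map_sub, h1, map_one, sub_self]
  exact (red_eq_zero_iff ((f * g - 1).2 i)).1 (congrArg (fun x => HahnSeries.coeff x i) h2)

theorem isUnit_matrix_of_isUnit_map_redHahn {n : ℕ}
    {A : Matrix (Fin n) (Fin n) (ExtRobba.int : Subring (ExtRobba K))}
    (hA : IsUnit (A.map redHahn)) : IsUnit A := by
  rw [Matrix.isUnit_iff_isUnit_det] at hA ⊢
  rw [← RingHom.mapMatrix_apply, ← RingHom.map_det] at hA
  exact isUnit_int_of_redHahn_ne_zero hA.ne_zero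

theorem redHahn_frob {φ : K →+* K} (hφ : ∀ x, ‖φ x‖ = ‖x‖) {q : ℕ} (hq : 1 < q)
    (f : (ExtRobba.int : Subring (ExtRobba K))) :
    redHahn ⟨ExtRobba.frob φ hφ q hq f.1, ExtRobba.frob_mem_int φ hφ q hq f.1 f.2⟩ =
      hahnFrob (redHom φ hφ) q hq (redHahn f) := by
  refine HahnSeries.ext (funext fun i => ?_)
  rw [coeff_redHahn, coeff_hahnFrob, coeff_redHahn, redHom_red φ hφ (f.2 _)]
  rfl

end Reduction

end Slopes

namespace Slopes

open Filter Topology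

/-! ### Homogeneous scalar equations over Hahn series -/

section HahnEquations

variable {k : Type u} [Field k]

theorem coeff_iterate_hahnFrob (σ : k →+* k) (q : ℕ) (hq : 1 < q) (n : ℕ) (x : HahnSeries ℚ k)
    (i : ℚ) : ((hahnFrob σ q hq)^[n] x).coeff i = σ^[n] (x.coeff (i / q ^ n)) := by
  induction n generalizing i with
  | zero => simp
  | succ n ih =>
    rw [Function.iterate_succ_apply', coeff_hahnFrob, ih, Function.iterate_succ_apply', div_div,
      ← pow_succ']

theorem coeff_C (z : k) (i : ℚ) :
    (HahnSeries.C z : HahnSeries ℚ k).coeff i = if i = 0 then z else 0 := by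
  rw [HahnSeries.C_apply, HahnSeries.coeff_single]
  congr

/-- Each coefficient is stable once g N exceeds its exponent. Up to any x the support is that of one
partial sum, so it is well-ordered. -/
theorem exists_hahn_sum {t : ℕ → HahnSeries ℚ k} {g : ℕ → ℚ} (hg : Monotone g)
    (hg' : ∀ x : ℚ, ∃ N, x < g N) (ht : ∀ n, (g n : WithTop ℚ) ≤ (t n).orderTop) :
    ∃ w : HahnSeries ℚ k, ∀ N, (g N : WithTop ℚ) ≤ (w - ∑ n ∈ Finset.range N, t n).orderTop := by
  choose N hN using hg'
  have hstab : ∀ i M M', i < g M → M ≤ M' → (∑ n ∈ Finset.range M', t n).coeff i =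
      (∑ n ∈ Finset.range M, t n).coeff i := by
    intro i M M' hi hM
    rw [HahnSeries.coeff_sum, HahnSeries.coeff_sum, ← Finset.sum_subset (Finset.range_mono hM)]
    intro n _ hn
    have h1 : M ≤ n := not_lt.1 fun h => hn (Finset.mem_range.2 h)
    exact HahnSeries.le_orderTop_iff_forall.1 (ht n) i
      (by exact_mod_cast hi.trans_le (hg h1))
  have hstab' : ∀ i M M', i < g M → i < g M' → (∑ n ∈ Finset.range M', t n).coeff i =
      (∑ n ∈ Finset.range M, t n).coeff i := by
    intro i M M' h h'
    rcases le_total M M' with hM | hM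
    · exact hstab i M M' h hM
    · exact (hstab i M' M h' hM).symm
  refine ⟨⟨fun i => (∑ n ∈ Finset.range (N i), t n).coeff i, ?_⟩, fun M => ?_⟩
  · refine (isWF_of_forall_inter_Iic fun x _ => ?_).isPWO
    refine (∑ n ∈ Finset.range (N x), t n).isWF_support.mono fun i hi => ?_
    have hix : i ≤ x := hi.2
    rw [HahnSeries.mem_support, hstab' i (N i) (N x) (hN i) (hix.trans_lt (hN x))]
    exact hi.1
  · rw [HahnSeries.le_orderTop_iff_forall]
    intro i hi
    rw [HahnSeries.coeff_sub, sub_eq_zero]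
    exact hstab' i M (N i) (by exact_mod_cast hi) (hN i)

/-- A solution of the equation on constant terms solves the original one up to an error with
positive exponents. On such series the operator multiplies orders by at least q, so the error is
removed by a geometric series. -/
theorem solvesHomogeneous_of_integral {σ : k →+* k} (hσ : SolvesHomogeneous σ) (q : ℕ)
    (hq : 1 < q) (m : ℕ) (d : ℕ → HahnSeries ℚ k) (hd : ∀ j < m, 0 ≤ (d j).orderTop)
    (hd' : ∃ j < m, (d j).coeff 0 ≠ 0) :
    ∃ y ≠ 0, y = ∑ j ∈ Finset.range m, d j * (hahnFrob σ q hq)^[j + 1] y := by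
  have hq1 : (1 : ℚ) < q := by exact_mod_cast hq
  have hq0 : (0 : ℚ) < q := zero_lt_one.trans hq1
  obtain ⟨z, hz0, hz⟩ := hσ m (fun j => (d j).coeff 0) hd'
  let L : HahnSeries ℚ k →+ HahnSeries ℚ k := ∑ j ∈ Finset.range m,
    (AddMonoidHom.mulLeft (d j)).comp (hahnFrob σ q hq ^ (j + 1) : _ →+* _).toAddMonoidHom
  have hL : ∀ x, L x = ∑ j ∈ Finset.range m, d j * (hahnFrob σ q hq)^[j + 1] x := fun x => by
    simp only [L, AddMonoidHom.finsetSum_apply]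
    refine Finset.sum_congr rfl fun j _ => ?_
    rw [← RingHom.coe_pow]
    rfl
  have hsum : ∀ (g : ℚ) (s : Finset ℕ) (f : ℕ → HahnSeries ℚ k),
      (∀ j ∈ s, (g : WithTop ℚ) ≤ (f j).orderTop) →
      (g : WithTop ℚ) ≤ (∑ j ∈ s, f j).orderTop := by
    intro g s f h
    rw [HahnSeries.le_orderTop_iff_forall]
    intro i hi
    rw [HahnSeries.coeff_sum]
    exact Finset.sum_eq_zero fun j hj => HahnSeries.le_orderTop_iff_forall.1 (h j hj) i hi
  have hadd : ∀ (g : ℚ) (x y : HahnSeries ℚ k), (g : WithTop ℚ) ≤ x.orderTop →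
      (g : WithTop ℚ) ≤ y.orderTop → (g : WithTop ℚ) ≤ (x - y).orderTop := by
    intro g x y hx hy
    rw [HahnSeries.le_orderTop_iff_forall] at *
    intro i hi
    rw [HahnSeries.coeff_sub, hx i hi, hy i hi, sub_zero]
  -- The contraction estimate: the coefficients d_j are integral, and φ^{j+1} multiplies exponents
  -- by q^{j+1} ≥ q.
  have hLord : ∀ (g : ℚ) (x : HahnSeries ℚ k), 0 ≤ g → (g : WithTop ℚ) ≤ x.orderTop →
      ((q * g : ℚ) : WithTop ℚ) ≤ (L x).orderTop := by
    intro g x hg hx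
    rw [hL]
    refine hsum _ _ _ fun j hj => ?_
    refine le_trans ?_ HahnSeries.orderTop_add_le_mul
    have h1 : ((q * g : ℚ) : WithTop ℚ) ≤ ((hahnFrob σ q hq)^[j + 1] x).orderTop := by
      rw [HahnSeries.le_orderTop_iff_forall] at hx ⊢
      intro i hi
      have hi' : i < q * g := by exact_mod_cast hi
      have h2 : i / (q : ℚ) ^ (j + 1) < g := by
        rw [div_lt_iff₀ (by positivity), mul_comm]
        refine hi'.trans_le (mul_le_mul_of_nonneg_right ?_ hg)
        exact le_self_pow₀ hq1.le (Nat.succ_ne_zero j)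
      rw [coeff_iterate_hahnFrob, hx _ (by exact_mod_cast h2), ← RingHom.coe_pow, map_zero]
    calc ((q * g : ℚ) : WithTop ℚ) = 0 + ((q * g : ℚ) : WithTop ℚ) := (zero_add _).symm
      _ ≤ _ := add_le_add (hd j (Finset.mem_range.1 hj)) h1
  let c : HahnSeries ℚ k := HahnSeries.C z
  have hc : ∀ i, c.coeff i = if i = 0 then z else 0 := coeff_C z
  let a := L c - c
  have ha : ∀ i ≤ 0, a.coeff i = 0 := by
    intro i hi
    have hcn : ∀ n, (hahnFrob σ q hq)^[n] c = HahnSeries.C (σ^[n] z) := by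
      intro n
      refine HahnSeries.ext (funext fun i => ?_)
      rw [coeff_iterate_hahnFrob, hc]
      rw [coeff_C]
      have h3 : i / (q : ℚ) ^ n = 0 ↔ i = 0 := by simp [hq0.ne']
      simp only [h3]
      split_ifs
      · rfl
      · rw [← RingHom.coe_pow, map_zero]
    have h1 : (L c).coeff i = ∑ j ∈ Finset.range m, (d j).coeff i * σ^[j + 1] z := by
      rw [hL, HahnSeries.coeff_sum]
      refine Finset.sum_congr rfl fun j _ => ?_
      rw [hcn]
      exact HahnSeries.coeff_mul_single_zero
    change (L c - c).coeff i = 0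
    rw [HahnSeries.coeff_sub, h1, hc]
    rcases hi.lt_or_eq with h | rfl
    · rw [if_neg h.ne, sub_zero]
      refine Finset.sum_eq_zero fun j hj => ?_
      have h2 := HahnSeries.le_orderTop_iff_forall.1 (hd j (Finset.mem_range.1 hj)) i
        (by exact_mod_cast h)
      rw [h2, zero_mul]
    · rw [if_pos rfl, sub_eq_zero]
      exact hz.symm
  obtain ⟨ε, hε, hεa⟩ : ∃ ε : ℚ, 0 < ε ∧ (ε : WithTop ℚ) ≤ a.orderTop := by
    by_cases h0 : a = 0
    · exact ⟨1, one_pos, by simp [h0]⟩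
    · refine ⟨a.order, ?_, (HahnSeries.order_eq_orderTop_of_ne_zero h0).le⟩
      by_contra hcon
      exact h0 (HahnSeries.coeff_order_eq_zero.1 (ha _ (not_lt.1 hcon)))
  have hiter : ∀ n, ((q ^ n * ε : ℚ) : WithTop ℚ) ≤ (L^[n] a).orderTop := by
    intro n
    induction n with
    | zero => simpa using hεa
    | succ n ih =>
      rw [Function.iterate_succ_apply', pow_succ', mul_assoc]
      exact hLord _ _ (by positivity) ih
  have hunb : ∀ x : ℚ, ∃ N : ℕ, x < (q : ℚ) ^ N * ε := fun x => by
    obtain ⟨N, hN⟩ := pow_unbounded_of_one_lt (x / ε) hq1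
    exact ⟨N, (div_lt_iff₀ hε).1 hN⟩
  obtain ⟨w, hw⟩ := exists_hahn_sum (fun a b hab => mul_le_mul_of_nonneg_right
    (pow_le_pow_right₀ hq1.le hab) hε.le) hunb hiter
  have hpart : ∀ N, ∑ n ∈ Finset.range N, L^[n] a - L (∑ n ∈ Finset.range N, L^[n] a) =
      a - L^[N] a := by
    intro N
    rw [map_sum, ← Finset.sum_sub_distrib]
    simp only [← Function.iterate_succ_apply' (f := ⇑L)]
    exact Finset.sum_range_sub' (fun n => L^[n] a) N
  have hweq : w - L w - a = 0 := by
    refine HahnSeries.ext (funext fun i => ?_)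
    obtain ⟨N, hN⟩ := hunb i
    have h1 : w - L w - a = (w - ∑ n ∈ Finset.range N, L^[n] a) -
        L (w - ∑ n ∈ Finset.range N, L^[n] a) - L^[N] a := by
      rw [map_sub]
      linear_combination hpart N
    have h2 : ((q ^ N * ε : ℚ) : WithTop ℚ) ≤ (w - L w - a).orderTop := by
      rw [h1]
      refine hadd _ _ _ (hadd _ _ _ (hw N) (le_trans ?_ (hLord _ _ (by positivity) (hw N))))
        (hiter N)
      have : (q : ℚ) ^ N * ε ≤ q * (q ^ N * ε) := le_mul_of_one_le_left (by positivity) hq1.le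
      exact_mod_cast this
    exact HahnSeries.le_orderTop_iff_forall.1 h2 i (by exact_mod_cast hN)
  -- Since w has order at least ε > 0, the coefficient of c + w at exponent 0 is z ≠ 0.
  refine ⟨c + w, fun h0 => hz0 ?_, ?_⟩
  · have h1 := HahnSeries.le_orderTop_iff_forall.1 (hw 0) 0 (by simpa using hε)
    have h2 := congrArg (fun x => HahnSeries.coeff x 0) h0
    simp only [HahnSeries.coeff_add, hc, if_true, HahnSeries.coeff_zero] at h2
    simp only [Finset.range_zero, Finset.sum_empty, sub_zero] at h1
    rwa [h1, add_zero] at h2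
  · rw [← hL, map_add]
    have haL : a = L c - c := rfl
    linear_combination hweq + haL

/-- Substituting u^b y for y multiplies d_j by u^{(q^{j+1}-1)b}. A suitable b makes all coefficients
integral and one of them of order exactly 0. -/
theorem solvesHomogeneous_hahnFrob {σ : k →+* k} (hσ : SolvesHomogeneous σ) (q : ℕ)
    (hq : 1 < q) : SolvesHomogeneous (hahnFrob σ q hq) := by
  classical
  have hq1 : (1 : ℚ) < q := by exact_mod_cast hq
  have hq0 : (0 : ℚ) < q := zero_lt_one.trans hq1
  intro m d hd
  let J := (Finset.range m).filter fun j => d j ≠ 0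
  have hJ : J.Nonempty := by
    obtain ⟨j, hj, hj0⟩ := hd
    exact ⟨j, Finset.mem_filter.2 ⟨Finset.mem_range.2 hj, hj0⟩⟩
  have hqj : ∀ j : ℕ, (0 : ℚ) < q ^ (j + 1) - 1 := fun j =>
    sub_pos.2 (one_lt_pow₀ hq1 (Nat.succ_ne_zero j))
  obtain ⟨j₀, hj₀, hmax⟩ := J.exists_max_image (fun j => -(d j).order / ((q : ℚ) ^ (j + 1) - 1)) hJ
  obtain ⟨hj₀m, hj₀0⟩ := Finset.mem_filter.1 hj₀
  -- Maximality of this slope gives order of d_j + (q^{j+1}-1) b ≥ 0 for all j, with equality at j₀.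
  set b : ℚ := -(d j₀).order / ((q : ℚ) ^ (j₀ + 1) - 1) with hb
  let d' : ℕ → HahnSeries ℚ k := fun j => d j * HahnSeries.single (((q : ℚ) ^ (j + 1) - 1) * b) 1
  have hcoef : ∀ j i, (d' j).coeff i = (d j).coeff (i - ((q : ℚ) ^ (j + 1) - 1) * b) := by
    intro j i
    simp only [d']
    rw [HahnSeries.coeff_mul_single, mul_one]
  obtain ⟨y, hy0, hy⟩ := solvesHomogeneous_of_integral hσ q hq m d' (fun j hj => by
      change ((0 : ℚ) : WithTop ℚ) ≤ _
      rw [HahnSeries.le_orderTop_iff_forall]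
      intro i hi
      have hi0 : i < 0 := by exact_mod_cast hi
      rw [hcoef]
      by_cases h0 : d j = 0
      · rw [h0, HahnSeries.coeff_zero]
      · refine HahnSeries.coeff_eq_zero_of_lt_order ?_
        have h1 := hmax j (Finset.mem_filter.2 ⟨Finset.mem_range.2 hj, h0⟩)
        rw [div_le_iff₀ (hqj j)] at h1
        linarith)
    ⟨j₀, Finset.mem_range.1 hj₀m, by
      rw [hcoef, hb, mul_div_cancel₀ _ (hqj j₀).ne', zero_sub, neg_neg]
      exact HahnSeries.coeff_order_eq_zero.not.2 hj₀0⟩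
  have hs0 : (HahnSeries.single b 1 : HahnSeries ℚ k) ≠ 0 := HahnSeries.single_ne_zero one_ne_zero
  refine ⟨HahnSeries.single b 1 * y, mul_ne_zero hs0 hy0, ?_⟩
  conv_lhs => rw [hy]
  rw [Finset.mul_sum]
  refine Finset.sum_congr rfl fun j _ => ?_
  have h1 : (hahnFrob σ q hq)^[j + 1] (HahnSeries.single b 1) =
      HahnSeries.single ((q : ℚ) ^ (j + 1) * b) 1 := by
    refine HahnSeries.ext (funext fun i => ?_)
    rw [coeff_iterate_hahnFrob, HahnSeries.coeff_single, HahnSeries.coeff_single]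
    have h2 : i / (q : ℚ) ^ (j + 1) = b ↔ i = (q : ℚ) ^ (j + 1) * b := by
      rw [div_eq_iff (by positivity), mul_comm]
    simp only [h2]
    split_ifs
    · rw [← RingHom.coe_pow, map_one]
    · rw [← RingHom.coe_pow, map_zero]
  have h2 : (HahnSeries.single ((q : ℚ) ^ (j + 1) * b) 1 : HahnSeries ℚ k) =
      HahnSeries.single (((q : ℚ) ^ (j + 1) - 1) * b) 1 * HahnSeries.single b 1 := by
    rw [HahnSeries.single_mul_single, one_mul, sub_one_mul, sub_add_cancel]
  rw [← RingHom.coe_pow, map_mul, RingHom.coe_pow, h1, h2]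
  simp only [d']
  ring

end HahnEquations

/-! ### Triviality over the field of Hahn series -/

section HahnLang

variable {K : Type u} [NontriviallyNormedField K] [IsUltrametricDist K] [CompleteSpace K]
  [(NormedField.valuation (K := K)).IsRankOneDiscrete]

/-- Lift the right-hand side to the extended Robba ring, solve there and reduce. This avoids summing
an infinite orbit in the residue field. -/
theorem exists_sub_hahnFrob_eq {φ : K →+* K} (hφ : ∀ x, ‖φ x‖ = ‖x‖)
    (hbij : Function.Bijective φ) {q : ℕ} (hq : 1 < q)
    (hsolve : ∀ b, ∃ x, ‖x‖ ≤ ‖b‖ ∧ x - φ x = b) (a : HahnSeries ℚ (ResField K)) :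
    ∃ x, x - hahnFrob (redHom φ hφ) q hq x = a := by
  obtain ⟨ϖ, hϖ⟩ := exists_isUniformizer (K := K)
  have hw := norm_uniformizer_lt_one hϖ
  have hw0 := norm_uniformizer_pos hϖ
  obtain ⟨f, rfl⟩ := redHahn_surjective a
  -- The weighted norm of an integral series may slightly exceed 1. Keeping it below |ϖ|⁻¹ suffices,
  -- since by discreteness a norm below |ϖ|⁻¹ is at most 1.
  obtain ⟨C, hC1, hC⟩ := exists_between ((one_lt_inv₀ hw0).2 hw)
  obtain ⟨r, hr, hr0⟩ := ((f.1.eventually_bound f.2 hC1).and self_mem_nhdsWithin).exists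
  obtain ⟨g, hg, hgf⟩ := exists_sub_frob_eq_ban hφ hbij hq hsolve hr0 ⟨f.1, C, hr⟩
  have hgC : ∀ i, ‖g.1.coeff i‖ ≤ 1 := by
    intro i
    have h1 : ‖g.1.coeff i‖ < ‖ϖ‖⁻¹ :=
      ((norm_coeff_le g i).trans (hg.trans (norm_le_of_bound hr))).trans_lt hC
    have h2 : ‖ϖ * g.1.coeff i‖ < 1 := by
      rw [norm_mul, ← mul_inv_cancel₀ hw0.ne']
      exact mul_lt_mul_of_pos_left h1 hw0
    have h3 := norm_le_of_lt_one hϖ h2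
    rw [norm_mul] at h3
    exact le_of_mul_le_mul_left (by rwa [mul_one]) hw0
  refine ⟨redHahn ⟨g.1, hgC⟩, ?_⟩
  rw [← redHahn_frob hφ hq, ← map_sub]
  congr 1
  exact Subtype.ext hgf

theorem Lang.exists_hahn {φ : K →+* K} (hφ : ∀ x, ‖φ x‖ = ‖x‖) (hbij : Function.Bijective φ)
    (hL : Lang φ) {ϖ : K} (hϖ : (NormedField.valuation (K := K)).IsUniformizer ϖ)
    (hϖφ : φ ϖ = ϖ) {q : ℕ} (hq : 1 < q) {n : ℕ}
    (A : Matrix (Fin n) (Fin n) (HahnSeries ℚ (ResField K))) (hA : IsUnit A) :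
    ∃ U : Matrix (Fin n) (Fin n) (HahnSeries ℚ (ResField K)), IsUnit U ∧
      A * U.map (hahnFrob (redHom φ hφ) q hq) = U :=
  exists_isUnit_mul_map_eq (hahnFrob_bijective (redHom_bijective hφ hbij) q hq)
    (solvesHomogeneous_hahnFrob (hL.solvesHomogeneous_residue hφ hϖ hϖφ) q hq)
    (exists_sub_hahnFrob_eq hφ hbij hq (hL.exists_sub_eq hφ hϖ hϖφ)) A hA

end HahnLang

end Slopes

namespace Slopes

open Filter Topology

/-! ### The matrix equation near the identity -/

section SolveMatrix

theorem norm_le_of_hasSum {E ι : Type*} [SeminormedAddCommGroup E] [IsUltrametricDist E]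
    {a : ι → E} {s : E} (hs : HasSum a s) {C : ℝ} (hC : 0 ≤ C) (h : ∀ i, ‖a i‖ ≤ C) : ‖s‖ ≤ C :=
  le_of_tendsto' hs.norm fun _ =>
    IsUltrametricDist.norm_sum_le_of_forall_le_of_nonneg hC fun i _ => h i

theorem norm_matrix_mul_le {E ι : Type*} [Fintype ι] [NormedCommRing E] [IsUltrametricDist E]
    {A B : Matrix ι ι E} {C D : ℝ} (hC : 0 ≤ C) (hD : 0 ≤ D) (hA : ∀ i j, ‖A i j‖ ≤ C)
    (hB : ∀ i j, ‖B i j‖ ≤ D) (i j : ι) : ‖(A * B) i j‖ ≤ C * D := by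
  rw [Matrix.mul_apply]
  refine IsUltrametricDist.norm_sum_le_of_forall_le_of_nonneg (mul_nonneg hC hD) fun k _ => ?_
  exact (norm_mul_le _ _).trans (mul_le_mul (hA i k) (hB k j) (norm_nonneg _) hC)

variable {K : Type u} [NontriviallyNormedField K] [IsUltrametricDist K] [CompleteSpace K]

/-- This is (1 + B) φ(1 + Y) = 1 + Y, with Z standing for φ(Y) so that everything stays in the
Banach ring. Successive approximation contracts by η at each step. -/
theorem exists_mul_frob_eq_ban {φ : K →+* K} (hφ : ∀ x, ‖φ x‖ = ‖x‖)
    (hbij : Function.Bijective φ) {q : ℕ} (hq : 1 < q)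
    (hsolve : ∀ b, ∃ x, ‖x‖ ≤ ‖b‖ ∧ x - φ x = b) {r : ℝ} (hr : 0 < r) {n : ℕ}
    (B : Matrix (Fin n) (Fin n) (banSubring K r)) {η : ℝ} (hη1 : η < 1)
    (hB : ∀ i j, ‖B i j‖ ≤ η) (hη0 : 0 ≤ η) :
    ∃ Y Z : Matrix (Fin n) (Fin n) (banSubring K r), (∀ i j, ‖Y i j‖ ≤ η) ∧
      Y = Z + B * (1 + Z) ∧ ∀ i j, ExtRobba.frob φ hφ q hq (Y i j).1 = (Z i j).1 := by
  have : Fact (0 < r) := ⟨hr⟩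
  choose T hT hT' using exists_sub_frob_eq_ban hφ hbij hq hsolve hr
  -- S f equals φ(T f) in the extended Robba ring, so it plays the role of φ without leaving the
  -- subring.
  let S : banSubring K r → banSubring K r := fun f => T f - f
  have hS : ∀ f, ‖S f‖ ≤ ‖f‖ := fun f => by
    simp only [S, sub_eq_add_neg]
    refine (IsUltrametricDist.norm_add_le_max _ _).trans (max_le (hT f) ?_)
    rw [norm_neg]
  have hST : ∀ f, ExtRobba.frob φ hφ q hq (T f).1 = (S f).1 := fun f => by
    change _ = (T f).1 - f.1
    rw [← hT' f, sub_sub_cancel]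
  -- With X₀ = B and X_{m+1} = B S(X_m), put Y = Σ T(X_m) and Z = Σ S(X_m). Then Y - Z = Σ X_m = B +
  -- B Z.
  let X : ℕ → Matrix (Fin n) (Fin n) (banSubring K r) := fun m => (fun P => B * P.map S)^[m] B
  have hX : ∀ m, X (m + 1) = B * (X m).map S := fun m => Function.iterate_succ_apply' _ _ _
  have hX0 : X 0 = B := rfl
  clear_value X
  have hXn : ∀ m i j, ‖X m i j‖ ≤ η ^ (m + 1) := by
    intro m
    induction m with
    | zero => rw [hX0]; simpa using hB
    | succ m ih =>
      intro i j
      rw [hX, pow_succ']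
      exact norm_matrix_mul_le hη0 (by positivity) hB (fun i j => (hS _).trans (ih i j)) i j
  have hgeom : Summable fun m : ℕ => η ^ (m + 1) :=
    (summable_nat_add_iff 1).2 (summable_geometric_of_lt_one hη0 hη1)
  have hZs : ∀ i j, Summable fun m => S (X m i j) := fun i j =>
    Summable.of_norm_bounded hgeom fun m => (hS _).trans (hXn m i j)
  let Z : Matrix (Fin n) (Fin n) (banSubring K r) := fun i j => ∑' m, S (X m i j)
  have hZ : ∀ i j, HasSum (fun m => S (X m i j)) (Z i j) := fun i j => (hZs i j).hasSum
  have hXs : ∀ i j, HasSum (fun m => X m i j) ((B * (1 + Z)) i j) := by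
    intro i j
    have h1 : HasSum (fun m => X (m + 1) i j) ((B * Z) i j) := by
      simp only [hX, Matrix.mul_apply, Matrix.map_apply]
      exact hasSum_sum fun k _ => (hZ k j).mul_left _
    have h2 : HasSum (fun m => X m i j) (X 0 i j + (B * Z) i j) :=
      HasSum.zero_add (f := fun m => X m i j) h1
    rw [hX0] at h2
    rw [mul_add, mul_one]
    exact h2
  have hYs : ∀ i j, HasSum (fun m => T (X m i j)) ((Z + B * (1 + Z)) i j) := by
    intro i j
    have h1 := (hZ i j).add (hXs i j)
    simp only [S, sub_add_cancel] at h1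
    exact h1
  refine ⟨Z + B * (1 + Z), Z, fun i j => ?_, rfl, fun i j => ExtRobba.ext (funext fun x => ?_)⟩
  · refine norm_le_of_hasSum (hYs i j) hη0 fun m => (hT _).trans ((hXn m i j).trans ?_)
    rw [pow_succ]
    exact mul_le_of_le_one_left hη0 (pow_le_one₀ hη0 hη1.le)
  -- The identity φ(Y) = Z is checked coefficient by coefficient, which requires only continuity of
  -- φ on K and of the coefficient maps.
  · have hcont : Continuous φ := (AddMonoidHomClass.isometry_of_norm φ hφ).continuous
    have h1 := ((hYs i j).map (coeffHom (x / q)) (continuous_coeffHom _)).map φ hcont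
    have h2 := (hZ i j).map (coeffHom x) (continuous_coeffHom _)
    have h3 : (φ ∘ coeffHom (x / q) ∘ fun m => T (X m i j)) = coeffHom x ∘ fun m => S (X m i j) :=
      funext fun m => congrArg (fun f => ExtRobba.coeff f x) (hST (X m i j))
    rw [h3] at h1
    exact h1.unique h2

end SolveMatrix

/-! ### Étale triviality over the extended Robba ring -/

section ExtRobbaLang

variable {K : Type u} [NontriviallyNormedField K] [IsUltrametricDist K] [CompleteSpace K]
  [(NormedField.valuation (K := K)).IsRankOneDiscrete]

/-- The Frobenius of the subring of integral extended Robba series. -/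
noncomputable abbrev frobInt (φ : K →+* K) (hφ : ∀ x, ‖φ x‖ = ‖x‖) (q : ℕ) (hq : 1 < q) :
    (ExtRobba.int : Subring (ExtRobba K)) →+* (ExtRobba.int : Subring (ExtRobba K)) :=
  (ExtRobba.frob φ hφ q hq).restrict _ _ (ExtRobba.frob_mem_int φ hφ q hq)

theorem redHahn_eq_zero_iff (f : (ExtRobba.int : Subring (ExtRobba K))) :
    redHahn f = 0 ↔ ∀ i, ‖f.1.coeff i‖ < 1 := by
  refine ⟨fun h i => (red_eq_zero_iff (f.2 i)).1 (congrArg (fun x => HahnSeries.coeff x i) h),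
    fun h => HahnSeries.ext (funext fun i => (red_eq_zero_iff (f.2 i)).2 (h i))⟩

/-- Discreteness bounds the entries of A - 1 by |ϖ| in Gauss norm; for small r they are also bounded
by some η < 1 in weighted norm, so successive approximation applies. -/
theorem exists_mul_frobInt_eq_of_map_redHahn_eq_one {φ : K →+* K} (hφ : ∀ x, ‖φ x‖ = ‖x‖)
    (hbij : Function.Bijective φ) {q : ℕ} (hq : 1 < q)
    (hsolve : ∀ b, ∃ x, ‖x‖ ≤ ‖b‖ ∧ x - φ x = b) {n : ℕ}
    (A : Matrix (Fin n) (Fin n) (ExtRobba.int : Subring (ExtRobba K)))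
    (hA : A.map redHahn = 1) :
    ∃ U : Matrix (Fin n) (Fin n) (ExtRobba.int : Subring (ExtRobba K)), IsUnit U ∧
      A * U.map (frobInt φ hφ q hq) = U := by
  obtain ⟨ϖ, hϖ⟩ := exists_isUniformizer (K := K)
  obtain ⟨η, hη, hη1⟩ := exists_between (norm_uniformizer_lt_one hϖ)
  have hη0 : 0 ≤ η := (norm_nonneg _).trans hη.le
  have hsmall : ∀ i j x, ‖((A - 1) i j).1.coeff x‖ < 1 := by
    intro i j
    rw [← redHahn_eq_zero_iff]
    have h1 : (A - 1).map redHahn = 0 := by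
      rw [← RingHom.mapMatrix_apply, map_sub, map_one, RingHom.mapMatrix_apply, hA, sub_self]
    exact congrFun (congrFun h1 i) j
  have hev : ∀ᶠ r in 𝓝[>] (0 : ℝ), ∀ i j x, ‖((A - 1) i j).1.coeff x‖ * wgt r x ≤ η :=
    eventually_all.2 fun i => eventually_all.2 fun j =>
      ExtRobba.eventually_bound _ (fun x => norm_le_of_lt_one hϖ (hsmall i j x)) hη
  obtain ⟨r, hr, hr0⟩ := (hev.and self_mem_nhdsWithin).exists
  let B : Matrix (Fin n) (Fin n) (banSubring K r) :=
    Matrix.of fun i j => ⟨((A - 1) i j).1, η, hr i j⟩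
  obtain ⟨Y, Z, hY, hYZ, hfrob⟩ := exists_mul_frob_eq_ban hφ hbij hq hsolve hr0 B hη1
    (fun i j => norm_le_of_bound (hr i j)) hη0
  have hYc : ∀ i j x, ‖(Y i j).1.coeff x‖ < 1 := fun i j x =>
    ((norm_coeff_le _ x).trans (hY i j)).trans_lt hη1
  let W : Matrix (Fin n) (Fin n) (ExtRobba.int : Subring (ExtRobba K)) :=
    Matrix.of fun i j => ⟨(Y i j).1, fun x => (hYc i j x).le⟩
  have hW : W.map redHahn = 0 := by
    refine Matrix.ext fun i j => ?_
    exact (redHahn_eq_zero_iff _).2 (hYc i j)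
  refine ⟨1 + W, isUnit_matrix_of_isUnit_map_redHahn ?_, ?_⟩
  · rw [← RingHom.mapMatrix_apply, map_add, map_one, RingHom.mapMatrix_apply, hW, add_zero]
    exact isUnit_one
  · let ι₁ := (ExtRobba.int : Subring (ExtRobba K)).subtype
    let ι₂ := (banSubring K r).subtype
    have hBA : ι₂.mapMatrix B = ι₁.mapMatrix A - 1 := by
      rw [← map_one ι₁.mapMatrix, ← map_sub]
      rfl
    have hZW : ι₁.mapMatrix ((frobInt φ hφ q hq).mapMatrix W) = ι₂.mapMatrix Z := by
      exact Matrix.ext fun i j => hfrob i j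
    have hWY : ι₁.mapMatrix W = ι₂.mapMatrix Y := rfl
    have hinj : Function.Injective (ι₁.mapMatrix (m := Fin n)) := fun P Q h => by
      refine Matrix.ext fun i j => ?_
      exact Subtype.ext (congrFun (congrFun h i) j)
    apply hinj
    rw [← RingHom.mapMatrix_apply, map_add (frobInt φ hφ q hq).mapMatrix,
      map_one (frobInt φ hφ q hq).mapMatrix, map_mul, map_add, map_one,
      hZW, map_add, map_one, hWY, hYZ, map_add, map_mul, map_add, map_one, hBA]
    noncomm_ring

/-- Étale modules over the extended Robba ring are trivial. -/
theorem Lang.exists_int {φ : K →+* K} (hφ : ∀ x, ‖φ x‖ = ‖x‖) (hbij : Function.Bijective φ)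
    (hL : Lang φ) {ϖ : K} (hϖ : (NormedField.valuation (K := K)).IsUniformizer ϖ)
    (hϖφ : φ ϖ = ϖ) {q : ℕ} (hq : 1 < q) {n : ℕ}
    (A : Matrix (Fin n) (Fin n) (ExtRobba.int : Subring (ExtRobba K))) (hA : IsUnit A) :
    ∃ U : Matrix (Fin n) (Fin n) (ExtRobba.int : Subring (ExtRobba K)), IsUnit U ∧
      A * U.map (frobInt φ hφ q hq) = U := by
  obtain ⟨U₀, hU₀, hAU₀⟩ := hL.exists_hahn hφ hbij hϖ hϖφ hq (A.map redHahn)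
    (hA.map redHahn.mapMatrix)
  choose lift hlift using redHahn_surjective (K := K)
  have hV : (U₀.map lift).map redHahn = U₀ := by
    exact Matrix.ext fun i j => hlift _
  have hunit : IsUnit (U₀.map lift) := isUnit_matrix_of_isUnit_map_redHahn (by rwa [hV])
  obtain ⟨V, hVU⟩ := hunit
  rw [← hVU] at hV
  -- A lift V of the trivialization over Hahn series is invertible, and V⁻¹ A φ(V) is congruent to
  -- 1.
  have hred : (V⁻¹.1 * (A * V.1.map (frobInt φ hφ q hq))).map redHahn = 1 := by
    have h1 : (V.1.map (frobInt φ hφ q hq)).map redHahn =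
        U₀.map (hahnFrob (redHom φ hφ) q hq) := by
      rw [← hV]
      exact Matrix.ext fun i j => redHahn_frob hφ hq _
    rw [← RingHom.mapMatrix_apply, map_mul, map_mul, RingHom.mapMatrix_apply,
      RingHom.mapMatrix_apply, RingHom.mapMatrix_apply, h1, hAU₀, ← hV,
      ← RingHom.mapMatrix_apply, ← RingHom.mapMatrix_apply, ← map_mul, Units.inv_mul, map_one]
  obtain ⟨W, hW, hAW⟩ := exists_mul_frobInt_eq_of_map_redHahn_eq_one hφ hbij hq
    (hL.exists_sub_eq hφ hϖ hϖφ) _ hred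
  refine ⟨V.1 * W, V.isUnit.mul hW, ?_⟩
  conv_rhs => rw [← hAW]
  rw [← RingHom.mapMatrix_apply, map_mul, RingHom.mapMatrix_apply, RingHom.mapMatrix_apply,
    ← mul_assoc V.1, ← mul_assoc V.1, Units.mul_inv, one_mul, mul_assoc]

end ExtRobbaLang

end Slopes

namespace Slopes

open CategoryTheory TensorProduct Module

/-! ### Matrices of φ-modules and the criterion for purity -/

theorem exists_basis_of_isUnit {R M ι : Type*} [CommRing R] [AddCommGroup M] [Module R M]
    [Fintype ι] [DecidableEq ι] (b : Basis ι R M) {U : Matrix ι ι R} (hU : IsUnit U) :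
    ∃ b' : Basis ι R M, ∀ j, b' j = ∑ i, U i j • b i := by
  have hdet : IsUnit (b.det fun j => ∑ i, U i j • b i) := by
    have h1 : b.toMatrix (fun j => ∑ i, U i j • b i) = U := by
      ext i j
      simp [Basis.toMatrix_apply, Finsupp.single_apply]
    rw [Basis.det_apply, h1]
    exact (Matrix.isUnit_iff_isUnit_det _).1 hU
  have hb := (Basis.is_basis_iff_det b).2 hdet
  exact ⟨Basis.mk hb.1 hb.2.ge, fun j => by simp⟩

namespace PhiMod

section

variable {R : Type u} [CommRing R] {φ : R →+* R}

/-- `A` is the matrix of `Φ` in the basis `b`. -/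
def HasMatrix (M : PhiMod φ) {n : ℕ} (b : Basis (Fin n) R M.carrier)
    (A : Matrix (Fin n) (Fin n) R) : Prop :=
  ∀ j, M.Φ (b j) = ∑ i, A i j • b i

theorem hasMatrix_toMatrix (M : PhiMod φ) {n : ℕ} (b : Basis (Fin n) R M.carrier) :
    M.HasMatrix b (b.toMatrix fun i => M.Φ (b i)) := fun j => by
  simp only [Basis.toMatrix_apply]
  exact (b.sum_repr _).symm

theorem HasMatrix.eq_toMatrix {M : PhiMod φ} {n : ℕ} {b : Basis (Fin n) R M.carrier}
    {A : Matrix (Fin n) (Fin n) R} (h : M.HasMatrix b A) :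
    b.toMatrix (fun i => M.Φ (b i)) = A := by
  ext i j
  rw [Basis.toMatrix_apply, h j]
  simp [Finsupp.single_apply]

theorem HasMatrix.isUnit {M : PhiMod φ} {n : ℕ} {b : Basis (Fin n) R M.carrier}
    {A : Matrix (Fin n) (Fin n) R} (h : M.HasMatrix b A) : IsUnit A := by
  obtain ⟨b', hb'⟩ := exists_basis_of_basis b
  rw [Matrix.isUnit_iff_isUnit_det, ← h.eq_toMatrix, ← funext hb', ← Basis.det_apply]
  exact (Basis.is_basis_iff_det b).1 ⟨b'.linearIndependent, b'.span_eq⟩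

theorem hasDegree_iff {ord : R → ℤ → Prop} {M : PhiMod φ} {k : ℤ} :
    M.HasDegree ord k ↔ ∃ (n : ℕ) (b : Basis (Fin n) R M.carrier) (A : Matrix (Fin n) (Fin n) R),
      M.HasMatrix b A ∧ ord A.det k :=
  ⟨fun ⟨n, b, h⟩ => ⟨n, b, _, M.hasMatrix_toMatrix b, h⟩,
    fun ⟨n, b, _, hA, h⟩ => ⟨n, b, by rwa [hA.eq_toMatrix]⟩⟩

/-- The `φ`-module `R^n` on which `φ` acts on the standard basis by an invertible matrix. -/
noncomputable def ofMatrix {n : ℕ} {A : Matrix (Fin n) (Fin n) R} (hA : IsUnit A) :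
    PhiMod φ where
  carrier := Fin n → R
  Φ :=
    { toFun := fun v => A.mulVec (φ ∘ v)
      map_add' := fun v w => by
        rw [← Matrix.mulVec_add]
        congr 1
        funext i
        exact map_add φ _ _
      map_smul' := fun r v => by
        rw [← Matrix.mulVec_smul]
        congr 1
        funext i
        exact map_mul φ _ _ }
  strict := by
    obtain ⟨b', hb'⟩ := exists_basis_of_isUnit (Pi.basisFun R (Fin n)) hA
    refine ⟨n, Pi.basisFun R (Fin n), b', fun j => ?_⟩
    rw [hb']
    funext i
    simp [Matrix.mulVec, dotProduct, Pi.single_apply]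

theorem exists_hasMatrix (φ : R →+* R) {n : ℕ} {A : Matrix (Fin n) (Fin n) R} (hA : IsUnit A) :
    ∃ (M : PhiMod φ) (b : Basis (Fin n) R M.carrier), M.HasMatrix b A := by
  refine ⟨ofMatrix hA, Pi.basisFun R (Fin n), fun j => ?_⟩
  funext i
  change A.mulVec (φ ∘ (Pi.basisFun R (Fin n)) j) i = (∑ i, A i j • Pi.basisFun R (Fin n) i) i
  simp [Matrix.mulVec, dotProduct, Pi.single_apply]

/-- The linear equivalence underlying an isomorphism of `φ`-modules. -/
def linearEquivOfIso {M N : PhiMod φ} (e : M ≅ N) : M.carrier ≃ₗ[R] N.carrier :=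
  LinearEquiv.ofLinearMap (Hom.lin e.hom) (Hom.lin e.inv)
    (congrArg Hom.lin e.inv_hom_id) (congrArg Hom.lin e.hom_inv_id)

theorem HasMatrix.map {M N : PhiMod φ} {n : ℕ} {b : Basis (Fin n) R M.carrier}
    {A : Matrix (Fin n) (Fin n) R} (h : M.HasMatrix b A) (e : M ≅ N) :
    N.HasMatrix (b.map (linearEquivOfIso e)) A := fun j => by
  have h1 := congrArg (Hom.lin e.hom) (h j)
  rw [Hom.comm, map_sum] at h1
  simp only [map_smul] at h1
  simp only [Basis.map_apply]
  exact h1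

theorem HasMatrix.nonempty_iso {M N : PhiMod φ} {n : ℕ} {b : Basis (Fin n) R M.carrier}
    {c : Basis (Fin n) R N.carrier} {A : Matrix (Fin n) (Fin n) R} (hM : M.HasMatrix b A)
    (hN : N.HasMatrix c A) : ∃ e : M ≅ N, ∀ i, Hom.lin e.hom (b i) = c i := by
  have key : ∀ {M N : PhiMod φ} {b : Basis (Fin n) R M.carrier} {c : Basis (Fin n) R N.carrier},
      M.HasMatrix b A → N.HasMatrix c A → ∀ x,
        b.equiv c (Equiv.refl _) (M.Φ x) = N.Φ (b.equiv c (Equiv.refl _) x) := by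
    intro M N b c hM hN x
    have h1 : (b.equiv c (Equiv.refl _)).toLinearMap.comp M.Φ =
        N.Φ.comp (b.equiv c (Equiv.refl _)).toLinearMap := by
      refine b.ext fun j => ?_
      simp only [LinearMap.comp_apply, LinearEquiv.coe_coe, Basis.equiv_apply, Equiv.refl_apply]
      rw [hM j, hN j, map_sum]
      simp
    exact LinearMap.congr_fun h1 x
  refine ⟨⟨⟨(b.equiv c (Equiv.refl _)).toLinearMap, key hM hN⟩,
    ⟨(c.equiv b (Equiv.refl _)).toLinearMap, key hN hM⟩, ?_, ?_⟩, fun i => ?_⟩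
  · refine hom_ext (b.ext fun i => ?_)
    change c.equiv b (Equiv.refl _) (b.equiv c (Equiv.refl _) (b i)) = b i
    simp
  · refine hom_ext (c.ext fun i => ?_)
    change b.equiv c (Equiv.refl _) (c.equiv b (Equiv.refl _) (c i)) = c i
    simp
  · change b.equiv c (Equiv.refl _) (b i) = c i
    simp

theorem HasMatrix.baseChange {S : Type u} [CommRing S] [Algebra R S] {ψ : S →+* S}
    (h : ∀ r, algebraMap R S (φ r) = ψ (algebraMap R S r)) {M : PhiMod φ} {n : ℕ}
    {b : Basis (Fin n) R M.carrier} {A : Matrix (Fin n) (Fin n) R} (hA : M.HasMatrix b A) :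
    (baseChangeObj h M).HasMatrix (b.baseChange S) (A.map (algebraMap R S)) := fun j => by
  have h1 : baseChangeΦ h M (b.baseChange S j) =
      ∑ i, A.map (algebraMap R S) i j • b.baseChange S i := by
    rw [Basis.baseChange_apply, baseChangeΦ_tmul, map_one, hA j, TensorProduct.tmul_sum]
    refine Finset.sum_congr rfl fun i _ => ?_
    rw [Basis.baseChange_apply, Matrix.map_apply, TensorProduct.tmul_smul, algebraMap_smul]
  exact h1

theorem isEtale_iff {O : Subring R} (hO : ∀ x ∈ O, φ x ∈ O) {M : PhiMod φ} :
    M.IsEtale O hO ↔ ∃ (n : ℕ) (b : Basis (Fin n) R M.carrier) (A : Matrix (Fin n) (Fin n) O),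
      IsUnit A ∧ M.HasMatrix b (A.map O.subtype) := by
  constructor
  · rintro ⟨N, ⟨e⟩⟩
    obtain ⟨n, b, -, -⟩ := N.strict
    exact ⟨n, _, _, (N.hasMatrix_toMatrix b).isUnit,
      ((N.hasMatrix_toMatrix b).baseChange (S := R) (ψ := φ) fun _ => rfl).map e⟩
  · rintro ⟨n, b, A, hA, hM⟩
    obtain ⟨N, c, hN⟩ := exists_hasMatrix (φ.restrict O O hO) hA
    obtain ⟨e, -⟩ := (hN.baseChange (S := R) (ψ := φ) fun _ => rfl).nonempty_iso hM
    exact ⟨_, ⟨e⟩⟩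

/-- A criterion for purity: over a ring for which étale `φ^d`-modules are trivial, `M` is pure of
slope `c/d` if it has the right degree and a basis on which `φ^d` acts by multiplication by a
scalar `z` of valuation `c`. -/
theorem isPure_iff [Nontrivial R] {O : Subring R} (hO : ∀ x ∈ O, φ x ∈ O) {ord : R → ℤ → Prop}
    {s : ℚ} (htriv : ∀ (n : ℕ) (A : Matrix (Fin n) (Fin n) O), IsUnit A →
      ∃ U : Matrix (Fin n) (Fin n) R, IsUnit U ∧ A.map O.subtype * U.map (φ ^ s.den) = U)
    (z : Rˣ) (hz : ord z⁻¹.1 (-s.num))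
    (hord : ∀ ν, IsUnit ν → ord ν (-s.num) → ∃ ν₀ : Oˣ, ν * z = ν₀) {M : PhiMod φ} :
    M.IsPure O hO ord s ↔ (∃ n : ℤ, M.HasDegree ord n ∧ (n : ℚ) = s * finrank R M.carrier) ∧
      ∃ (n : ℕ) (b : Basis (Fin n) R M.carrier), ∀ j, M.iter s.den (b j) = z.1 • b j := by
  refine and_congr_right fun _ => ⟨?_, ?_⟩
  · rintro ⟨N, hN, hdeg, het⟩
    obtain ⟨m, c, C, hC, hCdeg⟩ := hasDegree_iff.1 hdeg
    obtain rfl : m = 1 := by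
      rw [finrank_eq_card_basis c, Fintype.card_fin] at hN
      exact hN
    obtain ⟨n, b, A, hA, hbA⟩ := (isEtale_iff _).1 het
    set ν := C 0 0 with hν
    have hνdet : C.det = ν := by simp [hν]
    have hNΦ : N.Φ (c 0) = ν • c 0 := by simpa using hC 0
    have hνu : IsUnit ν := by
      rw [← hνdet]
      exact (Matrix.isUnit_iff_isUnit_det _).1 hC.isUnit
    -- N acts by ν of valuation -c, so it differs from z⁻¹ by a unit of the integral subring, and
    -- this unit can be absorbed into the étale matrix.
    obtain ⟨ν₀, hν₀⟩ := hord ν hνu (by rwa [← hνdet])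
    let cN : N.carrier ≃ₗ[R] R := c.equivFun ≪≫ₗ LinearEquiv.funUnique (Fin 1) R R
    have hcN : cN.symm 1 = c 0 := by
      rw [LinearEquiv.symm_apply_eq]
      simp [cN]
    -- As N has rank one, x ↦ x ⊗ c₀ identifies the modules and turns Φ on the tensor product into ν
    -- Φ^d on M.
    let e : M.carrier ≃ₗ[R] M.carrier ⊗[R] N.carrier :=
      (TensorProduct.rid R M.carrier).symm ≪≫ₗ
        TensorProduct.congr (LinearEquiv.refl R _) cN.symm
    have he : ∀ x, e x = x ⊗ₜ c 0 := fun x => by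
      simp [e, hcN]
    have heΦ : ∀ x, ((M.push s.den).tensor N).Φ (e x) = ν • e (M.iter s.den x) := fun x => by
      rw [he, he]
      change M.iter s.den x ⊗ₜ[R] N.Φ (c 0) = _
      rw [hNΦ, TensorProduct.tmul_smul]
    let b₁ : Basis (Fin n) R M.carrier := b.map e.symm
    have hb₁ : ∀ j, e (b₁ j) = b j := fun j => e.apply_symm_apply (b j)
    -- In the basis b₁ the map Φ^d is z times the étale matrix ν₀⁻¹ A. Trivializing the latter
    -- leaves the scalar z.
    obtain ⟨U, hU, hAU⟩ := htriv n (((ν₀⁻¹ : Oˣ) : O) • A)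
      ((hA.smul (ν₀⁻¹)))
    obtain ⟨b₂, hb₂⟩ := exists_basis_of_isUnit b₁ hU
    have hiter : ∀ j, M.iter s.den (b₁ j) =
        z.1 • ∑ i, ((((ν₀⁻¹ : Oˣ) : O) • A).map O.subtype) i j • b₁ i := by
      intro j
      have h1 : ν • M.iter s.den (b₁ j) = ∑ i, (A.map O.subtype) i j • b₁ i := by
        apply e.injective
        rw [map_smul, ← heΦ, hb₁, map_sum]
        simp only [map_smul, hb₁]
        exact hbA j
      have h2 : (((ν₀⁻¹ : Oˣ) : O) : R) * (ν * z.1) = 1 := by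
        rw [hν₀, ← Subring.coe_mul, Units.inv_mul, Subring.coe_one]
      have h3 : ∀ i, ((((ν₀⁻¹ : Oˣ) : O) • A).map O.subtype) i j =
          (((ν₀⁻¹ : Oˣ) : O) : R) * (A.map O.subtype) i j := fun i => rfl
      simp only [h3, mul_smul]
      rw [← Finset.smul_sum, ← h1, ← mul_smul, ← mul_smul]
      rw [show z.1 * (((ν₀⁻¹ : Oˣ) : O) : R) * ν = (((ν₀⁻¹ : Oˣ) : O) : R) * (ν * z.1) by ring,
        h2, one_smul]
    refine ⟨n, b₂, fun j => ?_⟩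
    have hUm : ∀ k, U.map (φ ^ s.den) k j = (φ ^ s.den) (U k j) := fun _ => rfl
    conv_rhs => rw [hb₂, ← hAU]
    rw [hb₂, map_sum]
    simp only [LinearMap.map_smulₛₗ, hiter, Matrix.mul_apply, hUm,
      Finset.smul_sum, Finset.sum_smul]
    rw [Finset.sum_comm]
    refine Finset.sum_congr rfl fun i _ => Finset.sum_congr rfl fun k _ => ?_
    simp only [← mul_smul]
    congr 1
    ring
  · rintro ⟨n, b, hb⟩
    have hA : IsUnit (Matrix.of fun _ _ : Fin 1 => z⁻¹.1) := by
      rw [Matrix.isUnit_iff_isUnit_det]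
      simp
    obtain ⟨N, c, hN⟩ := exists_hasMatrix (φ ^ s.den) hA
    refine ⟨N, ?_, hasDegree_iff.2 ⟨1, c, _, hN, ?_⟩, ?_⟩
    · rw [finrank_eq_card_basis c, Fintype.card_fin]
    · simpa using hz
    -- Twisting by z⁻¹ makes the tensor basis fixed, so the matrix of the twist is the identity.
    · refine (isEtale_iff _).2 ⟨n * 1, (b.tensorProduct c).reindex finProdFinEquiv, 1,
        isUnit_one, fun j => ?_⟩
      obtain ⟨⟨j, k⟩, rfl⟩ := finProdFinEquiv.surjective j
      rw [Matrix.map_one _ (map_zero _) (map_one _)]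
      simp only [Matrix.one_apply, ite_smul, one_smul, zero_smul, Finset.sum_ite_eq',
        Finset.mem_univ, if_true]
      have hbasis : ((b.tensorProduct c).reindex finProdFinEquiv) (finProdFinEquiv (j, k)) =
          b j ⊗ₜ c k := by
        rw [Basis.reindex_apply, Equiv.symm_apply_apply, Basis.tensorProduct_apply]
      have hk : N.Φ (c k) = z⁻¹.1 • c k := by
        rw [hN k, Subsingleton.elim k 0]
        simp
      have h1 : M.iter s.den (b j) ⊗ₜ[R] N.Φ (c k) = b j ⊗ₜ c k := by
        rw [hb, hk, TensorProduct.smul_tmul_smul, Units.mul_inv, one_smul]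
      exact (congrArg ((M.push s.den).tensor N).Φ hbasis).trans (h1.trans hbasis.symm)

end

end PhiMod

end Slopes

namespace Slopes

open CategoryTheory TensorProduct Module

namespace PhiMod

/-! ### Descent of morphisms and objects along base change -/

section

variable {R : Type u} [CommRing R] {φ : R →+* R}

theorem HasMatrix.mul_map_toMatrix {M : PhiMod φ} {n : ℕ} {b : Basis (Fin n) R M.carrier}
    {A : Matrix (Fin n) (Fin n) R} (h : M.HasMatrix b A) {m : ℕ} (c : Fin m → M.carrier) :
    A * (b.toMatrix c).map φ = b.toMatrix fun j => M.Φ (c j) := by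
  ext i j
  rw [Basis.toMatrix_apply]
  conv_rhs => rw [← b.sum_repr (c j)]
  simp only [map_sum, LinearMap.map_smulₛₗ, h _, Finsupp.coe_finsetSum, Finset.sum_apply,
    LinearEquiv.map_smul, Finsupp.smul_apply, Basis.repr_self, Finsupp.single_apply, smul_eq_mul,
    mul_ite, mul_one, mul_zero, Finset.sum_ite_eq', Finset.mem_univ, if_true, Matrix.mul_apply,
    Matrix.map_apply, Basis.toMatrix_apply]
  exact Finset.sum_congr rfl fun k _ => mul_comm _ _

theorem exists_mul_map_eq_of_isTrivial [Nontrivial R] {M : PhiMod φ} {n : ℕ}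
    {b : Basis (Fin n) R M.carrier} {A : Matrix (Fin n) (Fin n) R} (h : M.HasMatrix b A)
    (hM : M.IsTrivial) : ∃ U : Matrix (Fin n) (Fin n) R, IsUnit U ∧ A * U.map φ = U := by
  obtain ⟨m, c, hc⟩ := hM
  obtain rfl : m = n := by
    simpa using Fintype.card_congr (c.indexEquiv b)
  refine ⟨b.toMatrix c, ?_, ?_⟩
  · rw [Matrix.isUnit_iff_isUnit_det, ← Basis.det_apply]
    exact (Basis.is_basis_iff_det b).1 ⟨c.linearIndependent, c.span_eq⟩
  · rw [h.mul_map_toMatrix, funext hc]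

/-- In the basis e, the map φ^d acts by z times φ^d on coordinates. Cancelling z from the equation
for v leaves invariant coordinates. -/
theorem map_repr_eq_of_iter_eq {M : PhiMod φ} {n d : ℕ} {e : Basis (Fin n) R M.carrier} {z : R}
    (hz : IsUnit z) (he : ∀ j, M.iter d (e j) = z • e j) {v : M.carrier}
    (hv : M.iter d v = z • v) (i : Fin n) : (φ ^ d) (e.repr v i) = e.repr v i := by
  have h1 : M.iter d v = z • ∑ i, (φ ^ d) (e.repr v i) • e i := by
    conv_lhs => rw [← e.sum_repr v]
    simp only [map_sum, LinearMap.map_smulₛₗ, he, Finset.smul_sum]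
    exact Finset.sum_congr rfl fun k _ => smul_comm _ _ _
  rw [hv] at h1
  have h2 := hz.smul_left_cancel.1 h1
  conv_rhs => rw [h2]
  simp [Finsupp.single_apply]

theorem Hom.comm_iter {M N : PhiMod φ} (f : Hom M N) (d : ℕ) (x : M.carrier) :
    f.lin (M.iter d x) = N.iter d (f.lin x) := by
  induction d generalizing x with
  | zero => rfl
  | succ d ih => exact (ih (M.Φ x)).trans (congrArg (N.iter d) (f.comm x))

theorem iter_Φ (M : PhiMod φ) (d : ℕ) (x : M.carrier) : M.iter d (M.Φ x) = M.Φ (M.iter d x) :=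
  (Function.iterate_succ_apply M.Φ d x).symm.trans (Function.iterate_succ_apply' M.Φ d x)

theorem iter_baseChange {S : Type u} [CommRing S] [Algebra R S] {ψ : S →+* S}
    (h : ∀ r, algebraMap R S (φ r) = ψ (algebraMap R S r)) (M : PhiMod φ) (d : ℕ)
    (x : M.carrier) :
    (baseChangeObj h M).iter d ((1 : S) ⊗ₜ[R] x : S ⊗[R] M.carrier) =
      ((1 : S) ⊗ₜ[R] M.iter d x : S ⊗[R] M.carrier) := by
  induction d generalizing x with
  | zero => rfl
  | succ d ih =>
    refine Eq.trans ?_ (ih (M.Φ x))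
    refine congrArg ((baseChangeObj h M).iter d) ((baseChangeΦ_tmul h M 1 x).trans ?_)
    rw [map_one]

theorem one_tmul_injective {S : Type u} [CommRing S] [Algebra R S]
    (hinj : Function.Injective (algebraMap R S)) (M : PhiMod φ) :
    Function.Injective fun x : M.carrier => (1 : S) ⊗ₜ[R] x := by
  obtain ⟨n, b, -, -⟩ := M.strict
  intro x y hxy
  refine b.repr.injective (Finsupp.ext fun i => hinj ?_)
  have h1 := congrArg (fun t => (b.baseChange S).repr t i) hxy
  simpa [Basis.baseChange_repr_tmul, Algebra.smul_def] using h1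

theorem iter_baseChange_basis {S : Type u} [CommRing S] [Algebra R S] {ψ : S →+* S}
    (h : ∀ r, algebraMap R S (φ r) = ψ (algebraMap R S r)) {M : PhiMod φ} {n d : ℕ}
    {e : Basis (Fin n) R M.carrier} {z : R} (he : ∀ j, M.iter d (e j) = z • e j) (j : Fin n) :
    (baseChangeObj h M).iter d (e.baseChange S j) =
      (algebraMap R S z • e.baseChange S j : S ⊗[R] M.carrier) := by
  rw [Basis.baseChange_apply]
  refine (iter_baseChange h M d (e j)).trans ?_
  rw [he, TensorProduct.tmul_smul, algebraMap_smul]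

/-- Base change is faithful. -/
theorem baseChange_faithful {S : Type u} [CommRing S] [Algebra R S] {ψ : S →+* S}
    (h : ∀ r, algebraMap R S (φ r) = ψ (algebraMap R S r))
    (hinj : Function.Injective (algebraMap R S)) {M N : PhiMod φ} {f g : M ⟶ N}
    (hfg : (baseChange h).map f = (baseChange h).map g) : f = g := by
  refine hom_ext (LinearMap.ext fun x => one_tmul_injective hinj N ?_)
  exact LinearMap.congr_fun (congrArg Hom.lin hfg) ((1 : S) ⊗ₜ[R] x)

/-- Base change is full on modules with bases on which `φ^d` acts by the same scalar, if the
invariants of `ψ^d` come from `R`. -/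
theorem baseChange_full {S : Type u} [CommRing S] [Algebra R S] {ψ : S →+* S}
    (h : ∀ r, algebraMap R S (φ r) = ψ (algebraMap R S r))
    (hinj : Function.Injective (algebraMap R S)) {d : ℕ}
    (hinv : ∀ x : S, (ψ ^ d) x = x → ∃ a : R, algebraMap R S a = x) {z : R} (hz : IsUnit z)
    {M N : PhiMod φ} {m n : ℕ} {e : Basis (Fin m) R M.carrier} {e' : Basis (Fin n) R N.carrier}
    (he : ∀ j, M.iter d (e j) = z • e j) (he' : ∀ j, N.iter d (e' j) = z • e' j)
    (f : (baseChange h).obj M ⟶ (baseChange h).obj N) :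
    ∃ g : M ⟶ N, (baseChange h).map g = f := by
  let F : S ⊗[R] M.carrier →ₗ[S] S ⊗[R] N.carrier := Hom.lin f
  have hF : ∀ j, (baseChangeObj h N).iter d (F (e.baseChange S j)) =
      (algebraMap R S z • F (e.baseChange S j) : S ⊗[R] N.carrier) := by
    intro j
    rw [← map_smul]
    refine (Hom.comm_iter f d _).symm.trans ?_
    exact congrArg F (iter_baseChange_basis h he j)
  -- A morphism carries vectors on which ψ^d acts by z to such vectors, so its matrix entries are
  -- invariant.
  have hrepr : ∀ i j, ∃ a : R, algebraMap R S a =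
      (e'.baseChange S).repr (F (e.baseChange S j)) i := fun i j =>
    hinv _ (map_repr_eq_of_iter_eq (M := baseChangeObj h N) (e := e'.baseChange S)
      (hz.map (algebraMap R S)) (iter_baseChange_basis h he') (hF j) i)
  choose X hX using hrepr
  let G : M.carrier →ₗ[R] N.carrier := e.constr R fun j => ∑ i, X i j • e' i
  have hG : G.baseChange S = F := by
    refine (e.baseChange S).ext fun j => ?_
    rw [← (e'.baseChange S).sum_repr (F _), Basis.baseChange_apply, LinearMap.baseChange_tmul,
      Basis.constr_basis, TensorProduct.tmul_sum]
    refine Finset.sum_congr rfl fun i _ => ?_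
    rw [← Basis.baseChange_apply S e, ← hX, Basis.baseChange_apply, TensorProduct.tmul_smul,
      algebraMap_smul]
  have hcomm : ∀ x, G (M.Φ x) = N.Φ (G x) := by
    intro x
    refine one_tmul_injective hinj N ?_
    have h1 : F (baseChangeΦ h M ((1 : S) ⊗ₜ[R] x)) = baseChangeΦ h N (F ((1 : S) ⊗ₜ[R] x)) :=
      Hom.comm f _
    rw [← hG, baseChangeΦ_tmul, LinearMap.baseChange_tmul, LinearMap.baseChange_tmul,
      baseChangeΦ_tmul, map_one] at h1
    exact h1
  exact ⟨⟨G, hcomm⟩, hom_ext hG⟩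

/-- A module with a basis on which `ψ^d` acts by an invariant scalar descends, if the invariants of
`ψ^d` come from `R`. -/
theorem exists_baseChange_iso {S : Type u} [CommRing S] [Algebra R S] {ψ : S →+* S}
    (h : ∀ r, algebraMap R S (φ r) = ψ (algebraMap R S r))
    (hinj : Function.Injective (algebraMap R S))
    (hunit : ∀ x : R, IsUnit (algebraMap R S x) → IsUnit x) {d : ℕ}
    (hinv : ∀ x : S, (ψ ^ d) x = x → ∃ a : R, algebraMap R S a = x) {z : R} (hz : IsUnit z)
    (hzφ : φ z = z) {P : PhiMod ψ} {n : ℕ} {e : Basis (Fin n) S P.carrier}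
    (he : ∀ j, P.iter d (e j) = algebraMap R S z • e j) :
    ∃ (M : PhiMod φ) (b : Basis (Fin n) R M.carrier), (∀ j, M.iter d (b j) = z • b j) ∧
      Nonempty ((baseChange h).obj M ≅ P) := by
  have hB := P.hasMatrix_toMatrix e
  -- As z is fixed by φ, Φ(e_j) satisfies the same equation as e_j. So even the matrix of Φ
  -- descends.
  have hrepr : ∀ i j, ∃ a : R, algebraMap R S a = e.toMatrix (fun i => P.Φ (e i)) i j := by
    refine fun i j => hinv _ (map_repr_eq_of_iter_eq (hz.map (algebraMap R S)) he ?_ i)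
    rw [iter_Φ, he, LinearMap.map_smulₛₗ, ← h, hzφ]
  choose X hX using hrepr
  have hX' : (Matrix.of X).map (algebraMap R S) = e.toMatrix fun i => P.Φ (e i) :=
    Matrix.ext hX
  have hXu : IsUnit (Matrix.of X) := by
    rw [Matrix.isUnit_iff_isUnit_det]
    apply hunit
    rw [RingHom.map_det, RingHom.mapMatrix_apply, hX', ← Matrix.isUnit_iff_isUnit_det]
    exact hB.isUnit
  obtain ⟨M, b, hM⟩ := exists_hasMatrix φ hXu
  have hMS := hM.baseChange h
  rw [hX'] at hMS
  obtain ⟨f, hf⟩ := hMS.nonempty_iso hB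
  refine ⟨M, b, fun j => one_tmul_injective hinj M ?_, ⟨f⟩⟩
  apply (linearEquivOfIso f).injective
  let v : (baseChangeObj h M).carrier := ((1 : S) ⊗ₜ[R] b j : S ⊗[R] M.carrier)
  have hv : Hom.lin f.hom v = e j :=
    (congrArg (Hom.lin f.hom) (Basis.baseChange_apply S b j).symm).trans (hf j)
  have h1 : Hom.lin f.hom ((baseChangeObj h M).iter d v) =
      Hom.lin f.hom (algebraMap R S z • v) := by
    rw [Hom.comm_iter, map_smul, hv, he]
  have h2 : ((1 : S) ⊗ₜ[R] (z • b j) : S ⊗[R] M.carrier) =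
      algebraMap R S z • ((1 : S) ⊗ₜ[R] b j) := by
    rw [TensorProduct.tmul_smul, algebraMap_smul]
  exact ((congrArg (Hom.lin f.hom) (iter_baseChange h M d (b j))).symm.trans h1).trans
    (congrArg (Hom.lin f.hom) h2.symm)

theorem HasDegree.baseChange {S : Type u} [CommRing S] [Algebra R S] {ψ : S →+* S}
    (h : ∀ r, algebraMap R S (φ r) = ψ (algebraMap R S r)) {ord : R → ℤ → Prop}
    {ord' : S → ℤ → Prop} (hord : ∀ x n, ord x n → ord' (algebraMap R S x) n) {M : PhiMod φ}
    {k : ℤ} (hM : M.HasDegree ord k) : (baseChangeObj h M).HasDegree ord' k := by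
  obtain ⟨n, b, A, hA, hk⟩ := hasDegree_iff.1 hM
  refine hasDegree_iff.2 ⟨n, _, _, hA.baseChange h, ?_⟩
  rw [← RingHom.mapMatrix_apply, ← RingHom.map_det]
  exact hord _ _ hk

/-- The determinant of Φ^d is a product of φ-translates of det A, which all have the same value of
ν. -/
theorem HasMatrix.exists_push {M : PhiMod φ} {n : ℕ} {b : Basis (Fin n) R M.carrier}
    {A : Matrix (Fin n) (Fin n) R} (h : M.HasMatrix b A) {ν : R →*₀ ℝ} (hν : ∀ x, ν (φ x) = ν x)
    (d : ℕ) :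
    ∃ B : Matrix (Fin n) (Fin n) R, (∀ j, M.iter d (b j) = ∑ i, B i j • b i) ∧
      ν B.det = ν A.det ^ d := by
  induction d with
  | zero =>
    refine ⟨1, fun j => ?_, by simp⟩
    simp only [Matrix.one_apply, ite_smul, one_smul, zero_smul, Finset.sum_ite_eq',
      Finset.mem_univ, if_true]
    rfl
  | succ d ih =>
    obtain ⟨B, hB, hdet⟩ := ih
    refine ⟨A * B.map φ, fun j => ?_, ?_⟩
    · refine (iter_Φ M d (b j)).trans ?_
      rw [hB, map_sum]
      simp only [LinearMap.map_smulₛₗ, h _, Matrix.mul_apply, Matrix.map_apply, Finset.smul_sum,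
        Finset.sum_smul]
      rw [Finset.sum_comm]
      refine Finset.sum_congr rfl fun i _ => Finset.sum_congr rfl fun k _ => ?_
      rw [← mul_smul, mul_comm]
    · rw [Matrix.det_mul, map_mul, ← RingHom.mapMatrix_apply, ← RingHom.map_det, hν, hdet,
        pow_succ']

end

end PhiMod

end Slopes

namespace Slopes

open CategoryTheory Module

/-! ### Powers and invariants of Frobenius -/

section Iterate

variable {K : Type u} [NontriviallyNormedField K]

theorem norm_pow_apply {φ : K →+* K} (hφ : ∀ x, ‖φ x‖ = ‖x‖) (d : ℕ) (x : K) :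
    ‖(φ ^ d) x‖ = ‖x‖ := by
  induction d generalizing x with
  | zero => rfl
  | succ d ih =>
    rw [pow_succ]
    exact (ih (φ x)).trans (hφ x)

theorem bijective_pow {φ : K →+* K} (hbij : Function.Bijective φ) (d : ℕ) :
    Function.Bijective (φ ^ d) := by
  rw [RingHom.coe_pow]
  exact hbij.iterate d

theorem pow_apply_eq_self {φ : K →+* K} {x : K} (hx : φ x = x) (d : ℕ) : (φ ^ d) x = x := by
  rw [RingHom.coe_pow]
  exact Function.iterate_fixed hx d

variable [IsUltrametricDist K] [CompleteSpace K]

theorem coeff_frob_pow (φ : K →+* K) (hφ : ∀ x, ‖φ x‖ = ‖x‖) (q : ℕ) (hq : 1 < q) (d : ℕ)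
    (f : ExtRobba K) (i : ℚ) :
    ((ExtRobba.frob φ hφ q hq ^ d) f).coeff i = (φ ^ d) (f.coeff (i / (q : ℚ) ^ d)) := by
  induction d generalizing f with
  | zero => simp
  | succ d ih =>
    have h1 : (ExtRobba.frob φ hφ q hq ^ (d + 1)) f =
        (ExtRobba.frob φ hφ q hq ^ d) (ExtRobba.frob φ hφ q hq f) := by
      rw [pow_succ]
      rfl
    rw [h1, ih, ExtRobba.coeff_frob, pow_succ φ, pow_succ (q : ℚ), div_div]
    rfl

/-- A power of Frobenius is again a Frobenius, for the data φ^d and q^d, so the results on one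
Frobenius apply to it. -/
theorem frob_pow (φ : K →+* K) (hφ : ∀ x, ‖φ x‖ = ‖x‖) (q : ℕ) (hq : 1 < q) (d : ℕ)
    (hqd : 1 < q ^ d) :
    ExtRobba.frob φ hφ q hq ^ d = ExtRobba.frob (φ ^ d) (norm_pow_apply hφ d) (q ^ d) hqd := by
  refine RingHom.ext fun f => ExtRobba.ext (funext fun i => ?_)
  rw [coeff_frob_pow, ExtRobba.coeff_frob, Nat.cast_pow]

theorem algebraMap_coeff_zero (a : K) : (algebraMap K (ExtRobba K) a).coeff 0 = a :=
  Pi.single_eq_same (M := fun _ : ℚ => K) 0 a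

theorem algebraMap_coeff_of_ne {i : ℚ} (hi : i ≠ 0) (a : K) :
    (algebraMap K (ExtRobba K) a).coeff i = 0 :=
  Pi.single_eq_of_ne (M := fun _ : ℚ => K) hi a

theorem algebraMap_mul_coeff (a : K) (f : ExtRobba K) (i : ℚ) :
    (algebraMap K (ExtRobba K) a * f).coeff i = a * f.coeff i :=
  congrFun (single_conv a f.coeff) i

theorem algebraMap_extRobba_injective : Function.Injective (algebraMap K (ExtRobba K)) :=
  fun a b h => by rw [← algebraMap_coeff_zero a, h, algebraMap_coeff_zero]

instance : Nontrivial (ExtRobba K) := algebraMap_extRobba_injective.nontrivial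

/-- The invariants of Frobenius on the extended Robba ring are constant. -/
theorem exists_algebraMap_eq_of_frob_eq {φ : K →+* K} (hφ : ∀ x, ‖φ x‖ = ‖x‖) {q : ℕ}
    (hq : 1 < q) {f : ExtRobba K} (hf : ExtRobba.frob φ hφ q hq f = f) :
    ∃ a : K, algebraMap K (ExtRobba K) a = f := by
  have hq0 : (0 : ℚ) < q := by exact_mod_cast zero_lt_one.trans hq
  have hq1 : (1 : ℚ) < q := by exact_mod_cast hq
  have hnorm : ∀ i, ‖f.coeff (i / q)‖ = ‖f.coeff i‖ := fun i => by
    conv_rhs => rw [← hf, ExtRobba.coeff_frob, hφ]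
  have hnorm' : ∀ i, ‖f.coeff (i * q)‖ = ‖f.coeff i‖ := fun i => by
    rw [← hnorm, mul_div_cancel_right₀ _ hq0.ne']
  obtain ⟨r, -, hfr⟩ := f.2
  refine ⟨f.coeff 0, ExtRobba.ext (funext fun i => ?_)⟩
  by_cases hi : i = 0
  · rw [hi, algebraMap_coeff_zero]
  rw [algebraMap_coeff_of_ne hi]
  by_contra hne
  have hwf := hfr.wf ‖f.coeff i‖ (norm_pos_iff.2 (Ne.symm hne))
  rw [Set.isWF_iff_no_descending_seq] at hwf
  -- Coefficient norms are constant along i q^n for n in ℤ; the descending direction is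
  -- multiplication by q if i < 0 and division if i > 0.
  rcases lt_or_gt_of_ne hi with hneg | hpos
  · refine hwf (fun n => i * (q : ℚ) ^ n) ?_ fun n => ?_
    · refine strictAnti_nat_of_succ_lt fun n => ?_
      rw [pow_succ, ← mul_assoc]
      have : i * (q : ℚ) ^ n < 0 := mul_neg_of_neg_of_pos hneg (by positivity)
      nlinarith
    · change ‖f.coeff i‖ ≤ ‖f.coeff (i * (q : ℚ) ^ n)‖
      refine Eq.le ?_
      induction n with
      | zero => simp
      | succ n ih => rw [ih, pow_succ, ← mul_assoc, hnorm']
  · refine hwf (fun n => i / (q : ℚ) ^ n) ?_ fun n => ?_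
    · refine strictAnti_nat_of_succ_lt fun n => ?_
      rw [pow_succ, ← div_div]
      exact div_lt_self (by positivity) hq1
    · change ‖f.coeff i‖ ≤ ‖f.coeff (i / (q : ℚ) ^ n)‖
      refine Eq.le ?_
      induction n with
      | zero => simp
      | succ n ih => rw [ih, pow_succ, ← div_div, hnorm]

end Iterate

/-! ### Pure modules over K and over the extended Robba ring -/

section Purity

variable {K : Type u} [NontriviallyNormedField K] [IsUltrametricDist K]

theorem lang_of_isTrivial {φ : K →+* K} (hφ : ∀ x, ‖φ x‖ = ‖x‖)
    (htriv : ∀ M : PhiMod φ, IsEtaleField φ hφ M → M.IsTrivial) : Lang φ := fun n A hA => by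
  obtain ⟨M, b, hM⟩ := PhiMod.exists_hasMatrix φ
    (hA.map ((NormedField.valuation (K := K)).integer.subtype.mapMatrix))
  exact PhiMod.exists_mul_map_eq_of_isTrivial hM
    (htriv M ((PhiMod.isEtale_iff _).2 ⟨n, b, A, hA, hM⟩))

variable [(NormedField.valuation (K := K)).IsRankOneDiscrete]

/-- All uniformizers have the same norm, so the existential in the definitions of the valuations can
be read with any fixed one. -/
theorem exists_uniformizer_norm_iff {ϖ : K}
    (hϖ : (NormedField.valuation (K := K)).IsUniformizer ϖ) {P : ℝ → Prop} :
    (∃ ϖ' : K, (NormedField.valuation (K := K)).IsUniformizer ϖ' ∧ P ‖ϖ'‖) ↔ P ‖ϖ‖ := by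
  refine ⟨fun ⟨ϖ', hϖ', h⟩ => ?_, fun h => ⟨ϖ, hϖ, h⟩⟩
  have h1 : NormedField.valuation ϖ = NormedField.valuation ϖ' :=
    ((Valuation.IsUniformizer.iff).1 hϖ).trans ((Valuation.IsUniformizer.iff).1 hϖ').symm
  have h2 : ‖ϖ‖ = ‖ϖ'‖ := congrArg NNReal.toReal h1
  rwa [h2]

theorem fieldOrd_iff {ϖ : K} (hϖ : (NormedField.valuation (K := K)).IsUniformizer ϖ) {x : K}
    {n : ℤ} : fieldOrd x n ↔ ‖x‖ = ‖ϖ‖ ^ n :=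
  exists_uniformizer_norm_iff hϖ (P := fun t => ‖x‖ = t ^ n)

/-- A module over `K` is pure of slope `c/d` if and only if it has the right degree and a basis on
which `φ^d` acts by `ϖ^c`. -/
theorem isPureField_iff {φ : K →+* K} (hφ : ∀ x, ‖φ x‖ = ‖x‖) (hL : Lang φ) {ϖ : K}
    (hϖ : (NormedField.valuation (K := K)).IsUniformizer ϖ) {s : ℚ} {M : PhiMod φ} :
    IsPureField φ hφ s M ↔
      (∃ n : ℤ, M.HasDegree fieldOrd n ∧ (n : ℚ) = s * finrank K M.carrier) ∧
      ∃ (n : ℕ) (b : Basis (Fin n) K M.carrier), ∀ j, M.iter s.den (b j) = ϖ ^ s.num • b j := by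
  have hϖ0 : ϖ ≠ 0 := norm_pos_iff.1 (norm_uniformizer_pos hϖ)
  have key := PhiMod.isPure_iff (mem_integer_of_isometric φ hφ) (ord := fieldOrd) (s := s)
    (M := M) ?_ ((Units.mk0 ϖ hϖ0) ^ s.num) ?_ ?_
  · simp only [Units.val_zpow_eq_zpow_val, Units.val_mk0] at key
    exact key
  · intro n A hA
    obtain ⟨m, hm⟩ := Nat.exists_eq_succ_of_ne_zero s.den_nz
    rw [hm]
    exact hL.pow m n A hA
  · rw [fieldOrd_iff hϖ]
    simp
  · intro ν hν hord
    rw [fieldOrd_iff hϖ] at hord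
    have h1 : ‖ν * ϖ ^ s.num‖ = 1 := by
      rw [norm_mul, hord, norm_zpow, ← zpow_add₀ (norm_uniformizer_pos hϖ).ne', neg_add_cancel,
        zpow_zero]
    have h2 : ‖(ν * ϖ ^ s.num)⁻¹‖ = 1 := by rw [norm_inv, h1, inv_one]
    have h3 : ν * ϖ ^ s.num ≠ 0 := norm_pos_iff.1 (by rw [h1]; exact one_pos)
    refine ⟨⟨⟨_, mem_integer_iff_norm.2 h1.le⟩, ⟨_, mem_integer_iff_norm.2 h2.le⟩,
      Subtype.ext (mul_inv_cancel₀ h3), Subtype.ext (inv_mul_cancel₀ h3)⟩, ?_⟩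
    simp

/-- The degree of a module over `K` with a basis on which `φ^d` acts by `ϖ^c`. -/
theorem exists_hasDegree_fieldOrd {φ : K →+* K} (hφ : ∀ x, ‖φ x‖ = ‖x‖) {ϖ : K}
    (hϖ : (NormedField.valuation (K := K)).IsUniformizer ϖ) {s : ℚ} {M : PhiMod φ} {n : ℕ}
    {b : Basis (Fin n) K M.carrier} (hb : ∀ j, M.iter s.den (b j) = ϖ ^ s.num • b j) :
    ∃ k : ℤ, M.HasDegree fieldOrd k ∧ (k : ℚ) = s * finrank K M.carrier := by
  have hA := M.hasMatrix_toMatrix b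
  set A := b.toMatrix fun i => M.Φ (b i)
  have hdet0 : A.det ≠ 0 := ((Matrix.isUnit_iff_isUnit_det _).1 hA.isUnit).ne_zero
  obtain ⟨k, hk⟩ := exists_norm_eq_zpow hϖ hdet0
  refine ⟨k, PhiMod.hasDegree_iff.2 ⟨n, b, A, hA, (fieldOrd_iff hϖ).2 hk⟩, ?_⟩
  obtain ⟨B, hB, hdet⟩ := hA.exists_push (ν := normHom) hφ s.den
  have hBdiag : B = Matrix.diagonal fun _ => ϖ ^ s.num := by
    ext i j
    have h1 := congrArg (fun v => b.repr v i) ((hb j).symm.trans (hB j))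
    simp only [map_smul, Basis.repr_self, map_sum, Finsupp.coe_finsetSum, Finset.sum_apply,
      Finsupp.smul_apply, Finsupp.single_apply, smul_eq_mul, mul_ite, mul_one, mul_zero,
      Finset.sum_ite_eq', Finset.mem_univ, if_true] at h1
    rw [← h1, Matrix.diagonal_apply]
    simp only [eq_comm]
  -- The norm of the determinant of Φ^d computed in two ways gives n c = k d, so the degree
  -- condition is automatic.
  have h2 : (‖ϖ‖ ^ s.num) ^ n = (‖ϖ‖ ^ k) ^ s.den := by
    rw [← hk, ← norm_zpow, ← norm_pow]
    have h3 : ‖B.det‖ = ‖A.det‖ ^ s.den := hdet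
    rw [hBdiag, Matrix.det_diagonal, Finset.prod_const, Finset.card_univ, Fintype.card_fin] at h3
    exact h3
  rw [← zpow_natCast, ← zpow_natCast, ← zpow_mul, ← zpow_mul] at h2
  have h4 := zpow_right_injective₀ (norm_uniformizer_pos hϖ)
    (norm_uniformizer_lt_one hϖ).ne h2
  rw [finrank_eq_card_basis b, Fintype.card_fin]
  have h5 : (s.num : ℚ) * n = k * s.den := by exact_mod_cast h4
  have h6 : (s.den : ℚ) ≠ 0 := by exact_mod_cast s.den_nz
  conv_rhs => rw [← Rat.num_div_den s]
  rw [div_mul_eq_mul_div, h5, mul_div_cancel_right₀ _ h6]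

theorem extRobbaOrd_iff {ϖ : K} (hϖ : (NormedField.valuation (K := K)).IsUniformizer ϖ)
    {f : ExtRobba K} {n : ℤ} :
    extRobbaOrd f n ↔ IsGreatest (Set.range fun i => ‖f.coeff i‖) (‖ϖ‖ ^ n) :=
  exists_uniformizer_norm_iff hϖ
    (P := fun t => IsGreatest (Set.range fun i => ‖f.coeff i‖) (t ^ n))

variable [CompleteSpace K]

theorem extRobbaOrd_algebraMap {x : K} {n : ℤ} (h : fieldOrd x n) :
    extRobbaOrd (algebraMap K (ExtRobba K) x) n := by
  obtain ⟨ϖ, hϖ, hx⟩ := h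
  refine ⟨ϖ, hϖ, ⟨0, ?_⟩, ?_⟩
  · change ‖(algebraMap K (ExtRobba K) x).coeff 0‖ = _
    rw [algebraMap_coeff_zero, hx]
  · rintro _ ⟨i, rfl⟩
    change ‖(algebraMap K (ExtRobba K) x).coeff i‖ ≤ _
    by_cases hi : i = 0
    · rw [hi, algebraMap_coeff_zero, hx]
    · rw [algebraMap_coeff_of_ne hi, norm_zero]
      positivity

/-- A module over the extended Robba ring is pure of slope `c/d` if and only if it has the right
degree and a basis on which `φ^d` acts by `ϖ^c`. -/
theorem isPureExtRobba_iff {φ : K →+* K} (hφ : ∀ x, ‖φ x‖ = ‖x‖) (hbij : Function.Bijective φ)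
    (hL : Lang φ) {ϖ : K} (hϖ : (NormedField.valuation (K := K)).IsUniformizer ϖ)
    (hϖφ : φ ϖ = ϖ) {q : ℕ} (hq : 1 < q) {s : ℚ} {M : PhiMod (ExtRobba.frob φ hφ q hq)} :
    IsPureExtRobba φ hφ q hq s M ↔
      (∃ n : ℤ, M.HasDegree extRobbaOrd n ∧ (n : ℚ) = s * finrank (ExtRobba K) M.carrier) ∧
      ∃ (n : ℕ) (b : Basis (Fin n) (ExtRobba K) M.carrier), ∀ j,
        M.iter s.den (b j) = algebraMap K (ExtRobba K) (ϖ ^ s.num) • b j := by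
  have hϖ0 : ϖ ≠ 0 := norm_pos_iff.1 (norm_uniformizer_pos hϖ)
  refine PhiMod.isPure_iff (ExtRobba.frob_mem_int φ hφ q hq) (ord := extRobbaOrd) (s := s)
    (M := M) ?_ (Units.map (algebraMap K (ExtRobba K)).toMonoidHom
      (Units.mk0 (ϖ ^ s.num) (zpow_ne_zero _ hϖ0))) ?_ ?_
  · intro n A hA
    have hLd : Lang (φ ^ s.den) := by
      obtain ⟨m, hm⟩ := Nat.exists_eq_succ_of_ne_zero s.den_nz
      rw [hm]
      exact hL.pow m
    have hqd := Nat.one_lt_pow s.den_nz hq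
    obtain ⟨U, hU, hAU⟩ := hLd.exists_int (norm_pow_apply hφ s.den) (bijective_pow hbij s.den) hϖ
      (pow_apply_eq_self hϖφ s.den) hqd A hA
    refine ⟨_, hU.map (ExtRobba.int : Subring (ExtRobba K)).subtype.mapMatrix, ?_⟩
    rw [frob_pow φ hφ q hq s.den hqd]
    conv_rhs => rw [← hAU, map_mul]
    rfl
  · refine extRobbaOrd_algebraMap ((fieldOrd_iff hϖ).2 ?_)
    change ‖(ϖ ^ s.num)⁻¹‖ = _
    rw [norm_inv, norm_zpow, zpow_neg]
  · intro ν hν hord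
    rw [extRobbaOrd_iff hϖ] at hord
    obtain ⟨⟨i, hi⟩, hle⟩ := hord
    have hz : ‖ϖ‖ ^ (-s.num) * ‖ϖ ^ s.num‖ = 1 := by
      rw [norm_zpow, ← zpow_add₀ (norm_uniformizer_pos hϖ).ne', neg_add_cancel, zpow_zero]
    have hcoeff : ∀ k, ‖(ν * algebraMap K (ExtRobba K) (ϖ ^ s.num)).coeff k‖ =
        ‖ν.coeff k‖ * ‖ϖ ^ s.num‖ := fun k => by
      rw [mul_comm, algebraMap_mul_coeff, norm_mul, mul_comm]
    have hmem : ν * algebraMap K (ExtRobba K) (ϖ ^ s.num) ∈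
        (ExtRobba.int : Subring (ExtRobba K)) := fun k => by
      rw [hcoeff, ← hz]
      exact mul_le_mul_of_nonneg_right (hle ⟨k, rfl⟩) (norm_nonneg _)
    -- The coefficient attaining the minimal valuation of ν has norm one after multiplication by
    -- ϖ^c, so the product reduces to something nonzero and is a unit of the integral subring.
    have hne : redHahn ⟨_, hmem⟩ ≠ 0 := fun h => by
      have h1 := (redHahn_eq_zero_iff _).1 h i
      change ‖(ν * algebraMap K (ExtRobba K) (ϖ ^ s.num)).coeff i‖ < 1 at h1
      rw [hcoeff, ← hz] at h1
      exact h1.ne (congrArg (· * ‖ϖ ^ s.num‖) hi)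
    obtain ⟨ν₀, hν₀⟩ := isUnit_int_of_redHahn_ne_zero hne
    exact ⟨ν₀, by rw [hν₀]; rfl⟩

end Purity

end Slopes

/-! ### The equivalence of categories -/

open CategoryTheory Slopes in
theorem proposition2p1p4 {K : Type u} [NontriviallyNormedField K] [IsUltrametricDist K]
    [CompleteSpace K] [(NormedField.valuation (K := K)).IsRankOneDiscrete]
    (φ : K →+* K) (hφ : ∀ x, ‖φ x‖ = ‖x‖) (hbij : Function.Bijective φ) (q : ℕ) (hq : 1 < q)
    (htriv : ∀ M : PhiMod φ, IsEtaleField φ hφ M → M.IsTrivial) (s : ℚ) :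
    ∃ h : ∀ M : (IsPureField φ hφ s).FullSubcategory,
        IsPureExtRobba φ hφ q hq s ((toExtRobba φ hφ q hq).obj M.obj),
      ((IsPureExtRobba φ hφ q hq s).lift
        ((IsPureField φ hφ s).ι ⋙ toExtRobba φ hφ q hq) h).IsEquivalence := by
  have hL := lang_of_isTrivial hφ htriv
  obtain ⟨ϖ, hϖ, hϖφ⟩ := exists_uniformizer_map_eq hφ hL
  have hz : IsUnit (ϖ ^ s.num) :=
    (zpow_ne_zero _ (norm_pos_iff.1 (norm_uniformizer_pos hϖ))).isUnit
  have hinj := algebraMap_extRobba_injective (K := K)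
  have hqd := Nat.one_lt_pow s.den_nz hq
  have hinv : ∀ x : ExtRobba K, (ExtRobba.frob φ hφ q hq ^ s.den) x = x →
      ∃ a, algebraMap K (ExtRobba K) a = x := fun x hx => by
    rw [frob_pow φ hφ q hq s.den hqd] at hx
    exact exists_algebraMap_eq_of_frob_eq _ _ hx
  have h : ∀ M : (IsPureField φ hφ s).FullSubcategory,
      IsPureExtRobba φ hφ q hq s ((toExtRobba φ hφ q hq).obj M.obj) := fun M => by
    obtain ⟨⟨k, hk, hks⟩, n, b, hb⟩ := (isPureField_iff hφ hL hϖ).1 M.property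
    refine (isPureExtRobba_iff hφ hbij hL hϖ hϖφ hq).2 ⟨⟨k,
      hk.baseChange (ExtRobba.algebraMap_frob φ hφ q hq) fun _ _ => extRobbaOrd_algebraMap, ?_⟩,
      n, b.baseChange (ExtRobba K),
      PhiMod.iter_baseChange_basis (ExtRobba.algebraMap_frob φ hφ q hq) hb⟩
    rw [hks, Module.finrank_eq_card_basis b]
    exact congrArg (fun t : ℕ => s * (t : ℚ))
      (Module.finrank_eq_card_basis (b.baseChange (ExtRobba K))).symm
  refine ⟨h, @Functor.IsEquivalence.mk _ _ _ _ _ ⟨fun {M N f g} hfg => ?_⟩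
    ⟨fun {M N} f => ?_⟩ ⟨fun P => ?_⟩⟩
  · exact ObjectProperty.hom_ext _ (PhiMod.baseChange_faithful _ hinj
      (congrArg (fun t => t.hom) hfg))
  · obtain ⟨-, m, e, he⟩ := (isPureField_iff hφ hL hϖ).1 M.property
    obtain ⟨-, n, e', he'⟩ := (isPureField_iff hφ hL hϖ).1 N.property
    obtain ⟨g, hg⟩ := PhiMod.baseChange_full (ExtRobba.algebraMap_frob φ hφ q hq) hinj hinv hz
      he he' f.hom
    exact ⟨⟨g⟩, ObjectProperty.hom_ext _ hg⟩
  · obtain ⟨-, n, e, he⟩ := (isPureExtRobba_iff hφ hbij hL hϖ hϖφ hq).1 P.property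
    have hunit : ∀ x : K, IsUnit (algebraMap K (ExtRobba K) x) → IsUnit x := fun x hx =>
      isUnit_iff_ne_zero.2 fun h0 => not_isUnit_zero (M₀ := ExtRobba K)
        (by rwa [h0, map_zero] at hx)
    obtain ⟨M, b, hb, ⟨f⟩⟩ := PhiMod.exists_baseChange_iso
      (ExtRobba.algebraMap_frob φ hφ q hq) hinj hunit hinv hz
      (by rw [map_zpow₀, hϖφ]) he
    -- The descended basis, on which φ^d acts by ϖ^c, forces the degree, so nothing about degrees
    -- has to be descended from P.
    have hM : IsPureField φ hφ s M := (isPureField_iff hφ hL hϖ).2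
      ⟨exists_hasDegree_fieldOrd hφ hϖ hb, n, b, hb⟩
    exact ⟨⟨M, hM⟩, ⟨(IsPureExtRobba φ hφ q hq s).fullyFaithfulι.preimageIso f⟩⟩
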